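/- Let $N\ge 2$, $e\in[0,1)$, and let $b$ satisfy $0<b_0\le b\le b_1<\infty$ on $[-1,1]$ and be nondecreasing and convex on $(-1,1)$. For $u=v-v_*$, $\hat u=u/|u|$ and $\sigma\in\mathbb S^{N-1}$ put $v'=\frac{v+v_*}{2}+\frac12\big(\frac{1-e}{2}u+\frac{1+e}{2}|u|\sigma\big)$, and define the inelastic hard-sphere collision operator $Q$, with kernel $B=|u|\,b(\hat u\cdot\sigma)$, by duality: $$\int_{\mathbb R^N} Q(g,g)\,\psi\,dv=\int_{\mathbb R^N\times\mathbb R^N\times\mathbb S^{N-1}} g(v)\,g(v_*)\,|u|\,b(\hat u\cdot\sigma)\,\big(\psi(v')-\psi(v)\big)\,d\sigma\,dv_*\,dv .$$ Write $\|f\|_{L^1_q}=\int_{\mathbb R^N}|f(v)|(1+|v|^2)^{q/2}\,dv\in[0,\infty]$. Let $0\le g_{\rm in}\in L^1_2(\mathbb R^N)$ have zero momentum, $\int g_{\rm in}\,v\,dv=0$, mass $\rho=\int g_{\rm in}\,dv$ and kinetic energy $\mathcal E_{\rm in}=\int g_{\rm in}|v|^2\,dv$, and let $g\ge 0$ be a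 solution in $C(\mathbb R_+;L^1_2)\cap L^1_{\rm loc}(\mathbb R_+;L^1_3)$ of the rescaled Boltzmann equation $$\partial_t g=Q(g,g)-\nabla_v\cdot(v\,g),\qquad g(0,\cdot)=g_{\rm in},$$ in the weak sense: for all $\psi\in C_c^\infty(\mathbb R^N)$ and $t\ge0$, $$\int g(t)\,\psi\,dv=\int g_{\rm in}\,\psi\,dv+\int_0^t\Big(\int Q(g,g)\,\psi\,dv+\int g\,v\cdot\nabla\psi\,dv\Big)ds .$$ Then: (i) For any $s\ge2$ there is a constant $C_s>0$, depending only on $N$, $b$, $e$, $s$, $\rho$ and $\mathcal E_{\rm in}$, such that $\sup_{t\ge0}\|g(t,\cdot)\|_{L^1_s}\le\max\{\|g_{\rm in}\|_{L^1_s},C_s\}$. (ii) If $g_{\rm in}\,e^{r|v|^\eta}\in L^1(\mathbb R^N)$ for some $r>0$ and $\eta\in(0,1]$, then there are $C_1,r'>0$, depending only on $N$, $b$, $e$, $r$, $\eta$ and $g_{\rm in}$, such that $\sup_{t\ge0}\int_{\mathbb R^N} g(t,v)\,e^{r'|v|^\eta}\,dv\le C_1$. (iii) For any $\eta\in(0,1/2)$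 and $\tau>0$ there are $a_\eta,C_\eta\in(0,\infty)$, depending only on $N$, $b$, $e$, $\eta$, $\tau$, $\rho$ and $\mathcal E_{\rm in}$, such that $\sup_{t\ge\tau}\int_{\mathbb R^N} g(t,v)\,e^{a_\eta|v|^\eta}\,dv\le C_\eta$. -/

import Mathlib

open MeasureTheory Set Filter Topology
open scoped ENNReal ContDiff

noncomputable section

namespace Granular

/-- The velocity space `ℝ^N` with its Euclidean norm. -/
abbrev Vel (N : ℕ) := EuclideanSpace ℝ (Fin N)

/-- The unit sphere of `ℝ^N`, the set of the collision parameters `σ`. -/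
abbrev UnitSphere (N : ℕ) := Metric.sphere (0 : Vel N) 1

/-- The surface measure `dσ` of the unit sphere. -/
def sphereMeasure (N : ℕ) : Measure (UnitSphere N) :=
  (volume : Measure (Vel N)).toSphere

/-- The weighted norm `‖f‖_{L¹_q} = ∫ |f(v)| (1 + |v|²)^{q/2} dv`, with values in `[0, ∞]`. -/
def weightedNorm {N : ℕ} (q : ℝ) (f : Vel N → ℝ) : ℝ≥0∞ :=
  ∫⁻ v, ENNReal.ofReal (|f v| * (1 + ‖v‖ ^ 2) ^ (q / 2))

/-- `f` belongs to the weighted space `L¹_q(ℝ^N)`. -/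
def MemWeightedL1 {N : ℕ} (q : ℝ) (f : Vel N → ℝ) : Prop :=
  AEStronglyMeasurable f volume ∧ weightedNorm q f < ⊤

/-- The exponential moment `∫ f(v) e^{r |v|^η} dv` of a nonnegative function,
with values in `[0, ∞]`. -/
def expMoment {N : ℕ} (r η : ℝ) (f : Vel N → ℝ) : ℝ≥0∞ :=
  ∫⁻ v, ENNReal.ofReal (f v * Real.exp (r * ‖v‖ ^ η))

/-- The mass `∫ f dv`. -/
def mass {N : ℕ} (f : Vel N → ℝ) : ℝ := ∫ v, f v

/-- The momentum `∫ f v dv`. -/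
def momentum {N : ℕ} (f : Vel N → ℝ) : Vel N := ∫ v, f v • v

/-- The kinetic energy `∫ f |v|² dv`. -/
def energy {N : ℕ} (f : Vel N → ℝ) : ℝ := ∫ v, f v * ‖v‖ ^ 2

/-- The assumptions on the angular part `b` of the collision kernel `B = |u| b(û·σ)`: it lies
between two positive constants on `[-1, 1]`, and is nondecreasing and convex on `(-1, 1)`. -/
structure IsAngularKernel (b : ℝ → ℝ) : Prop where
  bounds : ∃ b₀ b₁ : ℝ, 0 < b₀ ∧ ∀ x ∈ Icc (-1 : ℝ) 1, b₀ ≤ b x ∧ b x ≤ b₁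
  mono : MonotoneOn b (Ioo (-1) 1)
  convex : ConvexOn ℝ (Ioo (-1) 1) b

/-- The post-collisional velocity
`v' = (v + v_*)/2 + u'/2`, `u' = (1-e)/2 u + (1+e)/2 |u| σ`, where `u = v - v_*` and `e` is the
normal restitution coefficient. -/
def postVel {N : ℕ} (e : ℝ) (v vs σ : Vel N) : Vel N :=
  (1 / 2 : ℝ) • (v + vs) +
    (1 / 2 : ℝ) • (((1 - e) / 2) • (v - vs) + ((1 + e) / 2 * ‖v - vs‖) • σ)

/-- The collision kernel `B(u, σ) = |u| b(û·σ)`, `û = u/|u|`. -/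
def collisionKernel {N : ℕ} (b : ℝ → ℝ) (u σ : Vel N) : ℝ :=
  ‖u‖ * b (inner ℝ (‖u‖⁻¹ • u) σ)

/-- The collision operator `Q(f, f)` in dual form, valid for every `e ∈ [0, 1]`:
`⟨Q(f,f), ψ⟩ = ∫∫∫ f f_* |u| b(û·σ) (ψ(v') - ψ(v)) dσ dv_* dv`
(the first term in the difference is the gain part, the second one the loss part). -/
def collisionDual {N : ℕ} (b : ℝ → ℝ) (e : ℝ) (f ψ : Vel N → ℝ) : ℝ :=
  ∫ v, ∫ vs, ∫ σ : UnitSphere N,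
    f v * f vs * collisionKernel b (v - vs) (σ : Vel N) *
      (ψ (postVel e v vs (σ : Vel N)) - ψ v) ∂(sphereMeasure N)

/-- Initial data: nonnegative functions in `L¹_2` with vanishing momentum. -/
structure IsInitialDatum {N : ℕ} (gin : Vel N → ℝ) : Prop where
  nonneg : ∀ᵐ v, 0 ≤ gin v
  mem : MemWeightedL1 2 gin
  momentum_eq_zero : momentum gin = 0

/-- `g` is a (nonnegative) solution in `C(ℝ₊; L¹_2) ∩ L¹_loc(ℝ₊; L¹_3)` of the rescaled equation
`∂g/∂t = Q(g,g) - ∇_v · (v g)` with initial datum `gin`. The equation is understood in the sense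
of distributions in `v`, integrated in time: the drift term, tested against `ψ`, is
`∫ g (v · ∇ψ) dv`. Only the values `g t` with `t ≥ 0` matter. -/
structure IsSolution {N : ℕ} (b : ℝ → ℝ) (e : ℝ) (gin : Vel N → ℝ) (g : ℝ → Vel N → ℝ) :
    Prop where
  nonneg : ∀ t, 0 ≤ t → ∀ᵐ v, 0 ≤ g t v
  mem : ∀ t, 0 ≤ t → MemWeightedL1 2 (g t)
  continuous : ∀ t₀, 0 ≤ t₀ →
    Tendsto (fun t => weightedNorm 2 (fun v => g t v - g t₀ v)) (𝓝[Ici 0] t₀) (𝓝 0)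
  locInt : ∀ T : ℝ, ∫⁻ t in Icc 0 T, weightedNorm 3 (g t) < ⊤
  initial : g 0 =ᵐ[volume] gin
  weak_eq : ∀ ψ : Vel N → ℝ, ContDiff ℝ ∞ ψ → HasCompactSupport ψ → ∀ t, 0 ≤ t →
    ∫ v, g t v * ψ v = (∫ v, gin v * ψ v) +
      ∫ s in (0 : ℝ)..t, (collisionDual b e (g s) ψ + ∫ v, g s v * fderiv ℝ ψ v v)

end Granular

end

/-! Test the equation against x h(x), where x = ⟨v⟩² and h is nonnegative, nondecreasing and
bounded. Symmetrizing under (v, v_*, σ) ↦ (v_*, v, -σ) brings in both outgoing velocities. Let X, Y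
be their values of ⟨·⟩², put y = ⟨v_*⟩² and S = x + y. Inelasticity gives X + Y = S - d with d =
(1-e²)/4 (|u|² - |u| u·σ) ≥ 0, so monotonicity of h alone yields X h(X) + Y h(Y) ≤ (S - d) h(S). The
collision bracket is therefore at most [S h(S) - x h(x) - y h(y)] - d h(S). The damping comes from
the energy lost in collisions, not from angular averaging as in the classical Povzner argument.

Gain: if y ≤ x, the square bracket is at most D √x h(x) y m(y). Multiplied by |u| ≤ 2√x it becomes a
product of two moments (`IsWeight.norm_mul_povzner_le`). Loss: |u| d h(x) consists of |u|³ h(x) and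
a term odd in σ, which integrates to zero. Since |u|³ ≥ |v|³ - 3|v| v·v_* and the momentum vanishes,
what remains is a multiple of ρ ∫ g h(x) |v|³, one power of |v| above the moment F = ∫ g x h(x)
itself (`IsWeight.collisionDual_le`). This loss absorbs the gain, the drift and a little more: the
time derivative of F is at most -λF + 2λ h(R) ∫ g min(x, R), even with an extra κ ∫ g h(x) ⟨v⟩³
added (`IsWeight.generator_le`).

Three weights are used. h = 1 bounds the second moment. A truncation of x^q, with m = 1, gives (i).
A truncation of exp(r x^{η/2}), with m = h, has a gain quadratic in F; for small r one has h(R) < 2,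
and F starting below M cannot cross 4M (`IsSolution.exp_moment_lt`). The rate r may even increase in
time, because its derivative costs at most κ ∫ g h(x) ⟨v⟩³. A constant rate gives (ii); the rate a
min(1, t/τ), which starts from the second moment, gives (iii).

Bounded h keeps all these quantities meaningful for solutions in C(L¹_2) ∩ L¹_loc(L¹_3)
(`IsSolution.weak_eq_admissible`). The bounds do not depend on the truncation, which is removed by
Fatou's lemma. -/

namespace Granular

variable {N : ℕ}

/-! ### The Japanese bracket -/

/-- The Japanese bracket `⟨v⟩ = (1 + |v|²)^{1/2}`. -/
noncomputable def jap (v : Vel N) : ℝ := √(1 + ‖v‖ ^ 2)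

lemma jap_sq (v : Vel N) : jap v ^ 2 = 1 + ‖v‖ ^ 2 :=
  Real.sq_sqrt (by positivity)

lemma one_le_jap (v : Vel N) : 1 ≤ jap v :=
  Real.one_le_sqrt.2 (by nlinarith [sq_nonneg ‖v‖])

lemma jap_pos (v : Vel N) : 0 < jap v := one_pos.trans_le (one_le_jap v)

lemma norm_le_jap (v : Vel N) : ‖v‖ ≤ jap v :=
  Real.le_sqrt_of_sq_le (by linarith)

lemma one_le_jap_sq (v : Vel N) : 1 ≤ jap v ^ 2 := one_le_pow₀ (one_le_jap v)

lemma continuous_jap : Continuous (jap : Vel N → ℝ) := by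
  unfold jap; fun_prop

lemma jap_rpow (v : Vel N) (s : ℝ) : (1 + ‖v‖ ^ 2) ^ (s / 2) = jap v ^ s := by
  rw [← jap_sq, ← Real.rpow_natCast, ← Real.rpow_mul (jap_pos v).le]
  congr 1; push_cast; ring

/-! ### The sphere measure -/

open scoped Pointwise in
-- The measure of a subset of the sphere is a multiple of the Lebesgue measure of the cone over it,
-- and Lebesgue measure is invariant under v ↦ -v. Used both to exchange the particles and to
-- discard terms odd in σ.
lemma measurePreserving_neg_sphere :
    MeasurePreserving (fun σ : UnitSphere N => -σ) (sphereMeasure N) (sphereMeasure N) := by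
  have hm : Measurable (fun σ : UnitSphere N => -σ) := continuous_neg.measurable
  refine ⟨hm, Measure.ext fun s hs => ?_⟩
  rw [Measure.map_apply hm hs, sphereMeasure, Measure.toSphere_apply' _ hs,
    Measure.toSphere_apply' _ (hm hs)]
  congr 1
  have : Ioo (0 : ℝ) 1 • ((↑) '' ((fun σ : UnitSphere N => -σ) ⁻¹' s) : Set (Vel N))
      = -(Ioo (0 : ℝ) 1 • ((↑) '' s : Set (Vel N))) := by
    ext w
    simp only [Set.mem_smul, mem_image, mem_preimage, Set.mem_neg]
    constructor
    · rintro ⟨r, hr, _, ⟨σ, hσ, rfl⟩, rfl⟩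
      exact ⟨r, hr, _, ⟨-σ, hσ, rfl⟩, by simp⟩
    · rintro ⟨r, hr, _, ⟨σ, hσ, rfl⟩, h⟩
      refine ⟨r, hr, _, ⟨-σ, by simpa using hσ, rfl⟩, ?_⟩
      rw [← neg_neg w, ← h]; simp
  rw [this, Measure.measure_neg]

instance : IsFiniteMeasure (sphereMeasure N) := by
  unfold sphereMeasure; infer_instance

/-- The total mass of the sphere. -/
noncomputable def sphereArea (N : ℕ) : ℝ := (sphereMeasure N).real univ

lemma sphereArea_pos (hN : 2 ≤ N) : 0 < sphereArea N := by
  have : Nonempty (Fin N) := ⟨⟨0, by omega⟩⟩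
  have h : sphereMeasure N ≠ 0 := Measure.toSphere_ne_zero _
  exact (measureReal_nonneg).lt_of_ne' (by
    rw [Measure.real, Ne, ENNReal.toReal_eq_zero_iff]
    simp [measure_ne_top, h])

lemma norm_sphere (σ : UnitSphere N) : ‖(σ : Vel N)‖ = 1 := by simp

/-! ### The collision kernel -/

lemma inner_unit_mem {u σ : Vel N} (hσ : ‖σ‖ = 1) :
    inner ℝ (‖u‖⁻¹ • u) σ ∈ Icc (-1 : ℝ) 1 := by
  have h1 : ‖(‖u‖⁻¹ • u)‖ ≤ 1 := by
    rw [norm_smul, norm_inv, norm_norm]; exact inv_mul_le_one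
  have h2 := abs_real_inner_le_norm (‖u‖⁻¹ • u) σ
  rw [hσ, mul_one] at h2
  exact abs_le.1 (h2.trans h1)

/-- Convexity makes `b` continuous on the open interval, and only the two endpoints remain.
Agreement on [-1, 1] is enough, since û·σ lies there. -/
lemma IsAngularKernel.exists_measurable {b : ℝ → ℝ} (hb : IsAngularKernel b) :
    ∃ b' : ℝ → ℝ, Measurable b' ∧ ∀ x ∈ Icc (-1 : ℝ) 1, b' x = b x := by
  classical
  have hc : ContinuousOn b (Ioo (-1) 1) := hb.convex.continuousOn isOpen_Ioo
  have h0 : Measurable ((Ioo (-1 : ℝ) 1).piecewise b (fun _ => (0 : ℝ))) :=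
    hc.measurable_piecewise continuousOn_const measurableSet_Ioo
  refine ⟨fun x => if x = 1 then b 1 else if x = -1 then b (-1) else
      (Ioo (-1 : ℝ) 1).piecewise b (fun _ => (0 : ℝ)) x, ?_, ?_⟩
  · exact Measurable.ite (measurableSet_singleton _) measurable_const
      (Measurable.ite (measurableSet_singleton _) measurable_const h0)
  · intro x hx
    by_cases h1 : x = 1
    · simp [h1]
    by_cases h2 : x = -1
    · subst h2; norm_num
    · have : x ∈ Ioo (-1 : ℝ) 1 := ⟨hx.1.lt_of_ne' h2, hx.2.lt_of_ne h1⟩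
      simp [h1, h2, Set.piecewise_eq_of_mem _ _ _ this]

lemma measurable_collisionKernel {b : ℝ → ℝ} (hb : IsAngularKernel b) :
    Measurable (fun p : Vel N × Vel N × UnitSphere N =>
      collisionKernel b (p.1 - p.2.1) (p.2.2 : Vel N)) := by
  obtain ⟨b', hm, hb'⟩ := hb.exists_measurable
  have : (fun p : Vel N × Vel N × UnitSphere N =>
      collisionKernel b (p.1 - p.2.1) (p.2.2 : Vel N)) = fun p =>
      ‖p.1 - p.2.1‖ * b' (inner ℝ (‖p.1 - p.2.1‖⁻¹ • (p.1 - p.2.1)) (p.2.2 : Vel N)) := by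
    funext p
    rw [collisionKernel, hb' _ (inner_unit_mem (norm_sphere _))]
  rw [this]
  have h1 : Measurable (fun p : Vel N × Vel N × UnitSphere N => p.1 - p.2.1) := by fun_prop
  have h2 : Measurable (fun p : Vel N × Vel N × UnitSphere N => (p.2.2 : Vel N)) := by fun_prop
  exact h1.norm.mul (hm.comp ((h1.norm.inv.smul h1).inner h2))

/-- Exchanging the particles turns u into -u, and reversing σ at the same time makes `postVel`
return the second outgoing velocity v'_*. This invariance is what permits the symmetrization. -/
lemma collisionKernel_neg (b : ℝ → ℝ) (u σ : Vel N) :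
    collisionKernel b (-u) (-σ) = collisionKernel b u σ := by
  simp [collisionKernel, inner_neg_left, inner_neg_right]

lemma continuous_postVel (e : ℝ) : Continuous (fun p : Vel N × Vel N × UnitSphere N =>
    postVel e p.1 p.2.1 (p.2.2 : Vel N)) := by
  unfold postVel; fun_prop

/-- Dissipation of kinetic energy in a collision. -/
lemma jap_sq_postVel_add (e : ℝ) (v vs : Vel N) {σ : Vel N} (hσ : ‖σ‖ = 1) :
    jap (postVel e v vs σ) ^ 2 + jap (postVel e vs v (-σ)) ^ 2 =
      jap v ^ 2 + jap vs ^ 2 -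
        (1 - e ^ 2) / 4 * (‖v - vs‖ ^ 2 - ‖v - vs‖ * inner ℝ (v - vs) σ) := by
  have hn : ‖v - vs‖ ^ 2 = ‖v‖ ^ 2 - 2 * inner ℝ v vs + ‖vs‖ ^ 2 := norm_sub_sq_real v vs
  have hs : inner ℝ σ σ = (1 : ℝ) := by rw [real_inner_self_eq_norm_sq, hσ]; norm_num
  have hv : inner ℝ v v = ‖v‖ ^ 2 := real_inner_self_eq_norm_sq v
  have hvs : inner ℝ vs vs = ‖vs‖ ^ 2 := real_inner_self_eq_norm_sq vs
  simp only [jap_sq]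
  rw [← real_inner_self_eq_norm_sq (postVel e v vs σ),
    ← real_inner_self_eq_norm_sq (postVel e vs v (-σ))]
  simp only [postVel, norm_sub_rev vs v]
  generalize ‖v - vs‖ = n at *
  simp only [inner_add_left, inner_add_right, inner_sub_left, inner_sub_right, inner_smul_left,
    inner_smul_right, inner_neg_left, inner_neg_right, hs, hv, hvs,
    real_inner_comm v vs, real_inner_comm v σ, real_inner_comm vs σ, RCLike.conj_to_real] at hn ⊢
  linear_combination (((1 + e) / 2) ^ 2 / 2 + (1 - e^2)/4) * hn

lemma IsAngularKernel.bounds_kernel {b : ℝ → ℝ} {b₀ b₁ : ℝ}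
    (hb : ∀ x ∈ Icc (-1 : ℝ) 1, b₀ ≤ b x ∧ b x ≤ b₁) (u : Vel N) {σ : Vel N} (hσ : ‖σ‖ = 1) :
    b₀ * ‖u‖ ≤ collisionKernel b u σ ∧ collisionKernel b u σ ≤ b₁ * ‖u‖ := by
  have := hb _ (inner_unit_mem (u := u) hσ)
  unfold collisionKernel
  constructor <;> nlinarith [norm_nonneg u]

/-! ### The collision integral as an integral over a product space -/

/-- The product measure `dv dv_* dσ`. -/
noncomputable abbrev collMeasure (N : ℕ) : Measure (Vel N × Vel N × UnitSphere N) :=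
  (volume : Measure (Vel N)).prod ((volume : Measure (Vel N)).prod (sphereMeasure N))

/-- The integrand of the (polarized) collision operator. -/
noncomputable def collInt (b : ℝ → ℝ) (e : ℝ) (f f' ψ : Vel N → ℝ)
    (p : Vel N × Vel N × UnitSphere N) : ℝ :=
  f p.1 * f' p.2.1 * collisionKernel b (p.1 - p.2.1) (p.2.2 : Vel N) *
    (ψ (postVel e p.1 p.2.1 (p.2.2 : Vel N)) - ψ p.1)

lemma aestronglyMeasurable_tensor {f f' : Vel N → ℝ} (hf : AEStronglyMeasurable f volume)
    (hf' : AEStronglyMeasurable f' volume) :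
    AEStronglyMeasurable (fun p : Vel N × Vel N × UnitSphere N => f p.1 * f' p.2.1)
      (collMeasure N) :=
  hf.comp_fst.mul (hf'.comp_fst.comp_snd)

lemma integrable_tensor {f f' : Vel N → ℝ} (hf : Integrable f) (hf' : Integrable f') :
    Integrable (fun p : Vel N × Vel N × UnitSphere N => f p.1 * f' p.2.1) (collMeasure N) := by
  have h := hf.mul_prod (hf'.mul_prod (integrable_const (μ := sphereMeasure N) (1 : ℝ)))
  simpa using h

lemma integral_tensor (f f' : Vel N → ℝ) :
    ∫ p, f p.1 * f' p.2.1 ∂(collMeasure N) = (∫ v, f v) * (∫ v, f' v) * sphereArea N := by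
  have h := integral_prod_mul (μ := (volume : Measure (Vel N)))
    (ν := (volume : Measure (Vel N)).prod (sphereMeasure N)) f (fun q => f' q.1 * 1)
  rw [integral_prod_mul f' (fun _ => (1 : ℝ))] at h
  simp only [mul_one, integral_const, smul_eq_mul] at h
  rw [h, sphereArea, mul_assoc]

lemma aestronglyMeasurable_collInt {b : ℝ → ℝ} (hb : IsAngularKernel b) (e : ℝ)
    {f f' ψ : Vel N → ℝ} (hf : AEStronglyMeasurable f volume)
    (hf' : AEStronglyMeasurable f' volume) (hψ : Continuous ψ) :
    AEStronglyMeasurable (collInt b e f f' ψ) (collMeasure N) := by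
  refine ((aestronglyMeasurable_tensor hf hf').mul
    (measurable_collisionKernel hb).aestronglyMeasurable).mul ?_
  exact ((hψ.comp (continuous_postVel e)).sub (hψ.comp continuous_fst)).aestronglyMeasurable

lemma collisionKernel_nonneg {b : ℝ → ℝ} (hb : IsAngularKernel b) (u : Vel N)
    (σ : UnitSphere N) : 0 ≤ collisionKernel b u σ := by
  obtain ⟨b₀, b₁, h0, h⟩ := hb.bounds
  exact (mul_nonneg h0.le (norm_nonneg u)).trans
    (IsAngularKernel.bounds_kernel h u (norm_sphere σ)).1

lemma norm_sub_le_jap (v vs : Vel N) : ‖v - vs‖ ≤ jap v + jap vs :=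
  (norm_sub_le _ _).trans (add_le_add (norm_le_jap v) (norm_le_jap vs))

lemma collisionKernel_le {b : ℝ → ℝ} {b₀ b₁ : ℝ} (h0 : 0 < b₀)
    (h : ∀ x ∈ Icc (-1 : ℝ) 1, b₀ ≤ b x ∧ b x ≤ b₁) (v vs : Vel N) (σ : UnitSphere N) :
    collisionKernel b (v - vs) σ ≤ b₁ * (jap v + jap vs) := by
  have h1 : 0 ≤ b₁ := h0.le.trans ((h 0 (by norm_num)).1.trans (h 0 (by norm_num)).2)
  exact (IsAngularKernel.bounds_kernel h _ (norm_sphere σ)).2.trans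
    (mul_le_mul_of_nonneg_left (norm_sub_le_jap v vs) h1)

lemma dissipation_nonneg {e : ℝ} (he₀ : 0 ≤ e) (he₁ : e < 1) (u : Vel N) {σ : Vel N}
    (hσ : ‖σ‖ = 1) : 0 ≤ (1 - e ^ 2) / 4 * (‖u‖ ^ 2 - ‖u‖ * inner ℝ u σ) := by
  have h2 := real_inner_le_norm u σ
  rw [hσ, mul_one] at h2
  have : 0 ≤ (1 - e ^ 2) := by nlinarith
  have : 0 ≤ ‖u‖ * (‖u‖ - inner ℝ u σ) := mul_nonneg (norm_nonneg u) (by linarith)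
  have := mul_nonneg (show 0 ≤ (1 - e ^ 2) / 4 by linarith) this
  linarith [this, show ‖u‖ * (‖u‖ - inner ℝ u σ) = ‖u‖ ^ 2 - ‖u‖ * inner ℝ u σ by ring,
    show (1 - e ^ 2) / 4 * (‖u‖ * (‖u‖ - inner ℝ u σ)) =
      (1 - e ^ 2) / 4 * (‖u‖ ^ 2 - ‖u‖ * inner ℝ u σ) by ring]

lemma jap_sq_postVel_add_le {e : ℝ} (he₀ : 0 ≤ e) (he₁ : e < 1) (v vs : Vel N) {σ : Vel N}
    (hσ : ‖σ‖ = 1) :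
    jap (postVel e v vs σ) ^ 2 + jap (postVel e vs v (-σ)) ^ 2 ≤ jap v ^ 2 + jap vs ^ 2 := by
  have := dissipation_nonneg he₀ he₁ (v - vs) hσ
  rw [jap_sq_postVel_add e v vs hσ]; linarith

lemma jap_sq_postVel_le {e : ℝ} (he₀ : 0 ≤ e) (he₁ : e < 1) (v vs : Vel N) {σ : Vel N}
    (hσ : ‖σ‖ = 1) : jap (postVel e v vs σ) ^ 2 ≤ jap v ^ 2 + jap vs ^ 2 := by
  nlinarith [jap_sq_postVel_add_le he₀ he₁ v vs hσ]

/-- Separation of variables: with s = ⟨v⟩ and t = ⟨v_*⟩, relative speed times quadratic growth is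
dominated by products of an L¹_3 weight and an L¹_2 weight. -/
lemma add_mul_add_sq_le {s t : ℝ} (hs : 1 ≤ s) (ht : 1 ≤ t) :
    (s + t) * (s ^ 2 + t ^ 2) ≤ 2 * (s ^ 3 * t ^ 2 + s ^ 2 * t ^ 3) := by
  have hs2 : 1 ≤ s ^ 2 := one_le_pow₀ hs
  have ht2 : 1 ≤ t ^ 2 := one_le_pow₀ ht
  have : s ^ 2 + t ^ 2 ≤ 2 * (s ^ 2 * t ^ 2) := by nlinarith
  nlinarith [mul_le_mul_of_nonneg_left this (show 0 ≤ s + t by linarith)]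

/-- Pointwise bound of the collision integrand against test functions of quadratic growth. -/
lemma abs_collInt_le {b : ℝ → ℝ} {b₀ b₁ : ℝ} (h0 : 0 < b₀)
    (h : ∀ x ∈ Icc (-1 : ℝ) 1, b₀ ≤ b x ∧ b x ≤ b₁) (hb : IsAngularKernel b)
    {e : ℝ} (he₀ : 0 ≤ e) (he₁ : e < 1)
    {f f' ψ : Vel N → ℝ} {C : ℝ} (hψ : ∀ v, |ψ v| ≤ C * jap v ^ 2)
    (p : Vel N × Vel N × UnitSphere N) :
    |collInt b e f f' ψ p| ≤ 4 * C * b₁ *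
      ((|f p.1| * jap p.1 ^ 3) * (|f' p.2.1| * jap p.2.1 ^ 2) +
        (|f p.1| * jap p.1 ^ 2) * (|f' p.2.1| * jap p.2.1 ^ 3)) := by
  obtain ⟨v, vs, σ⟩ := p
  have hC : 0 ≤ C := by
    have := (abs_nonneg _).trans (hψ 0)
    exact nonneg_of_mul_nonneg_left this (pow_pos (jap_pos _) 2)
  have h1 : 0 ≤ b₁ := h0.le.trans ((h 0 (by norm_num)).1.trans (h 0 (by norm_num)).2)
  have hK := collisionKernel_nonneg hb (v - vs) σ
  have hK' := collisionKernel_le h0 h v vs σ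
  have hd : |ψ (postVel e v vs σ) - ψ v| ≤ 2 * C * (jap v ^ 2 + jap vs ^ 2) := by
    have a1 := hψ (postVel e v vs σ)
    have a2 := hψ v
    have a3 := mul_le_mul_of_nonneg_left (jap_sq_postVel_le he₀ he₁ v vs (norm_sphere σ)) hC
    have a4 : |ψ (postVel e v vs σ) - ψ v| ≤ |ψ (postVel e v vs σ)| + |ψ v| := abs_sub _ _
    nlinarith [mul_nonneg hC (sq_nonneg (jap vs))]
  simp only [collInt, abs_mul, abs_of_nonneg hK]
  have hj := add_mul_add_sq_le (one_le_jap v) (one_le_jap vs)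
  have hff : 0 ≤ |f v| * |f' vs| := by positivity
  have hJ : 0 ≤ jap v + jap vs := by linarith [one_le_jap v, one_le_jap vs]
  calc |f v| * |f' vs| * collisionKernel b (v - vs) σ * |ψ (postVel e v vs σ) - ψ v|
      ≤ |f v| * |f' vs| * (b₁ * (jap v + jap vs)) * (2 * C * (jap v ^ 2 + jap vs ^ 2)) := by
        gcongr
    _ = (2 * C * b₁ * (|f v| * |f' vs|)) * ((jap v + jap vs) * (jap v ^ 2 + jap vs ^ 2)) := by ring
    _ ≤ (2 * C * b₁ * (|f v| * |f' vs|)) *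
          (2 * (jap v ^ 3 * jap vs ^ 2 + jap v ^ 2 * jap vs ^ 3)) := by gcongr
    _ = _ := by ring

/-- Pointwise bound of the collision integrand against bounded test functions. -/
lemma abs_collInt_le_of_bounded {b : ℝ → ℝ} {b₀ b₁ : ℝ} (h0 : 0 < b₀)
    (h : ∀ x ∈ Icc (-1 : ℝ) 1, b₀ ≤ b x ∧ b x ≤ b₁) (hb : IsAngularKernel b)
    (e : ℝ) {f f' ψ : Vel N → ℝ} {C : ℝ} (hψ : ∀ v, |ψ v| ≤ C)
    (p : Vel N × Vel N × UnitSphere N) :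
    |collInt b e f f' ψ p| ≤ 4 * C * b₁ *
      ((|f p.1| * jap p.1 ^ 2) * (|f' p.2.1| * jap p.2.1 ^ 2)) := by
  obtain ⟨v, vs, σ⟩ := p
  have hC : 0 ≤ C := (abs_nonneg _).trans (hψ 0)
  have h1 : 0 ≤ b₁ := h0.le.trans ((h 0 (by norm_num)).1.trans (h 0 (by norm_num)).2)
  have hK := collisionKernel_nonneg hb (v - vs) σ
  have hK' := collisionKernel_le h0 h v vs σ
  have hd : |ψ (postVel e v vs σ) - ψ v| ≤ 2 * C :=
    (abs_sub _ _).trans (by linarith [hψ (postVel e v vs σ), hψ v])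
  have hj : jap v + jap vs ≤ 2 * (jap v ^ 2 * jap vs ^ 2) := by
    have a1 := one_le_jap v
    have a2 := one_le_jap vs
    have a3 := one_le_jap_sq v
    have a4 := one_le_jap_sq vs
    nlinarith
  simp only [collInt, abs_mul, abs_of_nonneg hK]
  have hJ : 0 ≤ jap v + jap vs := by linarith [one_le_jap v, one_le_jap vs]
  calc |f v| * |f' vs| * collisionKernel b (v - vs) σ * |ψ (postVel e v vs σ) - ψ v|
      ≤ |f v| * |f' vs| * (b₁ * (jap v + jap vs)) * (2 * C) := by gcongr
    _ = (2 * C * b₁ * (|f v| * |f' vs|)) * (jap v + jap vs) := by ring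
    _ ≤ (2 * C * b₁ * (|f v| * |f' vs|)) * (2 * (jap v ^ 2 * jap vs ^ 2)) := by gcongr
    _ = _ := by ring

/-- Fubini: the operator is defined by iterated integrals, while the changes of variables act on the
product space. -/
lemma collisionDual_eq_of_integrable {b : ℝ → ℝ} {e : ℝ} {f ψ : Vel N → ℝ}
    (h : Integrable (collInt b e f f ψ) (collMeasure N)) :
    collisionDual b e f ψ = ∫ p, collInt b e f f ψ p ∂(collMeasure N) := by
  rw [integral_prod _ h]
  refine integral_congr_ae ?_
  filter_upwards [h.prod_right_ae] with v hv
  rw [integral_prod _ hv]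
  rfl

/-- A function of `L¹_3`. -/
structure InL13 (f : Vel N → ℝ) : Prop where
  meas : AEStronglyMeasurable f volume
  int : Integrable (fun v => f v * jap v ^ 3)

lemma integrable_of_weight_le {f w w' : Vel N → ℝ} (hf : AEStronglyMeasurable f volume)
    (hw : Continuous w) (h : Integrable (fun v => f v * w' v)) (C : ℝ)
    (hle : ∀ v, |w v| ≤ C * |w' v|) : Integrable (fun v => f v * w v) := by
  refine (h.norm.const_mul C).mono' (hf.mul hw.aestronglyMeasurable) (ae_of_all _ fun v => ?_)
  simp only [Real.norm_eq_abs, abs_mul]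
  nlinarith [mul_le_mul_of_nonneg_left (hle v) (abs_nonneg (f v))]

lemma InL13.weight {f : Vel N → ℝ} (hf : InL13 f) {w : Vel N → ℝ} (hw : Continuous w) (C : ℝ)
    (hle : ∀ v, |w v| ≤ C * jap v ^ 3) : Integrable (fun v => f v * w v) :=
  integrable_of_weight_le hf.meas hw hf.int C fun v => by
    rw [abs_of_pos (pow_pos (jap_pos v) 3)]; exact hle v

lemma jap_pow_le (v : Vel N) {m n : ℕ} (h : m ≤ n) : jap v ^ m ≤ jap v ^ n :=
  pow_le_pow_right₀ (one_le_jap v) h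

lemma InL13.weight_sq {f : Vel N → ℝ} (hf : InL13 f) {w : Vel N → ℝ} (hw : Continuous w) (C : ℝ)
    (hle : ∀ v, |w v| ≤ C * jap v ^ 2) : Integrable (fun v => f v * w v) :=
  hf.weight hw C fun v => (hle v).trans (mul_le_mul_of_nonneg_left (jap_pow_le v (by norm_num))
    (nonneg_of_mul_nonneg_left ((abs_nonneg _).trans (hle v)) (pow_pos (jap_pos v) 2)))

lemma InL13.int_jap_sq {f : Vel N → ℝ} (hf : InL13 f) : Integrable (fun v => f v * jap v ^ 2) :=
  hf.weight_sq (continuous_jap.pow 2) 1 fun v => by rw [abs_of_nonneg (sq_nonneg _), one_mul]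

lemma InL13.abs {f : Vel N → ℝ} (hf : InL13 f) : InL13 (fun v => |f v|) :=
  ⟨hf.meas.norm, hf.int.norm.congr (ae_of_all _ fun v => by
    simp [abs_of_pos (jap_pos v)])⟩

lemma integrable_collInt {b : ℝ → ℝ} (hb : IsAngularKernel b) {e : ℝ} (he₀ : 0 ≤ e)
    (he₁ : e < 1) {f ψ : Vel N → ℝ} (hf : InL13 f) (hψc : Continuous ψ) {C : ℝ}
    (hψ : ∀ v, |ψ v| ≤ C * jap v ^ 2) :
    Integrable (collInt b e f f ψ) (collMeasure N) := by
  obtain ⟨b₀, b₁, h0, h⟩ := hb.bounds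
  refine Integrable.mono' (((integrable_tensor hf.abs.int hf.abs.int_jap_sq).add
    (integrable_tensor hf.abs.int_jap_sq hf.abs.int)).const_mul (4 * C * b₁))
    (aestronglyMeasurable_collInt hb e hf.meas hf.meas hψc)
    (ae_of_all _ fun p => abs_collInt_le h0 h hb he₀ he₁ hψ p)

lemma abs_collisionDual_le {b : ℝ → ℝ} {b₀ b₁ : ℝ} (h0 : 0 < b₀)
    (h : ∀ x ∈ Icc (-1 : ℝ) 1, b₀ ≤ b x ∧ b x ≤ b₁) (hb : IsAngularKernel b) {e : ℝ}
    (he₀ : 0 ≤ e) (he₁ : e < 1) {f ψ : Vel N → ℝ} (hf : InL13 f) (hψc : Continuous ψ) {C : ℝ}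
    (hψ : ∀ v, |ψ v| ≤ C * jap v ^ 2) :
    |collisionDual b e f ψ| ≤ 8 * C * b₁ * sphereArea N * (∫ v, |f v| * jap v ^ 2) *
      ∫ v, |f v| * jap v ^ 3 := by
  rw [collisionDual_eq_of_integrable (integrable_collInt hb he₀ he₁ hf hψc hψ)]
  have i1 := integrable_tensor hf.abs.int hf.abs.int_jap_sq
  have i2 := integrable_tensor hf.abs.int_jap_sq hf.abs.int
  have hle := norm_integral_le_of_norm_le (f := collInt b e f f ψ) ((i1.add i2).const_mul (4 * C * b₁))
    (ae_of_all _ fun p => abs_collInt_le (f := f) (f' := f) h0 h hb he₀ he₁ hψ p)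
  refine hle.trans (le_of_eq ?_)
  simp only [Pi.add_apply]
  rw [integral_const_mul, integral_add i1 i2, integral_tensor (fun v => |f v| * jap v ^ 3)
    (fun v => |f v| * jap v ^ 2), integral_tensor (fun v => |f v| * jap v ^ 2)
    (fun v => |f v| * jap v ^ 3)]
  ring

/-! ### Symmetrization -/

lemma measurePreserving_swap :
    MeasurePreserving (fun p : Vel N × Vel N × UnitSphere N => (p.2.1, p.1, -p.2.2))
      (collMeasure N) (collMeasure N) := by
  have h1 : MeasurePreserving (fun p : Vel N × Vel N × UnitSphere N => ((p.1, p.2.1), p.2.2))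
      (collMeasure N) ((volume.prod volume).prod (sphereMeasure N)) :=
    (measurePreserving_prodAssoc volume volume (sphereMeasure N)).symm
  have h2 := (Measure.measurePreserving_swap (μ := (volume : Measure (Vel N)))
    (ν := (volume : Measure (Vel N)))).prod (measurePreserving_neg_sphere (N := N))
  exact (measurePreserving_prodAssoc volume volume (sphereMeasure N)).comp (h2.comp h1)

lemma measurePreserving_neg_angle :
    MeasurePreserving (fun p : Vel N × Vel N × UnitSphere N => (p.1, p.2.1, -p.2.2))
      (collMeasure N) (collMeasure N) :=
  (MeasurePreserving.id volume).prod ((MeasurePreserving.id volume).prod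
    measurePreserving_neg_sphere)

/-- Twice the collision integral, symmetrized with respect to the colliding particles. -/
lemma two_mul_collisionDual {b : ℝ → ℝ} {e : ℝ} {f ψ : Vel N → ℝ}
    (h : Integrable (collInt b e f f ψ) (collMeasure N)) :
    Integrable (fun p : Vel N × Vel N × UnitSphere N =>
      f p.1 * f p.2.1 * collisionKernel b (p.1 - p.2.1) (p.2.2 : Vel N) *
        (ψ (postVel e p.1 p.2.1 (p.2.2 : Vel N)) + ψ (postVel e p.2.1 p.1 (-(p.2.2 : Vel N)))
          - ψ p.1 - ψ p.2.1)) (collMeasure N) ∧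
    2 * collisionDual b e f ψ = ∫ p, f p.1 * f p.2.1 *
      collisionKernel b (p.1 - p.2.1) (p.2.2 : Vel N) *
        (ψ (postVel e p.1 p.2.1 (p.2.2 : Vel N)) + ψ (postVel e p.2.1 p.1 (-(p.2.2 : Vel N)))
          - ψ p.1 - ψ p.2.1) ∂(collMeasure N) := by
  have hs := measurePreserving_swap (N := N)
  have hinv : Function.Involutive
      (fun p : Vel N × Vel N × UnitSphere N => (p.2.1, p.1, -p.2.2)) := fun p => by simp
  have hme : MeasurableEmbedding
      (fun p : Vel N × Vel N × UnitSphere N => (p.2.1, p.1, -p.2.2)) :=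
    (MeasurableEquiv.ofInvolutive _ hinv hs.measurable).measurableEmbedding
  have h' : Integrable (fun p : Vel N × Vel N × UnitSphere N =>
      collInt b e f f ψ (p.2.1, p.1, -p.2.2)) (collMeasure N) := hs.integrable_comp_of_integrable h
  have heq := hs.integral_comp hme (collInt b e f f ψ)
  have hfun : ∀ p : Vel N × Vel N × UnitSphere N, f p.1 * f p.2.1 *
      collisionKernel b (p.1 - p.2.1) (p.2.2 : Vel N) *
        (ψ (postVel e p.1 p.2.1 (p.2.2 : Vel N)) + ψ (postVel e p.2.1 p.1 (-(p.2.2 : Vel N)))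
          - ψ p.1 - ψ p.2.1) =
      collInt b e f f ψ p + collInt b e f f ψ (p.2.1, p.1, -p.2.2) := by
    intro p
    have : collisionKernel b (p.2.1 - p.1) (-(p.2.2 : Vel N)) =
        collisionKernel b (p.1 - p.2.1) (p.2.2 : Vel N) := by
      rw [← neg_sub, collisionKernel_neg]
    simp only [collInt, coe_neg_sphere, this]
    ring
  simp only [hfun]
  refine ⟨h.add h', ?_⟩
  rw [integral_add h h', heq, ← collisionDual_eq_of_integrable h]
  ring

/-- Functions that are odd in the angle integrate to zero. -/
lemma integral_eq_zero_of_odd_angle {F : Vel N × Vel N × UnitSphere N → ℝ}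
    (h : ∀ p, F (p.1, p.2.1, -p.2.2) = -F p) : ∫ p, F p ∂(collMeasure N) = 0 := by
  have hs := measurePreserving_neg_angle (N := N)
  have hinv : Function.Involutive
      (fun p : Vel N × Vel N × UnitSphere N => (p.1, p.2.1, -p.2.2)) := fun p => by simp
  have hme : MeasurableEmbedding
      (fun p : Vel N × Vel N × UnitSphere N => (p.1, p.2.1, -p.2.2)) :=
    (MeasurableEquiv.ofInvolutive _ hinv hs.measurable).measurableEmbedding
  have heq := hs.integral_comp hme F
  simp only [h, integral_neg] at heq
  linarith

/-! ### Weights and the a priori inequality at a fixed time -/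

/-- Bounded weights `h` such that `x h(x)`, `x = ⟨v⟩²`, is an admissible test function whose
growth along collisions is controlled: the constant `D` and the function `m` enter the Povzner type
estimate, the constant `a` the estimate of the drift. The bound `H` is only used qualitatively. -/
structure IsWeight (h m : ℝ → ℝ) (D a H : ℝ) : Prop where
  smooth : ContDiffOn ℝ ∞ h (Ioi 0)
  nonneg : ∀ x, 1 ≤ x → 0 ≤ h x
  mono : MonotoneOn h (Ici 1)
  le : ∀ x, 1 ≤ x → h x ≤ H
  deriv_le : ∀ x, 1 ≤ x → x * deriv h x ≤ (D + a * √x) * h x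
  abs_deriv_le : ∀ x, 1 ≤ x → |x * deriv h x| ≤ H
  povzner : ∀ x y, 1 ≤ y → y ≤ x →
    (x + y) * h (x + y) - x * h x - y * h y ≤ D * √x * h x * (y * m y)
  D_nonneg : 0 ≤ D
  m_cont : ContinuousOn m (Ioi 0)
  m_nonneg : ∀ x, 1 ≤ x → 0 ≤ m x
  m_le : ∀ x, 1 ≤ x → m x ≤ H

/-- The test function `⟨v⟩² h(⟨v⟩²)`. -/
noncomputable def weightFn (h : ℝ → ℝ) (v : Vel N) : ℝ := jap v ^ 2 * h (jap v ^ 2)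

lemma continuous_comp_jap {h : ℝ → ℝ} (hh : ContinuousOn h (Ioi 0)) :
    Continuous (fun v : Vel N => h (jap v ^ 2)) := by
  refine continuous_iff_continuousAt.2 fun v => ?_
  have h1 : ContinuousAt h (jap v ^ 2) := hh.continuousAt (Ioi_mem_nhds (pow_pos (jap_pos v) 2))
  exact ContinuousAt.comp (f := fun v : Vel N => jap v ^ 2) h1
    (continuous_jap.pow 2).continuousAt

namespace IsWeight

variable {h m : ℝ → ℝ} {D a H : ℝ}

lemma continuous_h (W : IsWeight h m D a H) : Continuous (fun v : Vel N => h (jap v ^ 2)) :=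
  continuous_comp_jap W.smooth.continuousOn

lemma continuous_m (W : IsWeight h m D a H) : Continuous (fun v : Vel N => m (jap v ^ 2)) :=
  continuous_comp_jap W.m_cont

lemma continuous_weightFn (W : IsWeight h m D a H) : Continuous (weightFn h : Vel N → ℝ) :=
  (continuous_jap.pow 2).mul W.continuous_h

lemma abs_weightFn_le (W : IsWeight h m D a H) (v : Vel N) : |weightFn h v| ≤ H * jap v ^ 2 := by
  have h1 := W.nonneg _ (one_le_jap_sq v)
  have h2 := W.le _ (one_le_jap_sq v)
  rw [weightFn, abs_of_nonneg (by positivity)]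
  nlinarith [sq_nonneg (jap v)]

lemma H_nonneg (W : IsWeight h m D a H) : 0 ≤ H := (W.nonneg 1 le_rfl).trans (W.le 1 le_rfl)

lemma contDiff_weightFn (W : IsWeight h m D a H) : ContDiff ℝ ∞ (weightFn h : Vel N → ℝ) := by
  have h1 : ContDiff ℝ ∞ (fun v : Vel N => 1 + ‖v‖ ^ 2) := contDiff_const.add (contDiff_norm_sq ℝ)
  have h2 : ContDiff ℝ ∞ (fun v : Vel N => h (1 + ‖v‖ ^ 2)) :=
    W.smooth.comp_contDiff h1 fun v => by
      have : 0 ≤ ‖v‖ ^ 2 := by positivity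
      exact mem_Ioi.2 (by linarith)
  have : (weightFn h : Vel N → ℝ) = fun v => (1 + ‖v‖ ^ 2) * h (1 + ‖v‖ ^ 2) := by
    funext v; rw [weightFn, jap_sq]
  rw [this]
  exact h1.mul h2

lemma fderiv_weightFn (W : IsWeight h m D a H) (v : Vel N) :
    fderiv ℝ (weightFn h) v v =
      2 * ‖v‖ ^ 2 * (h (jap v ^ 2) + jap v ^ 2 * deriv h (jap v ^ 2)) := by
  have h0 : HasFDerivAt (fun v : Vel N => 1 + ‖v‖ ^ 2) (2 • innerSL ℝ v) v := by
    simpa using ((hasStrictFDerivAt_norm_sq v).hasFDerivAt).const_add (1 : ℝ)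
  have hx : (0 : ℝ) < 1 + ‖v‖ ^ 2 := by positivity
  have hd : HasDerivAt h (deriv h (1 + ‖v‖ ^ 2)) (1 + ‖v‖ ^ 2) :=
    ((W.smooth.differentiableOn (by norm_num)).differentiableAt (Ioi_mem_nhds hx)).hasDerivAt
  have h1 := ((hasDerivAt_id _).mul hd).comp_hasFDerivAt v h0
  have : (weightFn h : Vel N → ℝ) = (id * h) ∘ fun v => (1 + ‖v‖ ^ 2) := by
    funext v; simp [weightFn, jap_sq]
  rw [this, h1.fderiv, jap_sq]
  simp only [id, one_mul, smul_apply, smul_eq_mul, innerSL_apply_apply,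
    real_inner_self_eq_norm_sq, nsmul_eq_mul]
  push_cast; ring

lemma abs_fderiv_weightFn_le (W : IsWeight h m D a H) (v : Vel N) :
    |fderiv ℝ (weightFn h) v v| ≤ 4 * H * jap v ^ 2 := by
  rw [W.fderiv_weightFn]
  have h1 := W.nonneg _ (one_le_jap_sq v)
  have h2 := W.le _ (one_le_jap_sq v)
  have h3 := W.abs_deriv_le _ (one_le_jap_sq v)
  have h4 : ‖v‖ ^ 2 ≤ jap v ^ 2 := by rw [jap_sq]; linarith
  rw [abs_mul, abs_of_nonneg (by positivity)]
  have h5 : |h (jap v ^ 2) + jap v ^ 2 * deriv h (jap v ^ 2)| ≤ 2 * H :=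
    (abs_add_le _ _).trans (by rw [abs_of_nonneg h1]; linarith)
  calc 2 * ‖v‖ ^ 2 * |h (jap v ^ 2) + jap v ^ 2 * deriv h (jap v ^ 2)|
      ≤ 2 * jap v ^ 2 * (2 * H) := by gcongr
    _ = _ := by ring

/-- The only cubic contribution of the drift has coefficient 2a. It is of the same order as the
inelastic loss, so `a` will have to be small compared with the loss constant. -/
lemma fderiv_weightFn_le (W : IsWeight h m D a H) (v : Vel N) (ha : 0 ≤ a) :
    fderiv ℝ (weightFn h) v v ≤
      h (jap v ^ 2) * (2 * (1 + D) * jap v ^ 2 + 2 * a * jap v ^ 3) := by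
  rw [W.fderiv_weightFn]
  have h1 := W.nonneg _ (one_le_jap_sq v)
  have h3 := W.deriv_le _ (one_le_jap_sq v)
  rw [Real.sqrt_sq (jap_pos v).le] at h3
  have h4 : ‖v‖ ^ 2 ≤ jap v ^ 2 := by rw [jap_sq]; linarith
  have hD := W.D_nonneg
  have hJ := jap_pos v
  have h5 : 0 ≤ h (jap v ^ 2) + (D + a * jap v) * h (jap v ^ 2) := by positivity
  calc 2 * ‖v‖ ^ 2 * (h (jap v ^ 2) + jap v ^ 2 * deriv h (jap v ^ 2))
      ≤ 2 * ‖v‖ ^ 2 * (h (jap v ^ 2) + (D + a * jap v) * h (jap v ^ 2)) := by gcongr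
    _ ≤ 2 * jap v ^ 2 * (h (jap v ^ 2) + (D + a * jap v) * h (jap v ^ 2)) := by gcongr
    _ = _ := by ring

/-- The Povzner type estimate, multiplied by the relative speed. -/
lemma norm_mul_povzner_le (W : IsWeight h m D a H) (v vs : Vel N) :
    ‖v - vs‖ * ((jap v ^ 2 + jap vs ^ 2) * h (jap v ^ 2 + jap vs ^ 2) - weightFn h v
      - weightFn h vs) ≤
    2 * D * (weightFn h v * weightFn m vs + weightFn m v * weightFn h vs) := by
  -- The right-hand side contains both products precisely to be symmetric in the two velocities.
  wlog hle : jap vs ≤ jap v generalizing v vs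
  · have := this vs v (le_of_not_ge hle)
    rw [norm_sub_rev, add_comm (jap v ^ 2)]
    linarith
  have hsq : jap vs ^ 2 ≤ jap v ^ 2 := pow_le_pow_left₀ (jap_pos vs).le hle 2
  have h1 := W.povzner _ _ (one_le_jap_sq vs) hsq
  rw [Real.sqrt_sq (jap_pos v).le] at h1
  have hu : ‖v - vs‖ ≤ 2 * jap v := (norm_sub_le_jap v vs).trans (by linarith)
  have hJ := jap_pos v
  have hJs := jap_pos vs
  have a1 := W.nonneg _ (one_le_jap_sq v)
  have a2 := W.nonneg _ (one_le_jap_sq vs)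
  have a3 := W.m_nonneg _ (one_le_jap_sq v)
  have a4 := W.m_nonneg _ (one_le_jap_sq vs)
  have hD := W.D_nonneg
  simp only [weightFn]
  -- The factor √x = ⟨v⟩ allowed in `povzner` combines with |u| ≤ 2⟨v⟩ into ⟨v⟩², exactly the power
  -- already present in `weightFn h`.
  calc _ ≤ ‖v - vs‖ * (D * jap v * h (jap v ^ 2) * (jap vs ^ 2 * m (jap vs ^ 2))) := by gcongr
    _ ≤ 2 * jap v * (D * jap v * h (jap v ^ 2) * (jap vs ^ 2 * m (jap vs ^ 2))) := by gcongr
    _ = 2 * D * (jap v ^ 2 * h (jap v ^ 2) * (jap vs ^ 2 * m (jap vs ^ 2))) := by ring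
    _ ≤ _ := by
      gcongr
      have : 0 ≤ jap v ^ 2 * m (jap v ^ 2) * (jap vs ^ 2 * h (jap vs ^ 2)) := by positivity
      linarith

end IsWeight

/-! ### Gain and inelastic loss in the collision operator -/

/-- Tangent inequality for `|v - v_*|³`. -/
lemma norm_sub_cube_ge {E : Type*} [NormedAddCommGroup E] [InnerProductSpace ℝ E] (v z : E) :
    ‖v‖ ^ 3 - 3 * ‖v‖ * inner ℝ v z ≤ ‖v - z‖ ^ 3 := by
  have h1 : inner ℝ v (v - z) ≤ ‖v‖ * ‖v - z‖ := real_inner_le_norm _ _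
  rw [inner_sub_right, real_inner_self_eq_norm_sq] at h1
  have hv := norm_nonneg v
  have hz := norm_nonneg (v - z)
  -- With n = |v| and k = |v - z|, Cauchy–Schwarz times 3n leaves k³ - 3n²k + 2n³ = (k - n)²(k + 2n)
  -- ≥ 0.
  nlinarith [mul_le_mul_of_nonneg_left h1 hv,
    mul_nonneg (sq_nonneg (‖v - z‖ - ‖v‖)) (show 0 ≤ ‖v - z‖ + 2 * ‖v‖ by linarith)]

/-- Pointwise estimate of the symmetrized collision integrand. -/
lemma IsWeight.collision_le {h m : ℝ → ℝ} {D a H : ℝ} (W : IsWeight h m D a H)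
    {b : ℝ → ℝ} {b₀ b₁ : ℝ} (h0 : 0 < b₀)
    (hb : ∀ x ∈ Icc (-1 : ℝ) 1, b₀ ≤ b x ∧ b x ≤ b₁) {e : ℝ} (he₀ : 0 ≤ e) (he₁ : e < 1)
    (v vs : Vel N) {σ : Vel N} (hσ : ‖σ‖ = 1) :
    collisionKernel b (v - vs) σ *
        (weightFn h (postVel e v vs σ) + weightFn h (postVel e vs v (-σ))
          - weightFn h v - weightFn h vs) ≤
      2 * D * b₁ * (weightFn h v * weightFn m vs + weightFn m v * weightFn h vs)
        - b₀ * (1 - e ^ 2) / 4 * h (jap v ^ 2) * (‖v‖ ^ 3 - 3 * ‖v‖ * inner ℝ v vs)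
        + b₀ * (1 - e ^ 2) / 4 * h (jap v ^ 2) * ‖v - vs‖ ^ 2 * inner ℝ (v - vs) σ := by
  obtain ⟨k0, k1⟩ := IsAngularKernel.bounds_kernel hb (v - vs) hσ
  have hb1 : 0 ≤ b₁ := h0.le.trans ((hb 0 (by norm_num)).1.trans (hb 0 (by norm_num)).2)
  set S := jap v ^ 2 + jap vs ^ 2 with hS
  set d := (1 - e ^ 2) / 4 * (‖v - vs‖ ^ 2 - ‖v - vs‖ * inner ℝ (v - vs) σ) with hd
  have hd0 : 0 ≤ d := dissipation_nonneg he₀ he₁ _ hσ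
  have hXY : jap (postVel e v vs σ) ^ 2 + jap (postVel e vs v (-σ)) ^ 2 = S - d :=
    jap_sq_postVel_add e v vs hσ
  have hX := one_le_jap_sq (postVel e v vs σ)
  have hY := one_le_jap_sq (postVel e vs v (-σ))
  have hx := one_le_jap_sq v
  have hy := one_le_jap_sq vs
  have hS1 : S ∈ Ici (1 : ℝ) := mem_Ici.2 (by linarith)
  -- All four squared brackets are nonnegative and their pairwise sums are at most S, so h(S)
  -- dominates each of the four values of h.
  have m1 : h (jap (postVel e v vs σ) ^ 2) ≤ h S := W.mono hX hS1 (by linarith)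
  have m2 : h (jap (postVel e vs v (-σ)) ^ 2) ≤ h S := W.mono hY hS1 (by linarith)
  have m3 : h (jap v ^ 2) ≤ h S := W.mono hx hS1 (by linarith)
  have m4 : h (jap vs ^ 2) ≤ h S := W.mono hy hS1 (by linarith)
  have n3 := W.nonneg _ hx
  set P := S * h S - weightFn h v - weightFn h vs with hP
  have hP0 : 0 ≤ P := by
    have e1 := mul_le_mul_of_nonneg_left m3 (zero_le_one.trans hx)
    have e2 := mul_le_mul_of_nonneg_left m4 (zero_le_one.trans hy)
    simp only [hP, weightFn, hS] at *
    linarith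
  have hbr : weightFn h (postVel e v vs σ) + weightFn h (postVel e vs v (-σ))
          - weightFn h v - weightFn h vs ≤ P - d * h S := by
    have e1 := mul_le_mul_of_nonneg_left m1 (zero_le_one.trans hX)
    have e2 := mul_le_mul_of_nonneg_left m2 (zero_le_one.trans hY)
    have : (S - d) * h S = jap (postVel e v vs σ) ^ 2 * h S +
      jap (postVel e vs v (-σ)) ^ 2 * h S := by rw [← hXY]; ring
    simp only [hP, weightFn] at *
    linarith
  have hk : 0 ≤ collisionKernel b (v - vs) σ := (mul_nonneg h0.le (norm_nonneg _)).trans k0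
  have s1 : collisionKernel b (v - vs) σ * P ≤
      b₁ * (2 * D * (weightFn h v * weightFn m vs + weightFn m v * weightFn h vs)) := by
    calc _ ≤ b₁ * ‖v - vs‖ * P := by gcongr
      _ = b₁ * (‖v - vs‖ * P) := by ring
      _ ≤ _ := mul_le_mul_of_nonneg_left (W.norm_mul_povzner_le v vs) hb1
  -- In the loss, h(S) is lowered to h(⟨v⟩²) so that the weight depends on v alone. The factor d is
  -- kept exact, since its angular part has to cancel by oddness.
  have s2 : b₀ * ‖v - vs‖ * (d * h (jap v ^ 2)) ≤ collisionKernel b (v - vs) σ * (d * h S) := by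
    gcongr
  have s3 := norm_sub_cube_ge v vs
  have s4 : 0 ≤ b₀ * (1 - e ^ 2) / 4 * h (jap v ^ 2) := by
    have : 0 ≤ 1 - e ^ 2 := by nlinarith
    positivity
  have s5 := mul_le_mul_of_nonneg_left s3 s4
  have s6 : b₀ * ‖v - vs‖ * (d * h (jap v ^ 2)) = b₀ * (1 - e ^ 2) / 4 * h (jap v ^ 2) *
      ‖v - vs‖ ^ 3 - b₀ * (1 - e ^ 2) / 4 * h (jap v ^ 2) * ‖v - vs‖ ^ 2 *
        inner ℝ (v - vs) σ := by
    rw [hd]; ring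
  have s7 := mul_le_mul_of_nonneg_left hbr hk
  rw [mul_sub] at s7
  linarith

/-- Profiles at a fixed time: nonnegative, in `L¹_3`, with vanishing momentum. -/
structure IsProfile (f : Vel N → ℝ) : Prop extends InL13 f where
  nonneg : ∀ᵐ v, 0 ≤ f v
  momentum : ∀ i, ∫ v, f v * v i = 0

lemma abs_coord_le (v : Vel N) (i : Fin N) : |v i| ≤ jap v := by
  have := PiLp.norm_apply_le v i
  rw [Real.norm_eq_abs] at this
  exact this.trans (norm_le_jap v)

/-- The collision operator tested against a weight. -/
theorem IsWeight.collisionDual_le {h m : ℝ → ℝ} {D a H : ℝ} (W : IsWeight h m D a H)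
    {b : ℝ → ℝ} (hbk : IsAngularKernel b) {b₀ b₁ : ℝ} (h0 : 0 < b₀)
    (hb : ∀ x ∈ Icc (-1 : ℝ) 1, b₀ ≤ b x ∧ b x ≤ b₁) {e : ℝ} (he₀ : 0 ≤ e) (he₁ : e < 1)
    {f : Vel N → ℝ} (hf : IsProfile f) :
    2 * collisionDual b e f (weightFn h) ≤
      sphereArea N * (4 * D * b₁ * (∫ v, f v * weightFn h v) * (∫ v, f v * weightFn m v)
        - b₀ * (1 - e ^ 2) / 4 * mass f * ∫ v, f v * (h (jap v ^ 2) * ‖v‖ ^ 3)) := by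
  have hI := integrable_collInt hbk he₀ he₁ hf.toInL13 W.continuous_weightFn W.abs_weightFn_le
  obtain ⟨i0, heq⟩ := two_mul_collisionDual hI
  rw [heq]
  have hH := W.H_nonneg
  have hc := W.continuous_h (N := N)
  have hfm : Continuous (weightFn m : Vel N → ℝ) := (continuous_jap.pow 2).mul W.continuous_m
  have hbd : ∀ v : Vel N, |h (jap v ^ 2)| ≤ H := fun v => by
    rw [abs_of_nonneg (W.nonneg _ (one_le_jap_sq v))]; exact W.le _ (one_le_jap_sq v)
  have hmle : ∀ v : Vel N, |weightFn m v| ≤ H * jap v ^ 2 := fun v => by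
    have h1 := W.m_nonneg _ (one_le_jap_sq v)
    have h2 := W.m_le _ (one_le_jap_sq v)
    rw [weightFn, abs_of_nonneg (by positivity)]
    nlinarith [sq_nonneg (jap v)]
  have ih := hf.weight_sq W.continuous_weightFn H W.abs_weightFn_le
  have im := hf.weight_sq hfm H hmle
  have i1 : Integrable f := by
    simpa using hf.weight_sq (w := fun _ => 1) continuous_const 1
      (fun v => by simpa using one_le_jap_sq v)
  have i3 : Integrable (fun v => f v * (h (jap v ^ 2) * ‖v‖ ^ 3)) :=
    hf.weight (hc.mul (continuous_norm.pow 3)) H fun v => by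
      rw [abs_mul, abs_of_nonneg (show 0 ≤ ‖v‖ ^ 3 by positivity)]
      exact mul_le_mul (hbd v) (pow_le_pow_left₀ (norm_nonneg v) (norm_le_jap v) 3)
        (by positivity) hH
  have ic : ∀ i, Integrable (fun v => f v * v i) := fun i =>
    hf.weight_sq (by fun_prop) 1 fun v =>
      (abs_coord_le v i).trans (by nlinarith [one_le_jap v])
  have ihc : ∀ i, Integrable (fun v => f v * (h (jap v ^ 2) * ‖v‖ * v i)) := fun i =>
    hf.weight_sq ((hc.mul continuous_norm).mul (by fun_prop)) H fun v => by
      rw [abs_mul, abs_mul, abs_norm, mul_assoc, show H * jap v ^ 2 = H * (jap v * jap v) by ring]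
      exact mul_le_mul (hbd v) (mul_le_mul (norm_le_jap v) (abs_coord_le v i) (abs_nonneg _)
        (jap_pos v).le) (by positivity) hH
  set c := b₀ * (1 - e ^ 2) / 4 with hcdef
  have t1 := integrable_tensor ih im
  have t2 := integrable_tensor im ih
  have t3 := integrable_tensor i3 i1
  -- Splitting v·v_* into coordinates produces tensor products whose second factor integrates to a
  -- component of the momentum, that is, to zero.
  have t4 : ∀ i, Integrable (fun p : Vel N × Vel N × UnitSphere N =>
      f p.1 * (h (jap p.1 ^ 2) * ‖p.1‖ * p.1 i) * (f p.2.1 * p.2.1 i)) (collMeasure N) :=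
    fun i => integrable_tensor (ihc i) (ic i)
  have t4s := integrable_finsetSum Finset.univ fun i _ => t4 i
  have t5 : Integrable (fun p : Vel N × Vel N × UnitSphere N =>
      f p.1 * f p.2.1 * (h (jap p.1 ^ 2) * ‖p.1 - p.2.1‖ ^ 2 *
        inner ℝ (p.1 - p.2.1) (p.2.2 : Vel N))) (collMeasure N) := by
    have g1 := integrable_tensor hf.toInL13.abs.int hf.toInL13.abs.int
    refine Integrable.mono' (g1.const_mul (8 * H))
      ((aestronglyMeasurable_tensor hf.meas hf.meas).mul ?_) (ae_of_all _ fun p => ?_)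
    · exact (((hc.comp continuous_fst).mul (by fun_prop)).mul
        (by fun_prop)).aestronglyMeasurable
    · obtain ⟨v, vs, σ⟩ := p
      have q1 : |inner ℝ (v - vs) (σ : Vel N)| ≤ ‖v - vs‖ := by
        simpa using abs_real_inner_le_norm (v - vs) (σ : Vel N)
      have q2 : ‖v - vs‖ ≤ 2 * (jap v * jap vs) := (norm_sub_le_jap v vs).trans (by
        nlinarith [one_le_jap v, one_le_jap vs])
      simp only [Real.norm_eq_abs, abs_mul, abs_pow, abs_norm]
      calc |f v| * |f vs| * (|h (jap v ^ 2)| * ‖v - vs‖ ^ 2 * |inner ℝ (v - vs) (σ : Vel N)|)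
          ≤ |f v| * |f vs| * (H * ‖v - vs‖ ^ 2 * ‖v - vs‖) := by
            gcongr; exact hbd v
        _ = |f v| * |f vs| * (H * ‖v - vs‖ ^ 3) := by ring
        _ ≤ |f v| * |f vs| * (H * (2 * (jap v * jap vs)) ^ 3) := by gcongr
        _ = _ := by ring
  have hodd : ∫ p : Vel N × Vel N × UnitSphere N, f p.1 * f p.2.1 * (h (jap p.1 ^ 2) *
      ‖p.1 - p.2.1‖ ^ 2 * inner ℝ (p.1 - p.2.1) (p.2.2 : Vel N)) ∂(collMeasure N) = 0 :=
    integral_eq_zero_of_odd_angle fun p => by simp [inner_neg_right]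
  have ipos : ∀ᵐ p ∂(collMeasure N), 0 ≤ f p.1 * f p.2.1 := by
    have q1 : ∀ᵐ p ∂(collMeasure N), 0 ≤ f p.1 :=
      Measure.quasiMeasurePreserving_fst.ae hf.nonneg
    have q2 : ∀ᵐ p ∂(collMeasure N), 0 ≤ f p.2.1 :=
      Measure.quasiMeasurePreserving_snd.ae (Measure.quasiMeasurePreserving_fst.ae hf.nonneg)
    filter_upwards [q1, q2] with p a1 a2 using mul_nonneg a1 a2
  have hmono := integral_mono_ae i0
    (((((t1.add t2).const_mul (2 * D * b₁)).sub (t3.const_mul c)).add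
      (t4s.const_mul (3 * c))).add (t5.const_mul c)) (by
      filter_upwards [ipos] with p hp
      obtain ⟨v, vs, σ⟩ := p
      have := mul_le_mul_of_nonneg_left
        (W.collision_le h0 hb he₀ he₁ v vs (norm_sphere σ)) hp
      have hin : inner ℝ v vs = ∑ i, v i * vs i := by
        rw [PiLp.inner_apply]
        exact Finset.sum_congr rfl fun i _ => by simp [mul_comm]
      have hsum : ∑ i, f v * (h (jap v ^ 2) * ‖v‖ * v i) * (f vs * vs i) =
          f v * f vs * h (jap v ^ 2) * ‖v‖ * inner ℝ v vs := by
        rw [hin, Finset.mul_sum]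
        exact Finset.sum_congr rfl fun i _ => by ring
      simp only [Pi.add_apply, Pi.sub_apply, hsum]
      simp only [mul_assoc] at this ⊢
      refine this.trans (le_of_eq ?_)
      rw [hcdef]
      ring)
  refine hmono.trans (le_of_eq ?_)
  have hz : ∀ i, ∫ p : Vel N × Vel N × UnitSphere N,
      f p.1 * (h (jap p.1 ^ 2) * ‖p.1‖ * p.1 i) * (f p.2.1 * p.2.1 i) ∂(collMeasure N) = 0 := by
    intro i
    rw [integral_tensor (fun v => f v * (h (jap v ^ 2) * ‖v‖ * v i)) (fun v => f v * v i),
      hf.momentum i]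
    ring
  rw [integral_add' (((((t1.add t2).const_mul (2 * D * b₁)).sub (t3.const_mul c)).add
      (t4s.const_mul (3 * c)))) (t5.const_mul c),
    integral_add' ((((t1.add t2).const_mul (2 * D * b₁)).sub (t3.const_mul c)))
      (t4s.const_mul (3 * c)),
    integral_sub' ((t1.add t2).const_mul (2 * D * b₁)) (t3.const_mul c),
    integral_const_mul, integral_const_mul, integral_const_mul, integral_const_mul, hodd,
    integral_finsetSum _ fun i _ => t4 i, Finset.sum_congr rfl fun i _ => hz i,
    integral_tensor (fun v => f v * (h (jap v ^ 2) * ‖v‖ ^ 3)) f, integral_add' t1 t2,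
    integral_tensor (fun v => f v * weightFn h v) (fun v => f v * weightFn m v),
    integral_tensor (fun v => f v * weightFn m v) (fun v => f v * weightFn h v), mass]
  simp only [Finset.sum_const_zero]
  ring

/-! ### Absorption of gain and drift by the loss -/

/-- The right-hand side of the rescaled equation, tested against `ψ`. -/
noncomputable def generator (b : ℝ → ℝ) (e : ℝ) (f ψ : Vel N → ℝ) : ℝ :=
  collisionDual b e f ψ + ∫ v, f v * fderiv ℝ ψ v v

/-- Cube ⟨v⟩ - 1 ≤ |v| and drop the positive remainder 3⟨v⟩ - 1. This turns the loss in |v|³ into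
one in ⟨v⟩³, at the price of a quadratic term. -/
lemma jap_cube_le (v : Vel N) : jap v ^ 3 - 3 * jap v ^ 2 ≤ ‖v‖ ^ 3 := by
  have h1 : jap v ≤ ‖v‖ + 1 := by
    rw [jap, Real.sqrt_le_left (by positivity)]
    nlinarith [norm_nonneg v]
  have h2 := one_le_jap v
  have h3 := pow_le_pow_left₀ (show 0 ≤ jap v - 1 by linarith)
    (show jap v - 1 ≤ ‖v‖ by linarith) 3
  nlinarith

/-- At least half of the cubic loss survives 2a + κ, so the left-hand side is at most h ⟨v⟩² (λ -
c₁⟨v⟩/2). For ⟨v⟩² ≥ R the choice of R makes the parenthesis at most -λ; for ⟨v⟩² ≤ R one adds and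
subtracts 2λ and uses h ≤ h(R). The minimum in the remainder lets it be bounded later by the mass or
by the second moment. -/
lemma IsWeight.pointwise_le {h m : ℝ → ℝ} {D a H : ℝ} (W : IsWeight h m D a H)
    {c₁ A κ lam R : ℝ} (hc₁ : 0 < c₁) (haκ : 2 * a + κ ≤ c₁ / 2)
    (hlam : lam = A + 3 * c₁) (hlam0 : 0 ≤ lam) (hR : 1 ≤ R) (hRl : 4 * lam ≤ c₁ * √R)
    (v : Vel N) :
    h (jap v ^ 2) * (A * jap v ^ 2 + (2 * a + κ) * jap v ^ 3 - c₁ * ‖v‖ ^ 3) ≤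
      -lam * weightFn h v + 2 * lam * h R * min (jap v ^ 2) R := by
  have hJ := jap_pos v
  have hx := one_le_jap_sq v
  have hh := W.nonneg _ hx
  have hhR := W.nonneg _ hR
  have h1 := jap_cube_le v
  have h2 : A * jap v ^ 2 + (2 * a + κ) * jap v ^ 3 - c₁ * ‖v‖ ^ 3 ≤
      jap v ^ 2 * (lam - c₁ / 2 * jap v) := by
    have e1 := mul_le_mul_of_nonneg_left h1 hc₁.le
    have e2 := mul_le_mul_of_nonneg_right haκ (pow_pos hJ 3).le
    rw [hlam]
    nlinarith
  have h3 := mul_le_mul_of_nonneg_left h2 hh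
  refine h3.trans ?_
  have hmin : 0 ≤ min (jap v ^ 2) R := le_min (by positivity) (by linarith)
  rw [weightFn]
  rcases le_total (jap v ^ 2) R with hle | hle
  · rw [min_eq_left hle]
    have h4 : h (jap v ^ 2) ≤ h R := W.mono hx hR hle
    have e1 : 0 ≤ jap v ^ 2 * h (jap v ^ 2) * (c₁ / 2 * jap v) := by positivity
    have e2 := mul_le_mul_of_nonneg_left h4 (show 0 ≤ 2 * lam * jap v ^ 2 by positivity)
    nlinarith
  · have h4 : √R ≤ jap v := (Real.sqrt_le_left hJ.le).2 hle
    have e1 : 2 * lam ≤ c₁ / 2 * jap v := by nlinarith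
    have e2 := mul_le_mul_of_nonneg_left e1 (show 0 ≤ jap v ^ 2 * h (jap v ^ 2) by positivity)
    have e3 : 0 ≤ 2 * lam * h R * min (jap v ^ 2) R := by positivity
    nlinarith

lemma IsWeight.abs_h_le {h m : ℝ → ℝ} {D a H : ℝ} (W : IsWeight h m D a H) (v : Vel N) :
    |h (jap v ^ 2)| ≤ H := by
  rw [abs_of_nonneg (W.nonneg _ (one_le_jap_sq v))]; exact W.le _ (one_le_jap_sq v)

lemma continuous_min_jap (R : ℝ) : Continuous fun v : Vel N => min (jap v ^ 2) R :=
  (continuous_jap.pow 2).min continuous_const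

lemma abs_min_jap_le {R : ℝ} (hR : 1 ≤ R) (v : Vel N) :
    |min (jap v ^ 2) R| ≤ 1 * jap v ^ 2 := by
  rw [abs_of_nonneg (le_min (by positivity) (by linarith)), one_mul]; exact min_le_left _ _

/-- The a priori inequality for the generator. -/
theorem IsWeight.generator_le {h m : ℝ → ℝ} {D a H : ℝ} (W : IsWeight h m D a H)
    {b : ℝ → ℝ} (hbk : IsAngularKernel b) {b₀ b₁ : ℝ} (h0 : 0 < b₀)
    (hb : ∀ x ∈ Icc (-1 : ℝ) 1, b₀ ≤ b x ∧ b x ≤ b₁) {e : ℝ} (he₀ : 0 ≤ e) (he₁ : e < 1)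
    {f : Vel N → ℝ} (hf : IsProfile f) {c₁ G κ lam R : ℝ} (ha : 0 ≤ a)
    (hc : c₁ = sphereArea N * b₀ * (1 - e ^ 2) / 8 * mass f) (hc₁ : 0 < c₁)
    (hG0 : 0 ≤ G) (hG : D * (∫ v, f v * weightFn m v) ≤ D * G)
    (haκ : 2 * a + κ ≤ c₁ / 2)
    (hlam : lam = 2 * sphereArea N * b₁ * D * G + 2 * (1 + D) + 3 * c₁)
    (hR : 1 ≤ R) (hRl : 4 * lam ≤ c₁ * √R) :
    generator b e f (weightFn h) + κ * ∫ v, f v * (h (jap v ^ 2) * jap v ^ 3) ≤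
      -lam * (∫ v, f v * weightFn h v) + 2 * lam * h R * ∫ v, f v * min (jap v ^ 2) R := by
  have hb1 : 0 ≤ b₁ := h0.le.trans ((hb 0 (by norm_num)).1.trans (hb 0 (by norm_num)).2)
  have hω : 0 ≤ sphereArea N := measureReal_nonneg
  have hD := W.D_nonneg
  have hH := W.H_nonneg
  have hcont := W.continuous_h (N := N)
  have j2 : Integrable (fun v => f v * weightFn h v) :=
    hf.weight_sq W.continuous_weightFn H W.abs_weightFn_le
  have j3 : Integrable (fun v => f v * (h (jap v ^ 2) * jap v ^ 3)) :=
    hf.weight (hcont.mul (continuous_jap.pow 3)) H fun v => by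
      rw [abs_mul, abs_of_pos (pow_pos (jap_pos v) 3)]
      exact mul_le_mul_of_nonneg_right (W.abs_h_le v) (pow_pos (jap_pos v) 3).le
  have j4 : Integrable (fun v => f v * (h (jap v ^ 2) * ‖v‖ ^ 3)) :=
    hf.weight (hcont.mul (continuous_norm.pow 3)) H fun v => by
      rw [abs_mul, abs_of_nonneg (show 0 ≤ ‖v‖ ^ 3 by positivity)]
      exact mul_le_mul (W.abs_h_le v) (pow_le_pow_left₀ (norm_nonneg v) (norm_le_jap v) 3)
        (by positivity) hH
  have j5 : Integrable (fun v => f v * min (jap v ^ 2) R) :=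
    hf.weight_sq (continuous_min_jap R) 1 (abs_min_jap_le hR)
  have jd : Integrable (fun v => f v * fderiv ℝ (weightFn h) v v) :=
    hf.weight_sq ((W.contDiff_weightFn.continuous_fderiv (by norm_num)).clm_apply continuous_id)
      (4 * H) W.abs_fderiv_weightFn_le
  have hcoll := W.collisionDual_le hbk h0 hb he₀ he₁ hf
  have hdrift : ∫ v, f v * fderiv ℝ (weightFn h) v v ≤
      2 * (1 + D) * (∫ v, f v * weightFn h v) +
        2 * a * ∫ v, f v * (h (jap v ^ 2) * jap v ^ 3) := by
    rw [← integral_const_mul, ← integral_const_mul,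
      ← integral_add (j2.const_mul _) (j3.const_mul _)]
    refine integral_mono_ae jd ((j2.const_mul _).add (j3.const_mul _)) ?_
    filter_upwards [hf.nonneg] with v hv
    have := mul_le_mul_of_nonneg_left (W.fderiv_weightFn_le v ha) hv
    simp only [weightFn] at this ⊢
    linarith
  have hpos : 0 ≤ ∫ v, f v * weightFn h v := integral_nonneg_of_ae (by
    filter_upwards [hf.nonneg] with v hv
    have := W.nonneg _ (one_le_jap_sq v)
    simp only [weightFn, Pi.zero_apply]
    positivity)
  set A := 2 * sphereArea N * b₁ * D * G + 2 * (1 + D) with hA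
  have hlam0 : 0 ≤ lam := by rw [hlam]; positivity
  have hpt : ∫ v, f v * (h (jap v ^ 2) * (A * jap v ^ 2 + (2 * a + κ) * jap v ^ 3
      - c₁ * ‖v‖ ^ 3)) ≤ -lam * (∫ v, f v * weightFn h v) +
        2 * lam * h R * ∫ v, f v * min (jap v ^ 2) R := by
    rw [← integral_const_mul, ← integral_const_mul,
      ← integral_add (j2.const_mul _) (j5.const_mul _)]
    refine integral_mono_ae ?_ ((j2.const_mul _).add (j5.const_mul _)) ?_
    · refine (((j2.const_mul A).add (j3.const_mul (2 * a + κ))).sub (j4.const_mul c₁)).congr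
        (ae_of_all _ fun v => ?_)
      simp only [Pi.add_apply, Pi.sub_apply, weightFn]
      ring
    filter_upwards [hf.nonneg] with v hv
    have := mul_le_mul_of_nonneg_left (W.pointwise_le hc₁ haκ hlam hlam0 hR hRl v) hv
    linarith
  have hsplit : ∫ v, f v * (h (jap v ^ 2) * (A * jap v ^ 2 + (2 * a + κ) * jap v ^ 3
      - c₁ * ‖v‖ ^ 3)) = A * (∫ v, f v * weightFn h v) +
        (2 * a + κ) * (∫ v, f v * (h (jap v ^ 2) * jap v ^ 3)) -
        c₁ * ∫ v, f v * (h (jap v ^ 2) * ‖v‖ ^ 3) := by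
    have q := integral_sub ((j2.const_mul A).add (j3.const_mul (2 * a + κ))) (j4.const_mul c₁)
    rw [integral_add' (j2.const_mul A) (j3.const_mul (2 * a + κ)), integral_const_mul,
      integral_const_mul, integral_const_mul] at q
    rw [← q]
    refine integral_congr_ae (ae_of_all _ fun v => ?_)
    simp only [weightFn, Pi.add_apply]
    ring
  rw [hsplit] at hpt
  -- The hypothesis on G carries the factor D, so it is void for the weight 1, where D = 0 and no
  -- moment bound is available yet.
  have hGF : sphereArea N * (4 * D * b₁ * (∫ v, f v * weightFn h v) * ∫ v, f v * weightFn m v) ≤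
      2 * (2 * sphereArea N * b₁ * D * G) * ∫ v, f v * weightFn h v := by
    have := mul_le_mul_of_nonneg_left hG
      (show 0 ≤ sphereArea N * 4 * b₁ * ∫ v, f v * weightFn h v by positivity)
    linarith
  -- The 8 in c₁ is the 4 of the dissipation times the 2 of the symmetrization.
  have hcI : c₁ * (∫ v, f v * (h (jap v ^ 2) * ‖v‖ ^ 3)) = sphereArea N *
    (b₀ * (1 - e ^ 2) / 4 * mass f * ∫ v, f v * (h (jap v ^ 2) * ‖v‖ ^ 3)) / 2 := by
    rw [hc]; ring
  unfold generator
  rw [mul_sub] at hcoll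
  rw [hA] at hpt
  nlinarith

/-! ### Continuity in time -/

lemma weightedNorm_natCast (n : ℕ) (f : Vel N → ℝ) :
    weightedNorm (n : ℝ) f = ∫⁻ v, ‖f v * jap v ^ n‖ₑ := by
  unfold weightedNorm
  refine lintegral_congr fun v => ?_
  rw [jap_rpow, Real.rpow_natCast, Real.enorm_eq_ofReal_abs, abs_mul,
    abs_of_pos (pow_pos (jap_pos v) n)]

lemma weightedNorm_two (f : Vel N → ℝ) : weightedNorm 2 f = ∫⁻ v, ‖f v * jap v ^ 2‖ₑ := by
  have := weightedNorm_natCast 2 f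
  simpa using this

lemma weightedNorm_three (f : Vel N → ℝ) : weightedNorm 3 f = ∫⁻ v, ‖f v * jap v ^ 3‖ₑ := by
  have := weightedNorm_natCast 3 f
  simpa using this

lemma MemWeightedL1.integrable {f : Vel N → ℝ} (hf : MemWeightedL1 2 f) :
    Integrable (fun v => f v * jap v ^ 2) := by
  refine ⟨hf.1.mul (continuous_jap.pow 2).aestronglyMeasurable, ?_⟩
  rw [HasFiniteIntegral, ← weightedNorm_two]
  exact hf.2

lemma MemWeightedL1.weight {f : Vel N → ℝ} (hf : MemWeightedL1 2 f) {w : Vel N → ℝ}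
    (hw : Continuous w) (C : ℝ) (hle : ∀ v, |w v| ≤ C * jap v ^ 2) :
    Integrable (fun v => f v * w v) :=
  integrable_of_weight_le hf.1 hw hf.integrable C fun v => by
    rw [abs_of_pos (pow_pos (jap_pos v) 2)]; exact hle v

lemma MemWeightedL1.abs_integrable {f : Vel N → ℝ} (hf : MemWeightedL1 2 f) :
    Integrable (fun v => |f v| * jap v ^ 2) :=
  hf.integrable.norm.congr (ae_of_all _ fun v => by simp [abs_of_pos (jap_pos v)])

lemma inL13_of_weightedNorm {f : Vel N → ℝ} (hf : AEStronglyMeasurable f volume)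
    (h : weightedNorm 3 f < ⊤) : InL13 f :=
  ⟨hf, hf.mul (continuous_jap.pow 3).aestronglyMeasurable, by
    rw [HasFiniteIntegral, ← weightedNorm_three]; exact h⟩

lemma toReal_weightedNorm_two {f : Vel N → ℝ} (hf : AEStronglyMeasurable f volume) :
    (weightedNorm 2 f).toReal = ∫ v, |f v| * jap v ^ 2 := by
  rw [weightedNorm_two, ← integral_norm_eq_lintegral_enorm
    (f := fun v => f v * jap v ^ 2) (hf.mul (continuous_jap.pow 2).aestronglyMeasurable)]
  simp [abs_of_pos (jap_pos _)]

lemma toReal_weightedNorm_three {f : Vel N → ℝ} (hf : AEStronglyMeasurable f volume) :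
    (weightedNorm 3 f).toReal = ∫ v, |f v| * jap v ^ 3 := by
  rw [weightedNorm_three, ← integral_norm_eq_lintegral_enorm
    (f := fun v => f v * jap v ^ 3) (hf.mul (continuous_jap.pow 3).aestronglyMeasurable)]
  simp [abs_of_pos (jap_pos _)]

namespace IsSolution

variable {b : ℝ → ℝ} {e : ℝ} {gin : Vel N → ℝ} {g : ℝ → Vel N → ℝ}

lemma sub_integrable (hs : IsSolution b e gin g) {t t₀ : ℝ} (ht : 0 ≤ t) (ht₀ : 0 ≤ t₀) :
    Integrable (fun v => |g t v - g t₀ v| * jap v ^ 2) :=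
  ((hs.mem t ht).integrable.sub (hs.mem t₀ ht₀).integrable).norm.congr (ae_of_all _ fun v => by
    simp only [Pi.sub_apply, ← sub_mul, norm_mul, Real.norm_eq_abs]
    rw [abs_of_pos (pow_pos (jap_pos v) 2)])

lemma tendsto_dist (hs : IsSolution b e gin g) {t₀ : ℝ} (ht₀ : 0 ≤ t₀) :
    Tendsto (fun t => ∫ v, |g t v - g t₀ v| * jap v ^ 2) (𝓝[Ici 0] t₀) (𝓝 0) := by
  have h := (ENNReal.tendsto_toReal ENNReal.zero_ne_top).comp (hs.continuous t₀ ht₀)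
  rw [ENNReal.toReal_zero] at h
  refine h.congr' ?_
  filter_upwards [self_mem_nhdsWithin] with t ht
  exact toReal_weightedNorm_two ((hs.mem t ht).1.sub (hs.mem t₀ ht₀).1)

/-- The increment is at most C times the L¹_2 distance. This is why every weight is first truncated
to quadratic growth. -/
lemma continuousOn_integral (hs : IsSolution b e gin g) {w : Vel N → ℝ} (hw : Continuous w)
    (C : ℝ) (hle : ∀ v, |w v| ≤ C * jap v ^ 2) :
    ContinuousOn (fun t => ∫ v, g t v * w v) (Ici 0) := by
  intro t₀ ht₀
  rw [ContinuousWithinAt, tendsto_iff_norm_sub_tendsto_zero]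
  have h := (hs.tendsto_dist ht₀).const_mul C
  rw [mul_zero] at h
  refine squeeze_zero' (Eventually.of_forall fun t => norm_nonneg _) ?_ h
  filter_upwards [self_mem_nhdsWithin] with t ht
  rw [← integral_sub ((hs.mem t ht).weight hw C hle) ((hs.mem t₀ ht₀).weight hw C hle),
    ← integral_const_mul]
  refine norm_integral_le_of_norm_le ((hs.sub_integrable ht ht₀).const_mul C)
    (ae_of_all _ fun v => ?_)
  rw [← sub_mul, norm_mul, Real.norm_eq_abs, Real.norm_eq_abs]
  have := mul_le_mul_of_nonneg_left (hle v) (abs_nonneg (g t v - g t₀ v))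
  linarith

lemma integrable_collInt_of_bounded (hbk : IsAngularKernel b) {f f' ψ : Vel N → ℝ}
    (hf : AEStronglyMeasurable f volume) (hf' : AEStronglyMeasurable f' volume)
    (h1 : Integrable fun v => |f v| * jap v ^ 2) (h2 : Integrable fun v => |f' v| * jap v ^ 2)
    (hψc : Continuous ψ) {C b₀ b₁ : ℝ} (h0 : 0 < b₀)
    (h : ∀ x ∈ Icc (-1 : ℝ) 1, b₀ ≤ b x ∧ b x ≤ b₁) (hψ : ∀ v, |ψ v| ≤ C) :
    Integrable (collInt b e f f' ψ) (collMeasure N) ∧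
    |∫ p, collInt b e f f' ψ p ∂(collMeasure N)| ≤
      4 * C * b₁ * ((∫ v, |f v| * jap v ^ 2) * (∫ v, |f' v| * jap v ^ 2) * sphereArea N) := by
  have i1 := (integrable_tensor h1 h2).const_mul (4 * C * b₁)
  have hp : ∀ᵐ p ∂(collMeasure N), ‖collInt b e f f' ψ p‖ ≤ 4 * C * b₁ *
      ((|f p.1| * jap p.1 ^ 2) * (|f' p.2.1| * jap p.2.1 ^ 2)) :=
    ae_of_all _ fun p => abs_collInt_le_of_bounded h0 h hbk e hψ p
  refine ⟨i1.mono' (aestronglyMeasurable_collInt hbk e hf hf' hψc) hp, ?_⟩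
  refine (norm_integral_le_of_norm_le i1 hp).trans (le_of_eq ?_)
  rw [integral_const_mul, integral_tensor (fun v => |f v| * jap v ^ 2)
    (fun v => |f' v| * jap v ^ 2)]

/-- By bilinearity, Q(g,g) - Q(g₀,g₀) = Q(g-g₀,g) + Q(g₀,g-g₀), and against a bounded ψ each
polarized integral is controlled by a product of L¹_2 norms. Its role is to give measurability in
time. -/
lemma continuousOn_collisionDual (hs : IsSolution b e gin g) (hbk : IsAngularKernel b)
    {ψ : Vel N → ℝ} (hψc : Continuous ψ) {C : ℝ} (hψ : ∀ v, |ψ v| ≤ C) :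
    ContinuousOn (fun t => collisionDual b e (g t) ψ) (Ici 0) := by
  obtain ⟨b₀, b₁, h0, h⟩ := hbk.bounds
  intro t₀ ht₀
  rw [ContinuousWithinAt, tendsto_iff_norm_sub_tendsto_zero]
  set d : ℝ → ℝ := fun t => ∫ v, |g t v - g t₀ v| * jap v ^ 2 with hd
  set n₀ := ∫ v, |g t₀ v| * jap v ^ 2 with hn₀
  have hlim : Tendsto (fun t => 4 * C * b₁ * (d t * (∫ v, |g t v| * jap v ^ 2) * sphereArea N) +
      4 * C * b₁ * (n₀ * d t * sphereArea N)) (𝓝[Ici 0] t₀) (𝓝 0) := by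
    have e1 := hs.tendsto_dist ht₀
    have e2 : Tendsto (fun t => ∫ v, |g t v| * jap v ^ 2) (𝓝[Ici 0] t₀) (𝓝 n₀) := by
      have := hs.continuousOn_integral (continuous_jap.pow 2) 1
        (fun v => by rw [Pi.pow_apply, abs_of_nonneg (sq_nonneg _), one_mul]) t₀ ht₀
      rw [ContinuousWithinAt] at this
      have hab : ∀ t, 0 ≤ t → ∫ v, |g t v| * jap v ^ 2 = ∫ v, g t v * jap v ^ 2 := fun t ht =>
        integral_congr_ae (by
          filter_upwards [hs.nonneg t ht] with v hv
          rw [abs_of_nonneg hv])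
      rw [hn₀, hab t₀ ht₀]
      refine this.congr' ?_
      filter_upwards [self_mem_nhdsWithin] with t ht
      exact (hab t ht).symm
    have e3 := (((e1.mul e2).mul_const (sphereArea N)).const_mul (4 * C * b₁)).add
      (((e1.const_mul n₀).mul_const (sphereArea N)).const_mul (4 * C * b₁))
    simpa using e3
  refine squeeze_zero' (Eventually.of_forall fun t => norm_nonneg _) ?_ hlim
  filter_upwards [self_mem_nhdsWithin] with t ht
  have m1 := hs.mem t ht
  have m0 := hs.mem t₀ ht₀
  have k1 := integrable_collInt_of_bounded (e := e) hbk m1.1 m1.1 m1.abs_integrable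
    m1.abs_integrable hψc h0 h hψ
  have k0 := integrable_collInt_of_bounded (e := e) hbk m0.1 m0.1 m0.abs_integrable
    m0.abs_integrable hψc h0 h hψ
  have k2 := integrable_collInt_of_bounded (e := e) hbk (m1.1.sub m0.1) m1.1
    (hs.sub_integrable ht ht₀) m1.abs_integrable hψc h0 h hψ
  have k3 := integrable_collInt_of_bounded (e := e) hbk m0.1 (m1.1.sub m0.1)
    m0.abs_integrable (hs.sub_integrable ht ht₀) hψc h0 h hψ
  rw [collisionDual_eq_of_integrable k1.1, collisionDual_eq_of_integrable k0.1,
    ← integral_sub k1.1 k0.1]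
  have heq : ∀ p, collInt b e (g t) (g t) ψ p - collInt b e (g t₀) (g t₀) ψ p =
      collInt b e (g t - g t₀) (g t) ψ p + collInt b e (g t₀) (g t - g t₀) ψ p := fun p => by
    simp only [collInt, Pi.sub_apply]; ring
  simp only [heq]
  rw [integral_add k2.1 k3.1]
  exact (norm_add_le _ _).trans (add_le_add k2.2 k3.2)

/-! ### The third moment as a function of time -/

/-- The third moment need not be continuous in time, but it is the increasing limit of the moments
with weights min(⟨v⟩³, n⟨v⟩²), which are. -/
lemma aemeasurable_weightedNorm_three (hs : IsSolution b e gin g) (T : ℝ) :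
    AEMeasurable (fun t => weightedNorm 3 (g t)) (volume.restrict (Icc 0 T)) := by
  set w : ℕ → Vel N → ℝ := fun n v => min (jap v ^ 3) (n * jap v ^ 2) with hw
  have hw0 : ∀ n v, 0 ≤ w n v := fun n v => by
    have := jap_pos v
    exact le_min (by positivity) (by positivity)
  have hwc : ∀ n, Continuous (w n) := fun n =>
    (continuous_jap.pow 3).min (continuous_const.mul (continuous_jap.pow 2))
  have hwle : ∀ n v, |w n v| ≤ n * jap v ^ 2 := fun n v => by
    rw [abs_of_nonneg (hw0 n v)]; exact min_le_right _ _
  have hmeas : ∀ n : ℕ, AEMeasurable (fun t => ENNReal.ofReal (∫ v, g t v * w n v))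
      (volume.restrict (Icc 0 T)) := fun n =>
    ENNReal.measurable_ofReal.comp_aemeasurable
      (((hs.continuousOn_integral (hwc n) n (hwle n)).mono Icc_subset_Ici_self).aemeasurable
        measurableSet_Icc)
  refine aemeasurable_of_tendsto_metrizable_ae atTop hmeas ?_
  filter_upwards [ae_restrict_mem measurableSet_Icc] with t ht
  have hm := hs.mem t ht.1
  have hofReal : ∀ n, ENNReal.ofReal (∫ v, g t v * w n v) =
      ∫⁻ v, ENNReal.ofReal (g t v * w n v) := fun n =>
    ofReal_integral_eq_lintegral_ofReal (hm.weight (hwc n) n (hwle n)) (by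
      filter_upwards [hs.nonneg t ht.1] with v hv using mul_nonneg hv (hw0 n v))
  simp only [hofReal]
  have hval : weightedNorm 3 (g t) = ∫⁻ v, ENNReal.ofReal (g t v * jap v ^ 3) := by
    rw [weightedNorm_three]
    refine lintegral_congr_ae ?_
    filter_upwards [hs.nonneg t ht.1] with v hv
    rw [Real.enorm_eq_ofReal_abs, abs_of_nonneg (mul_nonneg hv (pow_pos (jap_pos v) 3).le)]
  rw [hval]
  refine lintegral_tendsto_of_tendsto_of_monotone (fun n =>
    (hm.1.mul (hwc n).aestronglyMeasurable).aemeasurable.ennreal_ofReal) ?_ ?_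
  · filter_upwards [hs.nonneg t ht.1] with v hv
    intro n k hnk
    refine ENNReal.ofReal_le_ofReal (mul_le_mul_of_nonneg_left (min_le_min le_rfl ?_) hv)
    exact mul_le_mul_of_nonneg_right (Nat.cast_le.2 hnk) (sq_nonneg _)
  · refine ae_of_all _ fun v => tendsto_const_nhds.congr' ?_
    filter_upwards [eventually_ge_atTop ⌈jap v⌉₊] with n hn
    have h1 : jap v ≤ n := (Nat.le_ceil _).trans (Nat.cast_le.2 hn)
    have h2 : w n v = jap v ^ 3 := min_eq_left (by
      nlinarith [mul_le_mul_of_nonneg_right h1 (sq_nonneg (jap v))])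
    rw [h2]

lemma ae_inL13 (hs : IsSolution b e gin g) (T : ℝ) :
    ∀ᵐ t ∂(volume.restrict (Icc 0 T)), InL13 (g t) := by
  filter_upwards [ae_lt_top' (hs.aemeasurable_weightedNorm_three T) (hs.locInt T).ne,
    ae_restrict_mem measurableSet_Icc] with t ht h't
  exact inL13_of_weightedNorm (hs.mem t h't.1).1 ht

lemma integrable_third_moment (hs : IsSolution b e gin g) (T : ℝ) :
    Integrable (fun t => ∫ v, |g t v| * jap v ^ 3) (volume.restrict (Icc 0 T)) := by
  refine (integrable_toReal_of_lintegral_ne_top (hs.aemeasurable_weightedNorm_three T)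
    (hs.locInt T).ne).congr ?_
  filter_upwards [ae_restrict_mem measurableSet_Icc] with t ht
  exact toReal_weightedNorm_three (hs.mem t ht.1).1

lemma integral_abs_eq (hs : IsSolution b e gin g) {t : ℝ} (ht : 0 ≤ t) (w : Vel N → ℝ) :
    ∫ v, |g t v| * w v = ∫ v, g t v * w v :=
  integral_congr_ae (by
    filter_upwards [hs.nonneg t ht] with v hv
    rw [abs_of_nonneg hv])

end IsSolution

/-! ### Test functions of quadratic growth -/

/-- Smooth test functions `ψ` such that `ψ` and `v · ∇ψ` grow at most quadratically. -/
structure IsAdmissible (ψ : Vel N → ℝ) (C : ℝ) : Prop where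
  smooth : ContDiff ℝ ∞ ψ
  le : ∀ v, |ψ v| ≤ C * jap v ^ 2
  drift_le : ∀ v, |fderiv ℝ ψ v v| ≤ C * jap v ^ 2

lemma IsAdmissible.nonneg {ψ : Vel N → ℝ} {C : ℝ} (h : IsAdmissible ψ C) : 0 ≤ C :=
  nonneg_of_mul_nonneg_left ((abs_nonneg _).trans (h.le 0)) (pow_pos (jap_pos _) 2)

lemma IsAdmissible.continuous_drift {ψ : Vel N → ℝ} {C : ℝ} (h : IsAdmissible ψ C) :
    Continuous (fun v => fderiv ℝ ψ v v) :=
  (h.smooth.continuous_fderiv (by norm_num)).clm_apply continuous_id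

lemma IsWeight.isAdmissible {h m : ℝ → ℝ} {D a H : ℝ} (W : IsWeight h m D a H) :
    IsAdmissible (weightFn h : Vel N → ℝ) (4 * H) :=
  ⟨W.contDiff_weightFn, fun v => (W.abs_weightFn_le v).trans (by
    nlinarith [mul_nonneg W.H_nonneg (sq_nonneg (jap v))]), W.abs_fderiv_weightFn_le⟩

/-- A smooth compactly supported function which equals `1` near the origin. -/
noncomputable def cutoff (N : ℕ) : ContDiffBump (0 : Vel N) := ⟨1, 2, one_pos, by norm_num⟩

/-- The operator v·∇ commutes with dilations, so this single constant serves for the cutoffs at all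
scales. -/
lemma exists_cutoff_drift_bound (N : ℕ) :
    ∃ K : ℝ, 0 ≤ K ∧ ∀ v : Vel N, |fderiv ℝ (cutoff N) v v| ≤ K := by
  have hc : Continuous (fun v : Vel N => fderiv ℝ (cutoff N) v v) :=
    ((cutoff N).contDiff (n := 1).continuous_fderiv (by norm_num)).clm_apply continuous_id
  have hsupp : HasCompactSupport (fun v : Vel N => fderiv ℝ (cutoff N) v v) := by
    refine ((cutoff N).hasCompactSupport.fderiv (𝕜 := ℝ)).mono fun v hv => ?_
    simp only [Function.mem_support, ne_eq] at hv ⊢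
    intro h0
    exact hv (by rw [h0]; rfl)
  obtain ⟨K, hK⟩ := hc.bounded_above_of_compact_support hsupp
  exact ⟨K, (norm_nonneg _).trans (hK 0), hK⟩

/-- The truncation of a test function at distance of order `n`. -/
noncomputable def truncated (ψ : Vel N → ℝ) (n : ℕ) (v : Vel N) : ℝ :=
  ψ v * cutoff N (((n : ℝ) + 1)⁻¹ • v)

lemma tendsto_scale (v : Vel N) :
    Tendsto (fun n : ℕ => ((n : ℝ) + 1)⁻¹ • v) atTop (𝓝 0) := by
  have h : Tendsto (fun n : ℕ => ((n : ℝ) + 1)⁻¹) atTop (𝓝 0) := by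
    simpa using tendsto_one_div_add_atTop_nhds_zero_nat (𝕜 := ℝ)
  simpa using h.smul_const v

namespace IsAdmissible

variable {ψ : Vel N → ℝ} {C : ℝ}

lemma contDiff_truncated (h : IsAdmissible ψ C) (n : ℕ) : ContDiff ℝ ∞ (truncated ψ n) :=
  h.smooth.mul ((cutoff N).contDiff.comp (contDiff_const_smul _))

lemma hasCompactSupport_truncated (ψ : Vel N → ℝ) (n : ℕ) :
    HasCompactSupport (truncated ψ n) := by
  have h0 : ((n : ℝ) + 1)⁻¹ ≠ 0 := by positivity
  have := (cutoff N).hasCompactSupport.comp_homeomorph (Homeomorph.smulOfNeZero _ h0)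
  exact HasCompactSupport.mul_left this

lemma tendsto_truncated (ψ : Vel N → ℝ) (v : Vel N) :
    Tendsto (fun n => truncated ψ n v) atTop (𝓝 (ψ v)) := by
  have h1 : Tendsto (fun n : ℕ => cutoff N (((n : ℝ) + 1)⁻¹ • v)) atTop (𝓝 (cutoff N 0)) :=
    (((cutoff N).continuous).tendsto 0).comp (tendsto_scale v)
  have h2 : cutoff N (0 : Vel N) = 1 :=
    (cutoff N).one_of_mem_closedBall (Metric.mem_closedBall_self zero_le_one)
  rw [h2] at h1
  simpa [truncated] using h1.const_mul (ψ v)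

lemma fderiv_truncated (h : IsAdmissible ψ C) (n : ℕ) (v : Vel N) :
    fderiv ℝ (truncated ψ n) v v = ψ v *
        fderiv ℝ (cutoff N) (((n : ℝ) + 1)⁻¹ • v) (((n : ℝ) + 1)⁻¹ • v) +
      cutoff N (((n : ℝ) + 1)⁻¹ • v) * fderiv ℝ ψ v v := by
  set c := ((n : ℝ) + 1)⁻¹
  have h1 : HasFDerivAt ψ (fderiv ℝ ψ v) v :=
    (h.smooth.differentiable (by norm_num) v).hasFDerivAt
  have h2 : HasFDerivAt (cutoff N : Vel N → ℝ) (fderiv ℝ (cutoff N) (c • v)) (c • v) :=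
    (((cutoff N).contDiff (n := 1)).differentiable (by norm_num) _).hasFDerivAt
  have h3 : HasFDerivAt (fun w : Vel N => c • w) (c • ContinuousLinearMap.id ℝ (Vel N)) v :=
    (hasFDerivAt_id v).const_smul c
  have h4 := h1.mul (h2.comp v h3)
  have h5 : fderiv ℝ (truncated ψ n) v = _ := h4.fderiv
  rw [h5]
  simp

lemma abs_truncated_le (h : IsAdmissible ψ C) (n : ℕ) (v : Vel N) :
    |truncated ψ n v| ≤ C * jap v ^ 2 := by
  rw [truncated, abs_mul, abs_of_nonneg (cutoff N).nonneg]
  exact (mul_le_of_le_one_right (abs_nonneg _) (cutoff N).le_one).trans (h.le v)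

lemma tendsto_fderiv_truncated (h : IsAdmissible ψ C) (v : Vel N) :
    Tendsto (fun n => fderiv ℝ (truncated ψ n) v v) atTop (𝓝 (fderiv ℝ ψ v v)) := by
  simp only [h.fderiv_truncated]
  have hc : Continuous (fun v : Vel N => fderiv ℝ (cutoff N) v v) :=
    ((cutoff N).contDiff (n := 1).continuous_fderiv (by norm_num)).clm_apply continuous_id
  have h0 := ((hc.tendsto 0).comp (tendsto_scale v)).const_mul (ψ v)
  have h1 : Tendsto (fun n : ℕ => cutoff N (((n : ℝ) + 1)⁻¹ • v)) atTop (𝓝 (cutoff N 0)) :=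
    (((cutoff N).continuous).tendsto 0).comp (tendsto_scale v)
  have h2 : cutoff N (0 : Vel N) = 1 :=
    (cutoff N).one_of_mem_closedBall (Metric.mem_closedBall_self zero_le_one)
  rw [h2] at h1
  have := h0.add (h1.mul_const (fderiv ℝ ψ v v))
  simpa using this

/-- The truncations are admissible, uniformly. -/
lemma exists_truncated (h : IsAdmissible ψ C) :
    ∃ C', ∀ n, IsAdmissible (truncated ψ n) C' := by
  obtain ⟨K, hK0, hK⟩ := exists_cutoff_drift_bound N
  have hC := h.nonneg
  refine ⟨C * (K + 1), fun n => ⟨h.contDiff_truncated n, fun v => ?_, fun v => ?_⟩⟩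
  · refine (h.abs_truncated_le n v).trans ?_
    nlinarith [mul_nonneg (mul_nonneg hC hK0) (sq_nonneg (jap v))]
  · rw [h.fderiv_truncated]
    have e1 := mul_le_mul (h.le v) (hK (((n : ℝ) + 1)⁻¹ • v)) (abs_nonneg _)
      (mul_nonneg hC (sq_nonneg _))
    have e2 : |cutoff N (((n : ℝ) + 1)⁻¹ • v) * fderiv ℝ ψ v v| ≤ C * jap v ^ 2 := by
      rw [abs_mul, abs_of_nonneg (cutoff N).nonneg]
      exact (mul_le_of_le_one_left (abs_nonneg _) (cutoff N).le_one).trans (h.drift_le v)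
    refine (abs_add_le _ _).trans ?_
    rw [abs_mul]
    linarith

end IsAdmissible

lemma tendsto_generator_truncated {b : ℝ → ℝ} (hbk : IsAngularKernel b) {e : ℝ} (he₀ : 0 ≤ e)
    (he₁ : e < 1) {f ψ : Vel N → ℝ} (hf : InL13 f) {C : ℝ} (h : IsAdmissible ψ C) :
    Tendsto (fun n => generator b e f (truncated ψ n)) atTop (𝓝 (generator b e f ψ)) := by
  obtain ⟨C', hC'⟩ := h.exists_truncated
  obtain ⟨b₀, b₁, h0, hb⟩ := hbk.bounds
  refine Tendsto.add ?_ ?_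
  · rw [collisionDual_eq_of_integrable
      (integrable_collInt hbk he₀ he₁ hf h.smooth.continuous h.le)]
    simp only [fun n => collisionDual_eq_of_integrable
      (integrable_collInt hbk he₀ he₁ hf (hC' n).smooth.continuous (hC' n).le)]
    refine tendsto_integral_of_dominated_convergence _ (fun n => aestronglyMeasurable_collInt hbk e
      hf.meas hf.meas (hC' n).smooth.continuous)
      (((integrable_tensor hf.abs.int hf.abs.int_jap_sq).add
        (integrable_tensor hf.abs.int_jap_sq hf.abs.int)).const_mul (4 * C' * b₁))
      (fun n => ae_of_all _ fun p => abs_collInt_le h0 hb hbk he₀ he₁ (hC' n).le p)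
      (ae_of_all _ fun p => ?_)
    exact ((IsAdmissible.tendsto_truncated ψ _).sub
      (IsAdmissible.tendsto_truncated ψ _)).const_mul _
  · refine tendsto_integral_of_dominated_convergence (fun v => C' * (|f v| * jap v ^ 2))
      (fun n => hf.meas.mul (hC' n).continuous_drift.aestronglyMeasurable)
      (hf.abs.int_jap_sq.const_mul C') (fun n => ae_of_all _ fun v => ?_)
      (ae_of_all _ fun v => (h.tendsto_fderiv_truncated v).const_mul _)
    rw [norm_mul, Real.norm_eq_abs, Real.norm_eq_abs]
    nlinarith [mul_le_mul_of_nonneg_left ((hC' n).drift_le v) (abs_nonneg (f v))]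

lemma abs_generator_le {b : ℝ → ℝ} {b₀ b₁ : ℝ} (h0 : 0 < b₀)
    (hb : ∀ x ∈ Icc (-1 : ℝ) 1, b₀ ≤ b x ∧ b x ≤ b₁) (hbk : IsAngularKernel b) {e : ℝ}
    (he₀ : 0 ≤ e) (he₁ : e < 1) {f ψ : Vel N → ℝ} (hf : InL13 f) {C : ℝ}
    (h : IsAdmissible ψ C) :
    |generator b e f ψ| ≤ 8 * C * b₁ * sphereArea N * (∫ v, |f v| * jap v ^ 2) *
      (∫ v, |f v| * jap v ^ 3) + C * ∫ v, |f v| * jap v ^ 2 := by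
  refine (abs_add_le _ _).trans (add_le_add
    (abs_collisionDual_le h0 hb hbk he₀ he₁ hf h.smooth.continuous h.le) ?_)
  rw [← integral_const_mul]
  refine norm_integral_le_of_norm_le (f := fun v => f v * fderiv ℝ ψ v v)
    (hf.abs.int_jap_sq.const_mul C) (ae_of_all _ fun v => ?_)
  rw [norm_mul, Real.norm_eq_abs, Real.norm_eq_abs]
  nlinarith [mul_le_mul_of_nonneg_left (h.drift_le v) (abs_nonneg (f v))]

namespace IsSolution

variable {b : ℝ → ℝ} {e : ℝ} {gin : Vel N → ℝ} {g : ℝ → Vel N → ℝ}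

/-- The weak formulation with test functions of quadratic growth. -/
theorem weak_eq_admissible (hs : IsSolution b e gin g) (hbk : IsAngularKernel b) (he₀ : 0 ≤ e)
    (he₁ : e < 1) (hin : MemWeightedL1 2 gin) {ψ : Vel N → ℝ} {C : ℝ} (h : IsAdmissible ψ C)
    {t : ℝ} (ht : 0 ≤ t) :
    IntervalIntegrable (fun s => generator b e (g s) ψ) volume 0 t ∧
    ∫ v, g t v * ψ v = (∫ v, gin v * ψ v) + ∫ s in (0 : ℝ)..t, generator b e (g s) ψ := by
  obtain ⟨C', hC'⟩ := h.exists_truncated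
  obtain ⟨b₀, b₁, h0, hb⟩ := hbk.bounds
  have hb1 : 0 ≤ b₁ := h0.le.trans ((hb 0 (by norm_num)).1.trans (hb 0 (by norm_num)).2)
  have hC0 := (hC' 0).nonneg
  have hω : 0 ≤ sphereArea N := measureReal_nonneg
  have hcont2 : ContinuousOn (fun t => ∫ v, g t v * jap v ^ 2) (Icc 0 t) :=
    (hs.continuousOn_integral (w := fun v => jap v ^ 2) (continuous_jap.pow 2) 1
      (fun v => by rw [abs_of_nonneg (sq_nonneg _), one_mul])).mono Icc_subset_Ici_self
  obtain ⟨M, hM⟩ := isCompact_Icc.bddAbove_image hcont2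
  have hM' : ∀ s ∈ Icc 0 t, ∫ v, |g s v| * jap v ^ 2 ≤ M := fun s hs' => by
    rw [hs.integral_abs_eq hs'.1 (fun v => jap v ^ 2)]
    exact hM (mem_image_of_mem _ hs')
  have hM0 : 0 ≤ M := (integral_nonneg fun v => by positivity).trans (hM' 0 ⟨le_rfl, ht⟩)
  have hsub : uIoc (0 : ℝ) t ⊆ Icc 0 t := by
    rw [uIoc_of_le ht]; exact Ioc_subset_Icc_self
  have hlt : volume.restrict (uIoc (0 : ℝ) t) ≤ volume.restrict (Icc 0 t) :=
    Measure.restrict_mono hsub le_rfl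
  have hae : ∀ᵐ s ∂(volume.restrict (uIoc (0 : ℝ) t)), s ∈ Icc 0 t ∧ InL13 (g s) := by
    filter_upwards [ae_mono hlt (hs.ae_inL13 t), ae_mono hlt (ae_restrict_mem measurableSet_Icc)]
      with s h1 h2 using ⟨h2, h1⟩
  -- The second moment is bounded on [0, t], so the generator is affinely controlled by the third
  -- moment, which is integrable in time.
  set bound : ℝ → ℝ := fun s => 8 * C' * b₁ * sphereArea N * M *
      (∫ v, |g s v| * jap v ^ 3) + C' * M with hbound
  have hbi : Integrable bound (volume.restrict (uIoc (0 : ℝ) t)) := by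
    have : IsFiniteMeasure (volume.restrict (uIoc (0 : ℝ) t)) := by
      rw [uIoc_of_le ht]; infer_instance
    exact (((hs.integrable_third_moment t).mono_measure hlt).const_mul _).add
      (integrable_const _)
  -- Truncated test functions are bounded, so their generator is continuous in time; measurability
  -- for ψ itself follows by passing to the limit.
  have hmeas : ∀ n, AEStronglyMeasurable (fun s => generator b e (g s) (truncated ψ n))
      (volume.restrict (uIoc (0 : ℝ) t)) := fun n => by
    obtain ⟨K, hK⟩ := (hC' n).smooth.continuous.bounded_above_of_compact_support
      (IsAdmissible.hasCompactSupport_truncated ψ n)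
    have hc := (hs.continuousOn_collisionDual hbk (hC' n).smooth.continuous hK).add
      (hs.continuousOn_integral (hC' n).continuous_drift C' (hC' n).drift_le)
    exact ((hc.mono (hsub.trans Icc_subset_Ici_self)).aemeasurable
      measurableSet_uIoc).aestronglyMeasurable
  have hle : ∀ ψ', IsAdmissible ψ' C' → ∀ᵐ s ∂(volume.restrict (uIoc (0 : ℝ) t)),
      ‖generator b e (g s) ψ'‖ ≤ bound s := fun ψ' hψ' => by
    filter_upwards [hae] with s hs'
    refine (abs_generator_le h0 hb hbk he₀ he₁ hs'.2 hψ').trans ?_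
    have e1 := hM' s hs'.1
    have e2 : 0 ≤ ∫ v, |g s v| * jap v ^ 3 := integral_nonneg fun v => by
      have := jap_pos v; positivity
    simp only [hbound]
    gcongr
  have hlim : ∀ᵐ s ∂(volume.restrict (uIoc (0 : ℝ) t)),
      Tendsto (fun n => generator b e (g s) (truncated ψ n)) atTop (𝓝 (generator b e (g s) ψ)) := by
    filter_upwards [hae] with s hs' using tendsto_generator_truncated hbk he₀ he₁ hs'.2 h
  have hlimb : ∀ᵐ s ∂(volume.restrict (uIoc (0 : ℝ) t)), ‖generator b e (g s) ψ‖ ≤ bound s := by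
    have := ae_all_iff.2 fun n => hle _ (hC' n)
    filter_upwards [hlim, this] with s h1 h2
    exact le_of_tendsto h1.norm (Eventually.of_forall h2)
  have hint : IntervalIntegrable (fun s => generator b e (g s) ψ) volume 0 t :=
    intervalIntegrable_iff.2 (hbi.mono' (aestronglyMeasurable_of_tendsto_ae _ hmeas hlim) hlimb)
  refine ⟨hint, ?_⟩
  have t1 : Tendsto (fun n => ∫ s in (0 : ℝ)..t, generator b e (g s) (truncated ψ n)) atTop
      (𝓝 (∫ s in (0 : ℝ)..t, generator b e (g s) ψ)) := by
    refine intervalIntegral.tendsto_integral_filter_of_dominated_convergence bound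
      (Eventually.of_forall hmeas) (Eventually.of_forall fun n => ?_)
      (intervalIntegrable_iff.2 hbi) ?_
    · exact (ae_restrict_iff' measurableSet_uIoc).1 (hle _ (hC' n))
    · exact (ae_restrict_iff' measurableSet_uIoc).1 hlim
  have t2 : ∀ f : Vel N → ℝ, MemWeightedL1 2 f →
      Tendsto (fun n => ∫ v, f v * truncated ψ n v) atTop (𝓝 (∫ v, f v * ψ v)) := fun f hf => by
    refine tendsto_integral_of_dominated_convergence (fun v => C' * (|f v| * jap v ^ 2))
      (fun n => hf.1.mul (hC' n).smooth.continuous.aestronglyMeasurable)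
      (hf.abs_integrable.const_mul C') (fun n => ae_of_all _ fun v => ?_)
      (ae_of_all _ fun v => (IsAdmissible.tendsto_truncated ψ v).const_mul _)
    rw [norm_mul, Real.norm_eq_abs, Real.norm_eq_abs]
    nlinarith [mul_le_mul_of_nonneg_left ((hC' n).le v) (abs_nonneg (f v))]
  refine tendsto_nhds_unique (t2 _ (hs.mem t ht)) (((t2 _ hin).add t1).congr fun n => ?_)
  exact (hs.weak_eq _ (hC' n).smooth (IsAdmissible.hasCompactSupport_truncated ψ n) t ht).symm

/-- Increment of a moment between two times. -/
lemma weak_eq_sub (hs : IsSolution b e gin g) (hbk : IsAngularKernel b) (he₀ : 0 ≤ e)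
    (he₁ : e < 1) (hin : MemWeightedL1 2 gin) {ψ : Vel N → ℝ} {C : ℝ} (h : IsAdmissible ψ C)
    {s t : ℝ} (hs0 : 0 ≤ s) (ht : 0 ≤ t) :
    IntervalIntegrable (fun τ => generator b e (g τ) ψ) volume s t ∧
    (∫ v, g t v * ψ v) - ∫ v, g s v * ψ v = ∫ τ in s..t, generator b e (g τ) ψ := by
  obtain ⟨i1, e1⟩ := hs.weak_eq_admissible hbk he₀ he₁ hin h ht
  obtain ⟨i2, e2⟩ := hs.weak_eq_admissible hbk he₀ he₁ hin h hs0
  refine ⟨i2.symm.trans i1, ?_⟩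
  rw [e1, e2, ← intervalIntegral.integral_interval_sub_left i1 i2]
  ring

/-! ### Conservation laws -/

lemma mass_eq (hs : IsSolution b e gin g) (hbk : IsAngularKernel b) (he₀ : 0 ≤ e)
    (he₁ : e < 1) (hin : MemWeightedL1 2 gin) {t : ℝ} (ht : 0 ≤ t) : mass (g t) = mass gin := by
  have hadm : IsAdmissible (fun _ : Vel N => (1 : ℝ)) 1 :=
    ⟨contDiff_const, fun v => by simpa using one_le_jap_sq v, fun v => by
      simpa using sq_nonneg (jap v)⟩
  have h := (hs.weak_eq_admissible hbk he₀ he₁ hin hadm ht).2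
  simpa [generator, collisionDual, mass] using h

lemma collisionDual_coord {f : Vel N → ℝ} (hf : InL13 f) (hbk : IsAngularKernel b) (he₀ : 0 ≤ e)
    (he₁ : e < 1) (i : Fin N) : collisionDual b e f (fun v => v i) = 0 := by
  have hI := integrable_collInt hbk he₀ he₁ hf (ψ := fun v => v i) (by fun_prop) (C := 1)
    (fun v => (abs_coord_le v i).trans (by nlinarith [one_le_jap v]))
  have h := (two_mul_collisionDual hI).2
  have hz : ∀ p : Vel N × Vel N × UnitSphere N, postVel e p.1 p.2.1 (p.2.2 : Vel N) i +
      postVel e p.2.1 p.1 (-(p.2.2 : Vel N)) i - p.1 i - p.2.1 i = 0 := fun p => by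
    simp only [postVel, norm_sub_rev p.2.1 p.1, PiLp.add_apply, PiLp.smul_apply, PiLp.sub_apply,
      PiLp.neg_apply, smul_eq_mul]
    ring
  simp only [hz, mul_zero, integral_zero] at h
  linarith

/-- Collisions conserve momentum and the drift reproduces it, so p(t) = ∫₀ᵗ p and Gronwall's lemma
gives p = 0. Without this the linear term of the tangent inequality would survive. -/
lemma coord_moment_eq_zero (hs : IsSolution b e gin g) (hbk : IsAngularKernel b) (he₀ : 0 ≤ e)
    (he₁ : e < 1) (hin : IsInitialDatum gin) (i : Fin N) {t : ℝ} (ht : 0 ≤ t) :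
    ∫ v, g t v * v i = 0 := by
  have hle : ∀ v : Vel N, |v i| ≤ 1 * jap v ^ 2 := fun v =>
    (abs_coord_le v i).trans (by nlinarith [one_le_jap v])
  have hder : ∀ v : Vel N, fderiv ℝ (fun v : Vel N => v i) v v = v i := fun v => by
    have := (EuclideanSpace.proj (𝕜 := ℝ) i).hasFDerivAt (x := v)
    have h2 : fderiv ℝ (fun v : Vel N => v i) v = EuclideanSpace.proj i := this.fderiv
    rw [h2]; rfl
  have hadm : IsAdmissible (fun v : Vel N => v i) 1 :=
    ⟨(EuclideanSpace.proj (𝕜 := ℝ) i).contDiff, hle, fun v => by rw [hder]; exact hle v⟩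
  set p : ℝ → ℝ := fun t => ∫ v, g t v * v i with hp
  have hpc : ContinuousOn p (Ici 0) := hs.continuousOn_integral (by fun_prop) 1 hle
  have hp0 : ∫ v, gin v * v i = 0 := by
    have hint : Integrable (fun v : Vel N => gin v • v) := by
      refine hin.mem.abs_integrable.mono' (hin.mem.1.smul aestronglyMeasurable_id)
        (ae_of_all _ fun v => ?_)
      rw [norm_smul, Real.norm_eq_abs]
      exact mul_le_mul_of_nonneg_left ((norm_le_jap v).trans (by nlinarith [one_le_jap v]))
        (abs_nonneg _)
    have h1 := (EuclideanSpace.proj (𝕜 := ℝ) i).integral_comp_comm hint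
    have h2 : ∫ v, gin v • v = 0 := hin.momentum_eq_zero
    rw [h2, map_zero] at h1
    simpa using h1
  have hpe : ∀ t, 0 ≤ t → p t = ∫ s in (0 : ℝ)..t, p s := fun t ht => by
    have h := (hs.weak_eq_admissible hbk he₀ he₁ hin.mem hadm ht).2
    rw [hp0, zero_add] at h
    refine h.trans (intervalIntegral.integral_congr_ae ?_)
    have := (ae_restrict_iff' measurableSet_Icc).1 (hs.ae_inL13 t)
    filter_upwards [this] with s hs' hs''
    rw [uIoc_of_le ht] at hs''
    have := hs' (Ioc_subset_Icc_self hs'')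
    simp only [generator, collisionDual_coord this hbk he₀ he₁ i, zero_add, hder, hp]
  -- A continuous extension to negative times makes the primitive differentiable everywhere.
  set P : ℝ → ℝ := fun t => p (max t 0) with hP
  have hPc : Continuous P := hpc.comp_continuous (by fun_prop) fun t => mem_Ici.2 (le_max_right _ _)
  set U : ℝ → ℝ := fun t => ∫ s in (0 : ℝ)..t, P s with hU
  have hUd : ∀ t, HasDerivAt U (P t) t := fun t => hPc.integral_hasStrictDerivAt 0 t |>.hasDerivAt
  have hUP : ∀ t, 0 ≤ t → P t = U t := fun t ht => by
    simp only [hP, hU, max_eq_left ht]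
    rw [hpe t ht]
    refine intervalIntegral.integral_congr fun s hs' => ?_
    rw [uIcc_of_le ht] at hs'
    simp only [max_eq_left hs'.1]
  have hgr := norm_le_gronwallBound_of_norm_deriv_right_le (f := U) (f' := P) (δ := 0) (K := 1)
    (ε := 0) (a := 0) (b := t) (fun s _ => (hUd s).continuousAt.continuousWithinAt)
    (fun s _ => (hUd s).hasDerivWithinAt) (by simp [hU])
    (fun s hs' => by rw [hUP s hs'.1]; simp) t ⟨ht, le_rfl⟩
  rw [gronwallBound_ε0_δ0, norm_le_zero_iff, ← hUP t ht] at hgr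
  simpa [hP, hp, max_eq_left ht] using hgr

/-- At almost every time, the solution is a profile. -/
lemma ae_isProfile (hs : IsSolution b e gin g) (hbk : IsAngularKernel b) (he₀ : 0 ≤ e)
    (he₁ : e < 1) (hin : IsInitialDatum gin) (T : ℝ) :
    ∀ᵐ t ∂(volume.restrict (Icc 0 T)), IsProfile (g t) := by
  filter_upwards [hs.ae_inL13 T, ae_restrict_mem measurableSet_Icc] with t h1 h2
  exact ⟨h1, hs.nonneg t h2.1, fun i => hs.coord_moment_eq_zero hbk he₀ he₁ hin i h2.1⟩

/-- Integrated differential inequalities for moments. -/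
lemma moment_sub_le (hs : IsSolution b e gin g) (hbk : IsAngularKernel b) (he₀ : 0 ≤ e)
    (he₁ : e < 1) (hin : IsInitialDatum gin) {ψ : Vel N → ℝ} {C : ℝ} (h : IsAdmissible ψ C)
    {s t : ℝ} (hs0 : 0 ≤ s) (hst : s ≤ t) {U : ℝ → ℝ} (hU : ContinuousOn U (Icc s t))
    (hle : ∀ τ ∈ Icc s t, IsProfile (g τ) → generator b e (g τ) ψ ≤ U τ) :
    (∫ v, g t v * ψ v) - ∫ v, g s v * ψ v ≤ ∫ τ in s..t, U τ := by
  obtain ⟨i1, e1⟩ := hs.weak_eq_sub hbk he₀ he₁ hin.mem h hs0 (hs0.trans hst)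
  rw [e1]
  refine intervalIntegral.integral_mono_ae_restrict hst i1 (hU.intervalIntegrable_of_Icc hst) ?_
  have hlt : volume.restrict (Icc s t) ≤ volume.restrict (Icc 0 t) :=
    Measure.restrict_mono (Icc_subset_Icc_left hs0) le_rfl
  filter_upwards [ae_mono hlt (hs.ae_isProfile hbk he₀ he₁ hin t),
    ae_restrict_mem measurableSet_Icc] with τ h1 h2 using hle τ h2 h1

end IsSolution

/-! ### Concrete weights -/

/-- The bounded approximation `x / (1 + ε x)` of the identity. -/
noncomputable def trunc (ε x : ℝ) : ℝ := x / (1 + ε * x)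

section trunc

variable {ε x y : ℝ}

lemma trunc_den_pos (hε : 0 < ε) (hx : 0 < x) : 0 < 1 + ε * x := by positivity

lemma trunc_pos (hε : 0 < ε) (hx : 0 < x) : 0 < trunc ε x :=
  div_pos hx (trunc_den_pos hε hx)

lemma trunc_le_self (hε : 0 < ε) (hx : 0 < x) : trunc ε x ≤ x :=
  div_le_self hx.le (by nlinarith [mul_pos hε hx])

lemma trunc_le_inv (hε : 0 < ε) (hx : 0 < x) : trunc ε x ≤ 1 / ε := by
  rw [trunc, div_le_div_iff₀ (trunc_den_pos hε hx) hε]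
  nlinarith

lemma trunc_mono (hε : 0 < ε) (hx : 0 < x) (hxy : x ≤ y) : trunc ε x ≤ trunc ε y := by
  have hy := hx.trans_le hxy
  rw [trunc, trunc, div_le_div_iff₀ (trunc_den_pos hε hx) (trunc_den_pos hε hy)]
  nlinarith

/-- Here and in `div_mul_trunc_le` the reason is that `trunc ε x / x` = 1/(1 + εx) decreases in x.
Both bounds are uniform in ε and let the truncation replace x in the Povzner estimates. -/
lemma trunc_add_le (hε : 0 < ε) (hx : 0 < x) (hy : 0 < y) :
    trunc ε (x + y) ≤ (1 + y / x) * trunc ε x := by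
  have h : (1 + y / x) * trunc ε x = (x + y) / (1 + ε * x) := by
    have := trunc_den_pos hε hx
    rw [trunc]; field_simp
  rw [h, trunc]
  exact div_le_div_of_nonneg_left (by linarith) (trunc_den_pos hε hx)
    (by nlinarith [mul_pos hε hy])

lemma div_mul_trunc_le (hε : 0 < ε) (hy : 0 < y) (hyx : y ≤ x) :
    y / x * trunc ε x ≤ trunc ε y := by
  have hx := hy.trans_le hyx
  have h : y / x * trunc ε x = y / (1 + ε * x) := by
    have := trunc_den_pos hε hx
    rw [trunc]; field_simp
  rw [h, trunc]
  exact div_le_div_of_nonneg_left hy.le (trunc_den_pos hε hy) (by nlinarith)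

lemma hasDerivAt_trunc (hε : 0 < ε) (hx : 0 < x) :
    HasDerivAt (trunc ε) (1 / (1 + ε * x) ^ 2) x := by
  have hd := trunc_den_pos hε hx
  have h := (hasDerivAt_id x).div (((hasDerivAt_id x).const_mul ε).const_add 1) hd.ne'
  refine h.congr_deriv ?_
  simp only [id]
  congr 1
  ring

lemma mul_deriv_trunc_le (hε : 0 < ε) (hx : 0 < x) :
    0 ≤ x * (1 / (1 + ε * x) ^ 2) ∧ x * (1 / (1 + ε * x) ^ 2) ≤ trunc ε x := by
  have hd := trunc_den_pos hε hx
  refine ⟨by positivity, ?_⟩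
  rw [trunc, mul_one_div]
  refine div_le_div_of_nonneg_left hx.le hd ?_
  nlinarith [mul_pos hε hx]

lemma contDiffOn_trunc (hε : 0 < ε) : ContDiffOn ℝ ∞ (trunc ε) (Ioi 0) := by
  unfold trunc
  exact contDiffOn_id.div (contDiffOn_const.add (contDiffOn_const.mul contDiffOn_id))
    fun x hx => (trunc_den_pos hε hx).ne'

lemma contDiffOn_trunc_rpow (hε : 0 < ε) (q : ℝ) :
    ContDiffOn ℝ ∞ (fun x => trunc ε x ^ q) (Ioi 0) :=
  (contDiffOn_trunc hε).rpow_const_of_ne fun _ hx => (trunc_pos hε hx).ne'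

/-- The logarithmic derivative of a power of `trunc`. -/
lemma hasDerivAt_trunc_rpow (hε : 0 < ε) (hx : 0 < x) {q : ℝ} (hq : 0 ≤ q) :
    ∃ d, HasDerivAt (fun x => trunc ε x ^ q) d x ∧ 0 ≤ x * d ∧ x * d ≤ q * trunc ε x ^ q := by
  have hk := trunc_pos hε hx
  refine ⟨_, (hasDerivAt_trunc hε hx).rpow_const (Or.inl hk.ne'), ?_, ?_⟩
  · have := (mul_deriv_trunc_le hε hx).1
    positivity
  · have h1 := (mul_deriv_trunc_le hε hx).2
    have h2 : trunc ε x ^ q = trunc ε x ^ (q - 1) * trunc ε x := by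
      rw [← Real.rpow_add_one hk.ne', sub_add_cancel]
    rw [h2]
    calc x * (1 / (1 + ε * x) ^ 2 * q * trunc ε x ^ (q - 1))
        = q * (trunc ε x ^ (q - 1) * (x * (1 / (1 + ε * x) ^ 2))) := by ring
      _ ≤ _ := by gcongr

lemma tendsto_trunc (x : ℝ) :
    Tendsto (fun n : ℕ => trunc (1 / ((n : ℝ) + 1)) x) atTop (𝓝 x) := by
  have h := (tendsto_one_div_add_atTop_nhds_zero_nat (𝕜 := ℝ)).mul_const x
  have h2 : Tendsto (fun n : ℕ => x / (1 + 1 / ((n : ℝ) + 1) * x)) atTop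
      (𝓝 (x / (1 + 0 * x))) := tendsto_const_nhds.div (h.const_add 1) (by simp)
  simpa [trunc] using h2

end trunc

/-- The gain bracket vanishes identically, so D = 0: the second moment is bounded without prior
information. -/
lemma isWeight_one : IsWeight (fun _ => (1 : ℝ)) (fun _ => 1) 0 0 1 where
  smooth := contDiffOn_const
  nonneg _ _ := zero_le_one
  mono := monotoneOn_const
  le _ _ := le_rfl
  deriv_le _ _ := by simp
  abs_deriv_le _ _ := by simp
  povzner _ _ _ _ := by simp
  D_nonneg := le_rfl
  m_cont := continuousOn_const
  m_nonneg _ _ := zero_le_one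
  m_le _ _ := le_rfl

/-- The right-hand side is the chord over [0, 1] of a convex function. -/
lemma one_add_pow_le {z : ℝ} (hz0 : 0 ≤ z) (hz1 : z ≤ 1) (n : ℕ) :
    (1 + z) ^ n ≤ 1 + (2 ^ n - 1) * z := by
  induction n with
  | zero => simp
  | succ n ih =>
    have h2 : (1 : ℝ) ≤ 2 ^ n := one_le_pow₀ (by norm_num)
    rw [pow_succ, pow_succ]
    have := mul_le_mul_of_nonneg_right ih (show 0 ≤ 1 + z by linarith)
    nlinarith [mul_nonneg (mul_nonneg (sub_nonneg.2 h2) hz0) (sub_nonneg.2 hz1)]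

/-- The constant in the Povzner type estimate for the weight `x ^ q`. -/
noncomputable def polyConst (q : ℝ) : ℝ := 2 * 2 ^ ⌈q⌉₊

lemma le_polyConst (q : ℝ) : q ≤ polyConst q := by
  have h1 : q ≤ ⌈q⌉₊ := Nat.le_ceil q
  have h2 : ((⌈q⌉₊ : ℕ) : ℝ) ≤ 2 ^ ⌈q⌉₊ := by
    exact_mod_cast (Nat.lt_two_pow_self (n := ⌈q⌉₊)).le
  have h3 : (0 : ℝ) < 2 ^ ⌈q⌉₊ := by positivity
  unfold polyConst
  linarith

/-- Polynomial weights. -/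
lemma isWeight_poly {ε : ℝ} (hε : 0 < ε) {q : ℝ} (hq : 0 ≤ q) :
    IsWeight (fun x => trunc ε x ^ q) (fun _ => 1) (polyConst q) 0
      ((1 + q) * (1 / ε) ^ q + 1) where
  smooth := contDiffOn_trunc_rpow hε q
  nonneg x hx := Real.rpow_nonneg (trunc_pos hε (by linarith)).le _
  mono x hx y hy hxy := by
    have h0 : (0 : ℝ) < x := lt_of_lt_of_le one_pos hx
    exact Real.rpow_le_rpow (trunc_pos hε h0).le (trunc_mono hε h0 hxy) hq
  le x hx := by
    have h0 : (0 : ℝ) < x := by linarith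
    have h1 := Real.rpow_le_rpow (trunc_pos hε h0).le (trunc_le_inv hε h0) hq
    have h2 : 0 ≤ (1 / ε) ^ q := by positivity
    nlinarith
  deriv_le x hx := by
    have h0 : (0 : ℝ) < x := by linarith
    obtain ⟨d, hd, -, hd2⟩ := hasDerivAt_trunc_rpow hε h0 hq
    rw [hd.deriv]
    have h3 : 0 ≤ trunc ε x ^ q := Real.rpow_nonneg (trunc_pos hε h0).le _
    have := mul_le_mul_of_nonneg_right (le_polyConst q) h3
    linarith
  abs_deriv_le x hx := by
    have h0 : (0 : ℝ) < x := by linarith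
    obtain ⟨d, hd, hd1, hd2⟩ := hasDerivAt_trunc_rpow hε h0 hq
    rw [hd.deriv, abs_of_nonneg hd1]
    have h1 := Real.rpow_le_rpow (trunc_pos hε h0).le (trunc_le_inv hε h0) hq
    have h2 : 0 ≤ (1 / ε) ^ q := by positivity
    nlinarith
  povzner x y hy hyx := by
    have hx0 : (0 : ℝ) < x := by linarith
    have hy0 : (0 : ℝ) < y := by linarith
    have hz0 : 0 ≤ y / x := by positivity
    have hz1 : y / x ≤ 1 := (div_le_one hx0).2 hyx
    set K : ℝ := 2 ^ ⌈q⌉₊ with hK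
    have hk := (trunc_pos hε hx0).le
    have hh : 0 ≤ trunc ε x ^ q := Real.rpow_nonneg hk _
    have hhy : 0 ≤ trunc ε y ^ q := Real.rpow_nonneg (trunc_pos hε hy0).le _
    have h1 : trunc ε (x + y) ^ q ≤ (1 + (K - 1) * (y / x)) * trunc ε x ^ q := by
      calc trunc ε (x + y) ^ q ≤ ((1 + y / x) * trunc ε x) ^ q :=
            Real.rpow_le_rpow (trunc_pos hε (by linarith)).le (trunc_add_le hε hx0 hy0) hq
        _ = (1 + y / x) ^ q * trunc ε x ^ q := Real.mul_rpow (by linarith) hk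
        _ ≤ (1 + y / x) ^ ((⌈q⌉₊ : ℕ) : ℝ) * trunc ε x ^ q := by
            refine mul_le_mul_of_nonneg_right ?_ hh
            exact Real.rpow_le_rpow_of_exponent_le (by linarith) (Nat.le_ceil q)
        _ ≤ _ := by
            rw [Real.rpow_natCast]
            exact mul_le_mul_of_nonneg_right (one_add_pow_le hz0 hz1 _) hh
    have hsq : 1 ≤ √x := Real.one_le_sqrt.2 (by linarith)
    have hK1 : 1 ≤ K := one_le_pow₀ (by norm_num)
    -- The terms of order x cancel and leave Ky + (K - 1)y²/x, where y ≤ x. The factor √x ≥ 1 is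
    -- inserted afterwards only to fit the common form of `povzner`.
    have h2 : (x + y) * (1 + (K - 1) * (y / x)) - x ≤ 2 * K * y := by
      have e1 : x * (y / x) = y := by field_simp
      have e2 : y * (y / x) ≤ y := mul_le_of_le_one_right hy0.le hz1
      nlinarith [mul_le_mul_of_nonneg_left e2 (sub_nonneg.2 hK1)]
    have h3 := mul_le_mul_of_nonneg_left h1 (show 0 ≤ x + y by linarith)
    have h4 := mul_le_mul_of_nonneg_right h2 hh
    have h5 : 2 * K * y * trunc ε x ^ q ≤ √x * (2 * K * y * trunc ε x ^ q) :=
      le_mul_of_one_le_left (by positivity) hsq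
    have h6 : 0 ≤ y * trunc ε y ^ q := by positivity
    simp only [polyConst, ← hK, mul_one]
    nlinarith
  D_nonneg := by unfold polyConst; positivity
  m_cont := continuousOn_const
  m_nonneg _ _ := zero_le_one
  m_le x hx := by
    have : 0 ≤ (1 / ε) ^ q := by positivity
    nlinarith [mul_nonneg hq this]

/-- Exponential weights, with exponent `β` in the variable `⟨v⟩²`. -/
noncomputable def expWeight (β ε r x : ℝ) : ℝ := Real.exp (r * trunc ε x ^ β)

/-- Qualitative bound for the exponential weights. -/
noncomputable def expBound (β ε : ℝ) : ℝ := (1 + (1 / ε) ^ β) * Real.exp ((1 / ε) ^ β)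

lemma trunc_rpow_le {β ε x : ℝ} (hε : 0 < ε) (hβ : 0 ≤ β) (hx : 0 < x) :
    0 ≤ trunc ε x ^ β ∧ trunc ε x ^ β ≤ (1 / ε) ^ β :=
  ⟨Real.rpow_nonneg (trunc_pos hε hx).le _,
    Real.rpow_le_rpow (trunc_pos hε hx).le (trunc_le_inv hε hx) hβ⟩

lemma trunc_rpow_le_sqrt {β ε x : ℝ} (hε : 0 < ε) (hβ0 : 0 ≤ β) (hβ : β ≤ 1 / 2) (hx : 1 ≤ x) :
    trunc ε x ^ β ≤ √x := by
  have h0 : (0 : ℝ) < x := by linarith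
  calc trunc ε x ^ β ≤ x ^ β := Real.rpow_le_rpow (trunc_pos hε h0).le (trunc_le_self hε h0) hβ0
    _ ≤ x ^ (1 / 2 : ℝ) := Real.rpow_le_rpow_of_exponent_le hx hβ
    _ = √x := (Real.sqrt_eq_rpow x).symm

lemma expWeight_le {β ε r x : ℝ} (hε : 0 < ε) (hβ : 0 ≤ β) (hr1 : r ≤ 1)
    (hx : 0 < x) : expWeight β ε r x ≤ Real.exp ((1 / ε) ^ β) := by
  obtain ⟨h1, h2⟩ := trunc_rpow_le hε hβ hx
  refine Real.exp_le_exp.2 ((mul_le_of_le_one_left h1 hr1).trans h2)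

/-- The exponent is subadditive, whence h(x+y) ≤ h(x) h(y) and the choice m = h. Passing from x to x
+ y raises it by at most r (y/x) `trunc ε x ^ β`, and β ≤ 1/2 bounds the last factor by √x. So
x(h(x+y) - h(x)) and y h(x+y) are each at most y √x h(x) h(y), which gives D = 2. The same bound by
√x yields the drift constant r. -/
lemma isWeight_exp {β ε r : ℝ} (hε : 0 < ε) (hβ0 : 0 ≤ β) (hβ : β ≤ 1 / 2) (hr0 : 0 ≤ r)
    (hr1 : r ≤ 1) :
    IsWeight (expWeight β ε r) (expWeight β ε r) 2 r (expBound β ε) := by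
  have hle : ∀ x, 1 ≤ x → expWeight β ε r x ≤ expBound β ε := fun x hx => by
    have h1 := expWeight_le hε hβ0 hr1 (show 0 < x by linarith)
    have h2 : 0 ≤ (1 / ε) ^ β := by positivity
    have := Real.exp_pos ((1 / ε) ^ β)
    unfold expBound
    nlinarith
  have hsm : ContDiffOn ℝ ∞ (expWeight β ε r) (Ioi 0) :=
    (contDiffOn_const.mul (contDiffOn_trunc_rpow hε β)).exp
  have hder : ∀ x, 1 ≤ x → 0 ≤ x * deriv (expWeight β ε r) x ∧
      x * deriv (expWeight β ε r) x ≤ r * trunc ε x ^ β * expWeight β ε r x := fun x hx => by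
    have h0 : (0 : ℝ) < x := by linarith
    obtain ⟨d, hd, hd1, hd2⟩ := hasDerivAt_trunc_rpow hε h0 hβ0
    have h2 : HasDerivAt (expWeight β ε r) (expWeight β ε r x * (r * d)) x :=
      (hd.const_mul r).exp
    have hpos : 0 ≤ expWeight β ε r x := (Real.exp_pos _).le
    have hk := (trunc_rpow_le hε hβ0 h0).1
    rw [h2.deriv]
    have h3 : x * (expWeight β ε r x * (r * d)) = r * expWeight β ε r x * (x * d) := by ring
    rw [h3]
    refine ⟨by positivity, ?_⟩
    have h4 : x * d ≤ trunc ε x ^ β := hd2.trans (mul_le_of_le_one_left hk (by linarith))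
    have := mul_le_mul_of_nonneg_left h4 (show 0 ≤ r * expWeight β ε r x by positivity)
    linarith
  have hmono : MonotoneOn (expWeight β ε r) (Ici 1) := fun x hx y hy hxy => by
    have h0 : (0 : ℝ) < x := lt_of_lt_of_le one_pos hx
    exact Real.exp_le_exp.2 (mul_le_mul_of_nonneg_left
      (Real.rpow_le_rpow (trunc_pos hε h0).le (trunc_mono hε h0 hxy) hβ0) hr0)
  refine ⟨hsm, fun x _ => (Real.exp_pos _).le, hmono, hle, fun x hx => ?_, fun x hx => ?_,
    fun x y hy hyx => ?_, by norm_num, hsm.continuousOn, fun x _ => (Real.exp_pos _).le, hle⟩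
  · have h0 : (0 : ℝ) < x := by linarith
    have hpos : 0 ≤ expWeight β ε r x := (Real.exp_pos _).le
    have h1 := trunc_rpow_le_sqrt hε hβ0 hβ hx
    have h2 := mul_le_mul_of_nonneg_left h1 hr0
    have h3 := mul_le_mul_of_nonneg_right h2 hpos
    linarith [(hder x hx).2]
  · obtain ⟨h1, h2⟩ := hder x hx
    have h0 : (0 : ℝ) < x := by linarith
    rw [abs_of_nonneg h1]
    obtain ⟨k1, k2⟩ := trunc_rpow_le hε hβ0 h0
    have h3 := expWeight_le hε hβ0 hr1 h0
    have hpos : 0 ≤ expWeight β ε r x := (Real.exp_pos _).le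
    calc _ ≤ r * trunc ε x ^ β * expWeight β ε r x := h2
      _ ≤ 1 * (1 / ε) ^ β * Real.exp ((1 / ε) ^ β) := by gcongr
      _ ≤ expBound β ε := by
        unfold expBound
        nlinarith [Real.exp_pos ((1 / ε) ^ β)]
  · have hx0 : (0 : ℝ) < x := by linarith
    have hy0 : (0 : ℝ) < y := by linarith
    have hz0 : 0 ≤ y / x := by positivity
    have hz1 : y / x ≤ 1 := (div_le_one hx0).2 hyx
    have hk := trunc_pos hε hx0
    set kx := trunc ε x ^ β with hkx
    set ky := trunc ε y ^ β with hky
    set ks := trunc ε (x + y) ^ β with hks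
    have hkx0 : 0 ≤ kx := Real.rpow_nonneg hk.le _
    have hky0 : 0 ≤ ky := Real.rpow_nonneg (trunc_pos hε hy0).le _
    have h1 : ks ≤ kx + y / x * kx := by
      calc ks ≤ ((1 + y / x) * trunc ε x) ^ β :=
            Real.rpow_le_rpow (trunc_pos hε (by linarith)).le (trunc_add_le hε hx0 hy0) hβ0
        _ = (1 + y / x) ^ β * kx := Real.mul_rpow (by linarith) hk.le
        _ ≤ (1 + y / x) ^ (1 : ℝ) * kx := mul_le_mul_of_nonneg_right
            (Real.rpow_le_rpow_of_exponent_le (by linarith) (by linarith)) hkx0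
        _ = _ := by rw [Real.rpow_one]; ring
    have h2 : y / x * kx ≤ ky := by
      calc y / x * kx ≤ (y / x) ^ β * kx := by
            refine mul_le_mul_of_nonneg_right ?_ hkx0
            calc y / x = (y / x) ^ (1 : ℝ) := (Real.rpow_one _).symm
              _ ≤ _ := Real.rpow_le_rpow_of_exponent_ge (by positivity) hz1 (by linarith)
        _ = (y / x * trunc ε x) ^ β := (Real.mul_rpow hz0 hk.le).symm
        _ ≤ ky := Real.rpow_le_rpow (by positivity) (div_mul_trunc_le hε hy0 hyx) hβ0
    set hx' := expWeight β ε r x with hhx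
    set hy' := expWeight β ε r y with hhy
    set hS := expWeight β ε r (x + y) with hhS
    have px : 0 < hx' := Real.exp_pos _
    have py : 0 < hy' := Real.exp_pos _
    have pS : 0 < hS := Real.exp_pos _
    have h3 : hS ≤ hx' * hy' := by
      rw [hhS, hhx, hhy, expWeight, expWeight, expWeight, ← Real.exp_add]
      refine Real.exp_le_exp.2 ?_
      have := mul_le_mul_of_nonneg_left (h1.trans (add_le_add_right h2 kx)) hr0
      linarith
    -- The inequality 1 - e^{-z} ≤ z with z = r(ks - kx).
    have h4 : hS - hx' ≤ hS * (r * (y / x * kx)) := by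
      have e1 : hx' = hS * Real.exp (r * kx - r * ks) := by
        rw [hhS, hhx, expWeight, expWeight, ← Real.exp_add]
        congr 1; ring
      have e2 := Real.add_one_le_exp (r * kx - r * ks)
      have e3 := mul_le_mul_of_nonneg_left e2 pS.le
      have e4 := mul_le_mul_of_nonneg_left h1 hr0
      have e5 := mul_le_mul_of_nonneg_left e4 pS.le
      nlinarith
    have h5 : x * (hS - hx') ≤ y * √x * hS := by
      have e0 := trunc_rpow_le_sqrt hε hβ0 hβ (hy.trans hyx)
      have e1 := mul_le_mul_of_nonneg_left h4 hx0.le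
      have e2 : x * (hS * (r * (y / x * kx))) = r * (y * kx * hS) := by field_simp
      have e3 : r * (y * kx * hS) ≤ y * kx * hS := mul_le_of_le_one_left (by positivity) hr1
      have e4 : y * kx * hS ≤ y * √x * hS := by gcongr
      linarith
    have hsq : 1 ≤ √x := Real.one_le_sqrt.2 (by linarith)
    have h6 : y * hS ≤ y * √x * hS := by
      have := mul_le_mul_of_nonneg_left hsq (show 0 ≤ y * hS by positivity)
      linarith
    have h7 : y * √x * hS ≤ y * √x * (hx' * hy') := by gcongr
    have h8 : 0 ≤ y * hy' := by positivity
    nlinarith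

/-! ### A comparison principle -/

/-- If a continuous function starting below `c` satisfies, at each time where it takes the value
`c`, an integrated differential inequality with negative right-hand side, it stays below `c`. -/
lemma lt_of_crossing {F : ℝ → ℝ} (hF : ContinuousOn F (Ici 0)) {c : ℝ} (h0 : F 0 < c)
    (hcross : ∀ T, 0 < T → F T = c → ∃ U V : ℝ → ℝ, ContinuousOn U (Ici 0) ∧
      ContinuousOn V (Ici 0) ∧ U T + V T < 0 ∧
      ∀ᶠ s in 𝓝[<] T, F T - F s ≤ (∫ τ in s..T, U τ) + (T - s) * V s) :
    ∀ t, 0 ≤ t → F t < c := by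
  intro t ht
  by_contra! hcon
  set A := Icc 0 t ∩ F ⁻¹' Ici c with hA
  have hAc : IsCompact A :=
    isCompact_Icc.of_isClosed_subset ((hF.mono Icc_subset_Ici_self).preimage_isClosed_of_isClosed
      isClosed_Icc isClosed_Ici) inter_subset_left
  have hAne : A.Nonempty := ⟨t, ⟨ht, le_rfl⟩, hcon⟩
  obtain ⟨⟨hT0, hTt⟩, hTc⟩ := hAc.sInf_mem hAne
  set T := sInf A with hTdef
  have hmin : ∀ s ∈ A, T ≤ s := fun s hs => csInf_le hAc.bddBelow hs
  have hTc' : F T = c := by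
    obtain ⟨s, hs, hsc⟩ := intermediate_value_Icc hT0 (hF.mono Icc_subset_Ici_self)
      (⟨h0.le, hTc⟩ : c ∈ Icc (F 0) (F T))
    have : T ≤ s := hmin s ⟨⟨hs.1, hs.2.trans hTt⟩, hsc.ge⟩
    rw [← hsc, le_antisymm this hs.2]
  have hTpos : 0 < T := hT0.lt_of_ne fun h => by rw [← h] at hTc'; linarith
  obtain ⟨U, V, hU, hV, hneg, hev⟩ := hcross T hTpos hTc'
  -- U and V each receive half of the margin. Then F(T) ≤ F(s) for some s just below T, against the
  -- choice of T as the first time with F ≥ c.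
  set δ := -(U T + V T) / 2 with hδ
  have hδ0 : 0 < δ := by rw [hδ]; linarith
  have hnhds : Ici (0 : ℝ) ∈ 𝓝 T := Ici_mem_nhds hTpos
  have hUe : ∀ᶠ s in 𝓝 T, U s < U T + δ :=
    (hU.continuousAt hnhds).eventually (gt_mem_nhds (by linarith))
  have hVe : ∀ᶠ s in 𝓝 T, V s < V T + δ :=
    (hV.continuousAt hnhds).eventually (gt_mem_nhds (by linarith))
  obtain ⟨l, hl, hlU⟩ : ∃ l < T, ∀ s ∈ Ioc l T, U s < U T + δ := by
    obtain ⟨l, u, hlu, hsub⟩ := mem_nhds_iff_exists_Ioo_subset.1 hUe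
    exact ⟨l, hlu.1, fun s hs => hsub ⟨hs.1, hs.2.trans_lt hlu.2⟩⟩
  have hpos : ∀ᶠ s in 𝓝[<] T, max l 0 < s :=
    eventually_nhdsWithin_of_eventually_nhds (lt_mem_nhds (max_lt hl hTpos))
  obtain ⟨s, ⟨h1, h2⟩, h3, h4⟩ := ((hev.and (eventually_nhdsWithin_of_eventually_nhds hVe)).and
    (hpos.and self_mem_nhdsWithin)).exists
  have h4' : s < T := h4
  have hs0 : 0 ≤ s := ((le_max_right _ _).trans_lt h3).le
  have hsl : l < s := (le_max_left _ _).trans_lt h3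
  have hint : ∫ τ in s..T, U τ ≤ (T - s) * (U T + δ) := by
    have : ∫ _ in s..T, (U T + δ) = (T - s) * (U T + δ) := by
      rw [intervalIntegral.integral_const, smul_eq_mul]
    rw [← this]
    refine intervalIntegral.integral_mono_on h4'.le ?_ (by simp) fun τ hτ =>
      (hlU τ ⟨hsl.trans_le hτ.1, hτ.2⟩).le
    exact (hU.mono fun τ hτ => mem_Ici.2 (hs0.trans hτ.1)).intervalIntegrable_of_Icc h4'.le
  have hV' : (T - s) * V s ≤ (T - s) * (V T + δ) :=
    mul_le_mul_of_nonneg_left h2.le (by linarith)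
  have hsum : (T - s) * (U T + δ) + (T - s) * (V T + δ) = 0 := by rw [hδ]; ring
  have hFs : c ≤ F s := by linarith
  have := hmin s ⟨⟨hs0, (h4'.le).trans hTt⟩, hFs⟩
  linarith

/-! ### Moment bounds -/

namespace IsSolution

variable {b : ℝ → ℝ} {e : ℝ} {gin : Vel N → ℝ} {g : ℝ → Vel N → ℝ}

lemma integral_min_le (hs : IsSolution b e gin g) {R : ℝ} (hR : 1 ≤ R) {t : ℝ} (ht : 0 ≤ t) :
    ∫ v, g t v * min (jap v ^ 2) R ≤ R * mass (g t) ∧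
    ∫ v, g t v * min (jap v ^ 2) R ≤ ∫ v, g t v * jap v ^ 2 := by
  have i1 := (hs.mem t ht).weight (continuous_min_jap R) 1 (abs_min_jap_le hR)
  have i2 : Integrable (g t) := by
    simpa using (hs.mem t ht).weight (w := fun _ => 1) continuous_const 1
      (fun v => by simpa using one_le_jap_sq v)
  constructor
  · rw [mass, ← integral_const_mul]
    refine integral_mono_ae i1 (i2.const_mul R) ?_
    filter_upwards [hs.nonneg t ht] with v hv
    have := mul_le_mul_of_nonneg_left (min_le_right (jap v ^ 2) R) hv
    linarith
  · refine integral_mono_ae i1 (hs.mem t ht).integrable ?_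
    filter_upwards [hs.nonneg t ht] with v hv
    exact mul_le_mul_of_nonneg_left (min_le_left (jap v ^ 2) R) hv

lemma continuousOn_moment (hs : IsSolution b e gin g) {h m : ℝ → ℝ} {D a H : ℝ}
    (W : IsWeight h m D a H) : ContinuousOn (fun t => ∫ v, g t v * weightFn h v) (Ici 0) :=
  hs.continuousOn_integral W.continuous_weightFn H W.abs_weightFn_le

/-- Uniform in time bound of the moment associated with a weight without drift loss. -/
lemma moment_le (hs : IsSolution b e gin g) (hbk : IsAngularKernel b) {b₀ b₁ : ℝ} (h0 : 0 < b₀)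
    (hb : ∀ x ∈ Icc (-1 : ℝ) 1, b₀ ≤ b x ∧ b x ≤ b₁) (he₀ : 0 ≤ e) (he₁ : e < 1)
    (hin : IsInitialDatum gin) {h m : ℝ → ℝ} {D H : ℝ} (W : IsWeight h m D 0 H)
    {c₁ G lam R : ℝ}
    (hc : c₁ = sphereArea N * b₀ * (1 - e ^ 2) / 8 * mass gin) (hc₁ : 0 < c₁)
    (hG0 : 0 ≤ G) (hG : ∀ t, 0 ≤ t → D * (∫ v, g t v * weightFn m v) ≤ D * G)
    (hlam : lam = 2 * sphereArea N * b₁ * D * G + 2 * (1 + D) + 3 * c₁)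
    (hR : 1 ≤ R) (hRl : 4 * lam ≤ c₁ * √R) {t : ℝ} (ht : 0 ≤ t) :
    ∫ v, g t v * weightFn h v ≤
      max (∫ v, g 0 v * weightFn h v) (2 * h R * (R * mass gin)) := by
  have hb1 : 0 ≤ b₁ := h0.le.trans ((hb 0 (by norm_num)).1.trans (hb 0 (by norm_num)).2)
  have hω : 0 ≤ sphereArea N := measureReal_nonneg
  have hD := W.D_nonneg
  have hlam0 : 0 < lam := by rw [hlam]; positivity
  -- Every level c strictly above the claimed maximum is a barrier: where F = c, the bound -λc + 2λ
  -- h(R) Rρ of its derivative is negative.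
  refine le_of_forall_gt_imp_ge_of_dense fun c hc' => ?_
  obtain ⟨hc1, hc2⟩ := max_lt_iff.1 hc'
  have hF := hs.continuousOn_moment W
  refine (lt_of_crossing hF hc1 (fun T hT hTc => ?_) t ht).le
  refine ⟨fun τ => -lam * (∫ v, g τ v * weightFn h v) +
      2 * lam * h R * ∫ v, g τ v * min (jap v ^ 2) R, fun _ => 0, ?_, continuousOn_const, ?_, ?_⟩
  · exact (continuousOn_const.mul hF).add (continuousOn_const.mul
      (hs.continuousOn_integral (continuous_min_jap R) 1 (abs_min_jap_le hR)))
  · have h1 := (hs.integral_min_le hR hT.le).1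
    rw [hs.mass_eq hbk he₀ he₁ hin.mem hT.le] at h1
    have hTc' : ∫ v, g T v * weightFn h v = c := hTc
    have h2 := mul_le_mul_of_nonneg_left h1
      (show 0 ≤ 2 * lam * h R by have := W.nonneg R hR; positivity)
    have h3 := mul_lt_mul_of_pos_left hc2 hlam0
    simp only [hTc', add_zero]
    linarith
  · filter_upwards [Ioo_mem_nhdsLT hT] with s hs'
    have hsub : Icc s T ⊆ Ici 0 := fun τ hτ => mem_Ici.2 (hs'.1.le.trans hτ.1)
    have := hs.moment_sub_le hbk he₀ he₁ hin W.isAdmissible hs'.1.le hs'.2.le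
      (U := fun τ => -lam * (∫ v, g τ v * weightFn h v) +
        2 * lam * h R * ∫ v, g τ v * min (jap v ^ 2) R)
      (((continuousOn_const.mul hF).add (continuousOn_const.mul
        (hs.continuousOn_integral (continuous_min_jap R) 1 (abs_min_jap_le hR)))).mono hsub)
      (fun τ hτ hprof => by
        have := W.generator_le hbk h0 hb he₀ he₁ hprof (κ := 0) le_rfl
          (by rw [hc, hs.mass_eq hbk he₀ he₁ hin.mem (hsub hτ)]) hc₁ hG0 (hG τ (hsub hτ))
          (by linarith) hlam hR hRl
        simpa using this)
    simpa using this

/-- The increment splits into a change of rate at fixed g(t), Lipschitz thanks to the second moment,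
and a change of g at the fixed rate r(t₀). The Lipschitz constant depends on ε, but it enters no
final bound. -/
lemma continuousOn_moment_expWeight (hs : IsSolution b e gin g) {β ε M : ℝ} (hε : 0 < ε)
    (hβ0 : 0 ≤ β) (hβ : β ≤ 1 / 2) {r : ℝ → ℝ} (hr : ContinuousOn r (Ici 0))
    (hr0 : ∀ t, 0 ≤ t → 0 ≤ r t) (hr1 : ∀ t, 0 ≤ t → r t ≤ 1)
    (hM : ∀ t, 0 ≤ t → ∫ v, g t v * jap v ^ 2 ≤ M) :
    ContinuousOn (fun t => ∫ v, g t v * weightFn (expWeight β ε (r t)) v) (Ici 0) := by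
  intro t₀ ht₀
  have W := fun t ht => isWeight_exp hε hβ0 hβ (hr0 t ht) (hr1 t ht)
  rw [ContinuousWithinAt, tendsto_iff_norm_sub_tendsto_zero]
  have l1 : Tendsto (fun t => expBound β ε * |r t - r t₀| * M) (𝓝[Ici 0] t₀) (𝓝 0) := by
    have := ((tendsto_iff_norm_sub_tendsto_zero.1 (hr t₀ ht₀)).const_mul
      (expBound β ε)).mul_const M
    simpa using this
  have l2 := tendsto_iff_norm_sub_tendsto_zero.1 (hs.continuousOn_moment (W t₀ ht₀) t₀ ht₀)
  have l := l1.add l2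
  rw [add_zero] at l
  refine squeeze_zero' (Eventually.of_forall fun t => norm_nonneg _) ?_ l
  filter_upwards [self_mem_nhdsWithin] with t ht
  have i1 := (hs.mem t ht).weight (W t ht).continuous_weightFn _ (W t ht).abs_weightFn_le
  have i2 := (hs.mem t ht).weight (W t₀ ht₀).continuous_weightFn _ (W t₀ ht₀).abs_weightFn_le
  have key : |(∫ v, g t v * weightFn (expWeight β ε (r t)) v) -
      ∫ v, g t v * weightFn (expWeight β ε (r t₀)) v| ≤ expBound β ε * |r t - r t₀| * M := by
    rw [← integral_sub i1 i2]
    have hle : ∀ᵐ v, ‖g t v * weightFn (expWeight β ε (r t)) v -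
        g t v * weightFn (expWeight β ε (r t₀)) v‖ ≤
        expBound β ε * |r t - r t₀| * (g t v * jap v ^ 2) := by
      filter_upwards [hs.nonneg t ht] with v hv
      have hJ : 0 < jap v ^ 2 := pow_pos (jap_pos v) 2
      obtain ⟨k1, k2⟩ := trunc_rpow_le hε hβ0 hJ
      have hexp : |expWeight β ε (r t) (jap v ^ 2) - expWeight β ε (r t₀) (jap v ^ 2)| ≤
          expBound β ε * |r t - r t₀| := by
        set z := trunc ε (jap v ^ 2) ^ β with hz
        set Z := (1 / ε) ^ β with hZ
        have aux : ∀ p q : ℝ, p ≤ 1 → Real.exp (p * z) - Real.exp (q * z) ≤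
            expBound β ε * |p - q| := fun p q hp => by
          have e1 : Real.exp (q * z) = Real.exp (p * z) * Real.exp (q * z - p * z) := by
            rw [← Real.exp_add]; congr 1; ring
          have e2 := mul_le_mul_of_nonneg_left (Real.add_one_le_exp (q * z - p * z))
            (Real.exp_pos (p * z)).le
          have e3 : Real.exp (p * z) ≤ Real.exp Z :=
            Real.exp_le_exp.2 ((mul_le_of_le_one_left k1 hp).trans k2)
          have e4 : Real.exp (p * z) - Real.exp (q * z) ≤
              Real.exp (p * z) * (z * (p - q)) := by rw [e1]; linarith
          calc _ ≤ Real.exp (p * z) * (z * (p - q)) := e4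
            _ ≤ Real.exp Z * (Z * |p - q|) := by
              have f1 : z * (p - q) ≤ z * |p - q| :=
                mul_le_mul_of_nonneg_left (le_abs_self (p - q)) k1
              have f2 : z * |p - q| ≤ Z * |p - q| :=
                mul_le_mul_of_nonneg_right k2 (abs_nonneg _)
              exact (mul_le_mul_of_nonneg_left f1 (Real.exp_pos _).le).trans
                (mul_le_mul e3 f2 (by positivity) (Real.exp_pos _).le)
            _ ≤ _ := by
              unfold expBound
              rw [← hZ]
              have := Real.exp_pos Z
              have := abs_nonneg (p - q)
              nlinarith [mul_nonneg this (Real.exp_pos Z).le]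
        rw [abs_sub_le_iff]
        exact ⟨aux _ _ (hr1 t ht), by rw [abs_sub_comm]; exact aux _ _ (hr1 t₀ ht₀)⟩
      rw [← mul_sub, weightFn, weightFn, ← mul_sub, norm_mul, norm_mul, Real.norm_eq_abs,
        Real.norm_eq_abs, Real.norm_eq_abs, abs_of_nonneg hv, abs_of_pos hJ]
      have := mul_le_mul_of_nonneg_left hexp (mul_nonneg hv hJ.le)
      linarith
    refine (norm_integral_le_of_norm_le ((hs.mem t ht).integrable.const_mul _) hle).trans ?_
    rw [integral_const_mul]
    refine mul_le_mul_of_nonneg_left (hM t ht) (mul_nonneg ?_ (abs_nonneg _))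
    unfold expBound; positivity
  exact (norm_sub_le_norm_sub_add_norm_sub _ _ _).trans (add_le_add key le_rfl)

/-- Uniform bound of exponential moments with a slowly increasing rate. -/
lemma exp_moment_lt (hs : IsSolution b e gin g) (hbk : IsAngularKernel b) {b₀ b₁ : ℝ}
    (h0 : 0 < b₀) (hb : ∀ x ∈ Icc (-1 : ℝ) 1, b₀ ≤ b x ∧ b x ≤ b₁) (he₀ : 0 ≤ e) (he₁ : e < 1)
    (hin : IsInitialDatum gin) {c₁ M lam R a κ β ε : ℝ}
    (hc : c₁ = sphereArea N * b₀ * (1 - e ^ 2) / 8 * mass gin) (hc₁ : 0 < c₁)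
    (hM0 : 0 < M) (hM : ∀ t, 0 ≤ t → ∫ v, g t v * jap v ^ 2 ≤ M)
    (hlam : lam = 2 * sphereArea N * b₁ * 2 * (5 * M) + 2 * (1 + 2) + 3 * c₁)
    (hR : 1 ≤ R) (hRl : 4 * lam ≤ c₁ * √R) (hε : 0 < ε) (hβ0 : 0 ≤ β) (hβ : β ≤ 1 / 2)
    (ha1 : a ≤ 1) (haR : a * R ≤ 1 / 2) (haκ : 2 * a + κ ≤ c₁ / 2) (hκ : 0 ≤ κ)
    {r : ℝ → ℝ} (hr : ContinuousOn r (Ici 0)) (hr0 : ∀ t, 0 ≤ t → 0 ≤ r t)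
    (hra : ∀ t, 0 ≤ t → r t ≤ a) (hrκ : ∀ s t, 0 ≤ s → s ≤ t → r t - r s ≤ κ * (t - s))
    (hinit : ∫ v, g 0 v * weightFn (expWeight β ε (r 0)) v ≤ M) {t : ℝ} (ht : 0 ≤ t) :
    ∫ v, g t v * weightFn (expWeight β ε (r t)) v < 4 * M := by
  have hb1 : 0 ≤ b₁ := h0.le.trans ((hb 0 (by norm_num)).1.trans (hb 0 (by norm_num)).2)
  have hω : 0 ≤ sphereArea N := measureReal_nonneg
  have hlam0 : 0 < lam := by rw [hlam]; positivity
  have W := fun t ht => isWeight_exp hε hβ0 hβ (hr0 t ht) ((hra t ht).trans ha1)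
  refine lt_of_crossing (hs.continuousOn_moment_expWeight hε hβ0 hβ hr hr0
    (fun t ht => (hra t ht).trans ha1) hM) (by linarith) (fun T hT hTc => ?_) t ht
  have WT := W T hT.le
  set h := expWeight β ε (r T) with hh
  have hF := hs.continuousOn_moment WT
  have hwc : Continuous fun v : Vel N => trunc ε (jap v ^ 2) ^ β * weightFn h v :=
    (continuous_comp_jap (contDiffOn_trunc_rpow hε β).continuousOn).mul WT.continuous_weightFn
  have hwle : ∀ v : Vel N, |trunc ε (jap v ^ 2) ^ β * weightFn h v| ≤
      ((1 / ε) ^ β * expBound β ε) * jap v ^ 2 := fun v => by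
    obtain ⟨k1, k2⟩ := trunc_rpow_le hε hβ0 (pow_pos (jap_pos v) 2)
    rw [abs_mul, abs_of_nonneg k1, mul_assoc]
    exact mul_le_mul k2 (WT.abs_weightFn_le v) (abs_nonneg _) (by positivity)
  have hDt := hs.continuousOn_integral hwc _ hwle
  have hU : ContinuousOn (fun τ => -lam * (∫ v, g τ v * weightFn h v) +
      2 * lam * h R * (∫ v, g τ v * min (jap v ^ 2) R) -
      κ * ∫ v, g τ v * (trunc ε (jap v ^ 2) ^ β * weightFn h v)) (Ici 0) :=
    ((continuousOn_const.mul hF).add (continuousOn_const.mul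
      (hs.continuousOn_integral (continuous_min_jap R) 1 (abs_min_jap_le hR)))).sub
      (continuousOn_const.mul hDt)
  -- U describes the evolution with the weight frozen at rate r(T), V the change of weight between
  -- the rates r(s) and r(T). Their κ terms cancel at time T.
  refine ⟨_, fun τ => κ * ∫ v, g τ v * (trunc ε (jap v ^ 2) ^ β * weightFn h v), hU,
    continuousOn_const.mul hDt, ?_, ?_⟩
  · have h1 := (hs.integral_min_le hR hT.le).2.trans (hM T hT.le)
    have hTc' : ∫ v, g T v * weightFn h v = 4 * M := hTc
    -- Smallness of the rate: aR ≤ 1/2 gives h(R) ≤ e^{1/2}. The remainder 2λ h(R) M is then below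
    -- 4λM, the damping at the barrier.
    have hhR : h R < 2 := by
      have e1 : r T * trunc ε R ^ β ≤ 1 / 2 := by
        have e2 := trunc_rpow_le_sqrt hε hβ0 hβ hR
        have e3 : √R ≤ R := Real.sqrt_le_iff.2 ⟨by linarith, by nlinarith⟩
        calc r T * trunc ε R ^ β ≤ a * R :=
              mul_le_mul (hra T hT.le) (e2.trans e3) (trunc_rpow_le hε hβ0 (by linarith)).1
                ((hr0 T hT.le).trans (hra T hT.le))
          _ ≤ _ := haR
      have e4 : h R ≤ Real.exp (1 / 2) := Real.exp_le_exp.2 e1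
      have e5 : Real.exp (1 / 2 : ℝ) < 2 := by
        have e6 : Real.exp (1 / 2 : ℝ) ^ 2 = Real.exp 1 := by
          rw [← Real.exp_nat_mul]; norm_num
        nlinarith [Real.exp_one_lt_d9, Real.exp_pos (1 / 2 : ℝ)]
      linarith
    have h2 := mul_le_mul_of_nonneg_left h1
      (show 0 ≤ 2 * lam * h R by have := WT.nonneg R hR; positivity)
    have h3 := mul_lt_mul_of_pos_left hhR (show 0 < 2 * lam * M by positivity)
    simp only [hTc']
    linarith
  · have hnear : ∀ᶠ s in 𝓝[<] T, ∀ τ ∈ Icc s T, ∫ v, g τ v * weightFn h v ≤ 5 * M := by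
      have hev : ∀ᶠ τ in 𝓝 T, ∫ v, g τ v * weightFn h v < 5 * M :=
        (hF.continuousAt (Ici_mem_nhds hT)).eventually (gt_mem_nhds (by
          have : ∫ v, g T v * weightFn h v = 4 * M := hTc
          simp only [this]; linarith))
      obtain ⟨l, u, hlu, hsub⟩ := mem_nhds_iff_exists_Ioo_subset.1 hev
      filter_upwards [Ioo_mem_nhdsLT hlu.1] with s hs' τ hτ
      exact le_of_lt (hsub ⟨hs'.1.trans_le hτ.1, hτ.2.trans_lt hlu.2⟩)
    filter_upwards [Ioo_mem_nhdsLT hT, hnear] with s hs' hG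
    have hsub : Icc s T ⊆ Ici 0 := fun τ hτ => mem_Ici.2 (hs'.1.le.trans hτ.1)
    have h1 := hs.moment_sub_le hbk he₀ he₁ hin WT.isAdmissible hs'.1.le hs'.2.le
      (hU.mono hsub) (fun τ hτ hprof => by
        have hgen := WT.generator_le hbk h0 hb he₀ he₁ hprof (κ := κ) (hr0 T hT.le)
          (by rw [hc, hs.mass_eq hbk he₀ he₁ hin.mem (hsub hτ)]) hc₁ (by positivity)
          (mul_le_mul_of_nonneg_left (hG τ hτ) (by norm_num))
          (by linarith [hra T hT.le]) hlam hR hRl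
        -- The cost of varying the rate is at most the cubic moment reserved by the κ term of
        -- `generator_le`, because β ≤ 1/2.
        have hcmp : ∫ v, g τ v * (trunc ε (jap v ^ 2) ^ β * weightFn h v) ≤
            ∫ v, g τ v * (h (jap v ^ 2) * jap v ^ 3) := by
          refine integral_mono_ae ((hs.mem τ (hsub hτ)).weight hwc _ hwle)
            (hprof.weight (WT.continuous_h.mul (continuous_jap.pow 3)) (expBound β ε) fun v => ?_)
            ?_
          · rw [abs_mul, abs_of_pos (pow_pos (jap_pos v) 3)]
            exact mul_le_mul_of_nonneg_right (WT.abs_h_le v) (pow_pos (jap_pos v) 3).le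
          · filter_upwards [hprof.nonneg] with v hv
            have k := trunc_rpow_le_sqrt hε hβ0 hβ (one_le_jap_sq v)
            rw [Real.sqrt_sq (jap_pos v).le] at k
            have hh0 := WT.nonneg _ (one_le_jap_sq v)
            have := mul_le_mul_of_nonneg_right k
              (show 0 ≤ jap v ^ 2 * h (jap v ^ 2) by positivity)
            refine mul_le_mul_of_nonneg_left ?_ hv
            rw [weightFn]
            linarith
        have := mul_le_mul_of_nonneg_left hcmp hκ
        linarith)
    have h2 : (∫ v, g s v * weightFn h v) - ∫ v, g s v * weightFn (expWeight β ε (r s)) v ≤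
        (T - s) * (κ * ∫ v, g s v * (trunc ε (jap v ^ 2) ^ β * weightFn h v)) := by
      have hm := hs.mem s hs'.1.le
      have Ws := W s hs'.1.le
      rw [← integral_sub (hm.weight WT.continuous_weightFn _ WT.abs_weightFn_le)
        (hm.weight Ws.continuous_weightFn _ Ws.abs_weightFn_le), ← mul_assoc,
        ← integral_const_mul]
      refine integral_mono_ae ((hm.weight WT.continuous_weightFn _ WT.abs_weightFn_le).sub
        (hm.weight Ws.continuous_weightFn _ Ws.abs_weightFn_le))
        ((hm.weight hwc _ hwle).const_mul _) ?_
      filter_upwards [hs.nonneg s hs'.1.le] with v hv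
      set z := trunc ε (jap v ^ 2) ^ β with hz
      have hz0 : 0 ≤ z := (trunc_rpow_le hε hβ0 (pow_pos (jap_pos v) 2)).1
      have hhpos : 0 < h (jap v ^ 2) := Real.exp_pos _
      have e1 : expWeight β ε (r s) (jap v ^ 2) = h (jap v ^ 2) * Real.exp (r s * z - r T * z) := by
        rw [hh, expWeight, expWeight, ← Real.exp_add]; congr 1; ring
      have e2 := Real.add_one_le_exp (r s * z - r T * z)
      have e3 := mul_le_mul_of_nonneg_right (hrκ s T hs'.1.le hs'.2.le) hz0
      have e4 : h (jap v ^ 2) - expWeight β ε (r s) (jap v ^ 2) ≤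
          h (jap v ^ 2) * (κ * (T - s) * z) := by
        rw [e1]
        have := mul_le_mul_of_nonneg_left
          (show 1 - Real.exp (r s * z - r T * z) ≤ κ * (T - s) * z by linarith) hhpos.le
        linarith
      have e5 := mul_le_mul_of_nonneg_left e4 (show 0 ≤ g s v * jap v ^ 2 by positivity)
      simp only [weightFn]
      linarith
    linarith

end IsSolution

/-! ### Passage to the limit and conclusion -/

/-- Fatou's lemma, used to remove the truncation of the weights. -/
lemma lintegral_le_of_tendsto {f : Vel N → ℝ} (hf : AEStronglyMeasurable f volume)
    (hf0 : ∀ᵐ v, 0 ≤ f v) {ψ : ℕ → Vel N → ℝ} {Ψ : Vel N → ℝ} (hψc : ∀ n, Continuous (ψ n))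
    (hψ0 : ∀ n v, 0 ≤ ψ n v) (hint : ∀ n, Integrable (fun v => f v * ψ n v))
    (hlim : ∀ v, Tendsto (fun n => ψ n v) atTop (𝓝 (Ψ v))) {B : ℝ}
    (hB : ∀ n, ∫ v, f v * ψ n v ≤ B) :
    ∫⁻ v, ENNReal.ofReal (f v * Ψ v) ≤ ENNReal.ofReal B := by
  have h1 : ∀ v, ENNReal.ofReal (f v * Ψ v) =
      liminf (fun n => ENNReal.ofReal (f v * ψ n v)) atTop := fun v =>
    ((ENNReal.continuous_ofReal.tendsto _).comp ((hlim v).const_mul (f v))).liminf_eq.symm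
  have h2 : ∀ n, ∫⁻ v, ENNReal.ofReal (f v * ψ n v) ≤ ENNReal.ofReal B := fun n => by
    rw [← ofReal_integral_eq_lintegral_ofReal (hint n) (by
      filter_upwards [hf0] with v hv using mul_nonneg hv (hψ0 n v))]
    exact ENNReal.ofReal_le_ofReal (hB n)
  simp only [h1]
  refine (lintegral_liminf_le' fun n =>
    (hf.mul (hψc n).aestronglyMeasurable).aemeasurable.ennreal_ofReal).trans ?_
  refine (liminf_le_liminf (Eventually.of_forall h2)).trans ?_
  simp

lemma exists_radius {c lam : ℝ} (hc : 0 < c) : ∃ R : ℝ, 1 ≤ R ∧ 4 * lam ≤ c * √R := by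
  refine ⟨max 1 ((4 * lam / c) ^ 2), le_max_left _ _, ?_⟩
  have h1 : 4 * lam / c ≤ √(max 1 ((4 * lam / c) ^ 2)) :=
    (le_abs_self _).trans (Real.abs_le_sqrt (le_max_right _ _))
  rw [div_le_iff₀ hc] at h1
  linarith

/-- The constant in front of the dissipation term. -/
noncomputable def lossConst (N : ℕ) (b₀ e ρ : ℝ) : ℝ := sphereArea N * b₀ * (1 - e ^ 2) / 8 * ρ

lemma lossConst_pos (hN : 2 ≤ N) {b₀ e ρ : ℝ} (h0 : 0 < b₀) (he₀ : 0 ≤ e) (he₁ : e < 1)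
    (hρ : 0 < ρ) : 0 < lossConst N b₀ e ρ := by
  have := sphereArea_pos hN
  have : 0 < 1 - e ^ 2 := by nlinarith
  unfold lossConst
  positivity

lemma IsInitialDatum.integral_jap_sq {gin : Vel N → ℝ} (hin : IsInitialDatum gin) :
    ∫ v, gin v * jap v ^ 2 = mass gin + energy gin := by
  have i1 : Integrable gin := by
    simpa using hin.mem.weight (w := fun _ => 1) continuous_const 1
      (fun v => by simpa using one_le_jap_sq v)
  have i2 : Integrable (fun v => gin v * ‖v‖ ^ 2) :=
    hin.mem.weight (by fun_prop) 1 fun v => by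
      rw [abs_of_nonneg (sq_nonneg _), jap_sq]; linarith
  rw [mass, energy, ← integral_add i1 i2]
  simp only [jap_sq, mul_add, mul_one]

namespace IsSolution

variable {b : ℝ → ℝ} {e : ℝ} {gin : Vel N → ℝ} {g : ℝ → Vel N → ℝ}

lemma integral_initial (hs : IsSolution b e gin g) (w : Vel N → ℝ) :
    ∫ v, g 0 v * w v = ∫ v, gin v * w v :=
  integral_congr_ae (by filter_upwards [hs.initial] with v hv; rw [hv])

/-- Degenerate case: without mass the loss constant is not positive and the main argument does not
apply, but mass conservation makes the solution vanish. -/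
lemma ae_eq_zero (hs : IsSolution b e gin g) (hbk : IsAngularKernel b) (he₀ : 0 ≤ e)
    (he₁ : e < 1) (hin : IsInitialDatum gin) (hρ : mass gin ≤ 0) {t : ℝ} (ht : 0 ≤ t) :
    ∀ᵐ v, g t v = 0 := by
  have i2 : Integrable (g t) := by
    simpa using (hs.mem t ht).weight (w := fun _ => 1) continuous_const 1
      (fun v => by simpa using one_le_jap_sq v)
  have h1 : 0 ≤ᵐ[volume] g t := hs.nonneg t ht
  have h2 : ∫ v, g t v = 0 := le_antisymm
    ((hs.mass_eq hbk he₀ he₁ hin.mem ht).le.trans hρ) (integral_nonneg_of_ae h1)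
  exact (integral_eq_zero_iff_of_nonneg_ae h1 i2).1 h2

lemma weightedNorm_eq_zero {f : Vel N → ℝ} (hf : ∀ᵐ v, f v = 0) (s : ℝ) :
    weightedNorm s f = 0 := by
  unfold weightedNorm
  rw [lintegral_congr_ae (g := fun _ => 0) (by filter_upwards [hf] with v hv; simp [hv])]
  simp

lemma expMoment_eq_zero {f : Vel N → ℝ} (hf : ∀ᵐ v, f v = 0) (r η : ℝ) :
    expMoment r η f = 0 := by
  unfold expMoment
  rw [lintegral_congr_ae (g := fun _ => 0) (by filter_upwards [hf] with v hv; simp [hv])]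
  simp

end IsSolution

/-! ### Uniform bounds for second, polynomial and exponential moments -/

/-- Uniform bound of the mass and energy. -/
lemma exists_second_moment_bound (hN : 2 ≤ N) {b : ℝ → ℝ} (hbk : IsAngularKernel b) {e : ℝ}
    (he₀ : 0 ≤ e) (he₁ : e < 1) {ρ : ℝ} (hρ : 0 < ρ) (E : ℝ) :
    ∃ M : ℝ, 0 < M ∧ ∀ (gin : Vel N → ℝ) (g : ℝ → Vel N → ℝ), IsInitialDatum gin →
      mass gin = ρ → energy gin = E → IsSolution b e gin g →
      ∀ t, 0 ≤ t → ∫ v, g t v * jap v ^ 2 ≤ M := by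
  obtain ⟨b₀, b₁, h0, hb⟩ := hbk.bounds
  have hc := lossConst_pos hN h0 he₀ he₁ hρ
  obtain ⟨R, hR, hRl⟩ := exists_radius (lam := 2 + 3 * lossConst N b₀ e ρ) hc
  refine ⟨max (ρ + E) (2 * (R * ρ)), lt_max_of_lt_right (by positivity), ?_⟩
  intro gin g hin hmass hE hs t ht
  have h := hs.moment_le hbk h0 hb he₀ he₁ hin isWeight_one (G := 0)
    (by rw [hmass]; rfl) hc le_rfl (by simp) (by ring) hR hRl ht
  simp only [weightFn, mul_one] at h
  rwa [hs.integral_initial (fun v => jap v ^ 2), hin.integral_jap_sq, hmass, hE] at h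

/-- Propagation of polynomial moments. -/
theorem exists_weightedNorm_bound (hN : 2 ≤ N) {b : ℝ → ℝ} (hbk : IsAngularKernel b) {e : ℝ}
    (he₀ : 0 ≤ e) (he₁ : e < 1) {ρ : ℝ} (hρ : 0 < ρ) (E : ℝ) {s : ℝ} (hs2 : 2 ≤ s) :
    ∃ C : ℝ, 0 < C ∧ ∀ (gin : Vel N → ℝ) (g : ℝ → Vel N → ℝ), IsInitialDatum gin →
      mass gin = ρ → energy gin = E → IsSolution b e gin g →
      ∀ t, 0 ≤ t → weightedNorm s (g t) ≤ max (weightedNorm s gin) (ENNReal.ofReal C) := by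
  obtain ⟨M, hM0, hM⟩ := exists_second_moment_bound hN hbk he₀ he₁ hρ E
  obtain ⟨b₀, b₁, h0, hb⟩ := hbk.bounds
  have hc := lossConst_pos hN h0 he₀ he₁ hρ
  -- The exponent for which ⟨v⟩² (⟨v⟩²)^q = ⟨v⟩^s.
  set q := s / 2 - 1 with hq
  have hq0 : 0 ≤ q := by rw [hq]; linarith
  obtain ⟨R, hR, hRl⟩ := exists_radius (lam := 2 * sphereArea N * b₁ * polyConst q * M +
    2 * (1 + polyConst q) + 3 * lossConst N b₀ e ρ) hc
  have hR0 : 0 < R := by linarith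
  refine ⟨2 * R ^ q * (R * ρ), by positivity, ?_⟩
  intro gin g hin hmass hE hs t ht
  rcases eq_or_ne (weightedNorm s gin) ⊤ with htop | htop
  · rw [htop]; simp
  set ε : ℕ → ℝ := fun n => 1 / ((n : ℝ) + 1) with hε
  have hε0 : ∀ n, 0 < ε n := fun n => by rw [hε]; positivity
  have W := fun n => isWeight_poly (hε0 n) hq0
  have hψ0 : ∀ n (v : Vel N), 0 ≤ weightFn (fun x => trunc (ε n) x ^ q) v := fun n v =>
    mul_nonneg (sq_nonneg _) ((W n).nonneg _ (one_le_jap_sq v))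
  have hΨ : ∀ v : Vel N, (1 + ‖v‖ ^ 2) ^ (s / 2) = jap v ^ 2 * (jap v ^ 2) ^ q := fun v => by
    have hJ : 0 < jap v ^ 2 := pow_pos (jap_pos v) 2
    rw [← jap_sq, mul_comm, ← Real.rpow_add_one hJ.ne']
    congr 1; rw [hq]; ring
  have hψle : ∀ n (v : Vel N), weightFn (fun x => trunc (ε n) x ^ q) v ≤
      (1 + ‖v‖ ^ 2) ^ (s / 2) := fun n v => by
    have hJ : 0 < jap v ^ 2 := pow_pos (jap_pos v) 2
    rw [hΨ]
    exact mul_le_mul_of_nonneg_left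
      (Real.rpow_le_rpow (trunc_pos (hε0 n) hJ).le (trunc_le_self (hε0 n) hJ) hq0) hJ.le
  have hinit : ∀ n, ∫ v, g 0 v * weightFn (fun x => trunc (ε n) x ^ q) v ≤
      (weightedNorm s gin).toReal := fun n => by
    rw [hs.integral_initial]
    refine (ENNReal.ofReal_le_iff_le_toReal htop).1 ?_
    rw [ofReal_integral_eq_lintegral_ofReal
      (hin.mem.weight (W n).continuous_weightFn _ (W n).abs_weightFn_le) (by
        filter_upwards [hin.nonneg] with v hv using mul_nonneg hv (hψ0 n v))]
    refine lintegral_mono fun v => ENNReal.ofReal_le_ofReal ?_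
    exact mul_le_mul (le_abs_self _) (hψle n v) (hψ0 n v) (abs_nonneg _)
  have hbound : ∀ n, ∫ v, g t v * weightFn (fun x => trunc (ε n) x ^ q) v ≤
      max (weightedNorm s gin).toReal (2 * R ^ q * (R * ρ)) := fun n => by
    have h := hs.moment_le hbk h0 hb he₀ he₁ hin (W n) (G := M)
      (by rw [hmass]; rfl) hc hM0.le
      (fun τ hτ => mul_le_mul_of_nonneg_left
        (by simpa [weightFn] using hM gin g hin hmass hE hs τ hτ) (W n).D_nonneg)
      rfl hR hRl ht
    refine h.trans (max_le_max (hinit n) ?_)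
    rw [hmass]
    have := Real.rpow_le_rpow (trunc_pos (hε0 n) hR0).le (trunc_le_self (hε0 n) hR0) hq0
    gcongr
  have hfin := lintegral_le_of_tendsto (hs.mem t ht).1 (hs.nonneg t ht)
    (fun n => (W n).continuous_weightFn) hψ0
    (fun n => (hs.mem t ht).weight (W n).continuous_weightFn _ (W n).abs_weightFn_le)
    (Ψ := fun v => (1 + ‖v‖ ^ 2) ^ (s / 2)) (fun v => by
      rw [hΨ]
      exact ((tendsto_trunc _).rpow_const (Or.inr hq0)).const_mul _) hbound
  rw [ENNReal.ofReal_max, ENNReal.ofReal_toReal htop] at hfin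
  refine le_trans (le_of_eq ?_) hfin
  refine lintegral_congr_ae ?_
  filter_upwards [hs.nonneg t ht] with v hv
  rw [abs_of_nonneg hv]

/-- Exponential moments with a slowly varying rate stay bounded. -/
lemma exists_exp_rate (hN : 2 ≤ N) {b : ℝ → ℝ} (hbk : IsAngularKernel b) {e : ℝ}
    (he₀ : 0 ≤ e) (he₁ : e < 1) {ρ M a₀ τ : ℝ} (hρ : 0 < ρ) (hM0 : 0 < M) (ha₀ : 0 < a₀)
    (hτ : 0 < τ) :
    ∃ a : ℝ, 0 < a ∧ a ≤ a₀ ∧ ∀ (gin : Vel N → ℝ) (g : ℝ → Vel N → ℝ), IsInitialDatum gin →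
      mass gin = ρ → IsSolution b e gin g → (∀ t, 0 ≤ t → ∫ v, g t v * jap v ^ 2 ≤ M) →
      ∀ β : ℝ, 0 ≤ β → β ≤ 1 / 2 → ∀ r : ℝ → ℝ, Continuous r → (∀ t, 0 ≤ t → 0 ≤ r t) →
      (∀ t, 0 ≤ t → r t ≤ a) → (∀ s t, 0 ≤ s → s ≤ t → r t - r s ≤ a / τ * (t - s)) →
      (∀ ε, 0 < ε → ∫ v, gin v * weightFn (expWeight β ε (r 0)) v ≤ M) →
      ∀ t, 0 ≤ t → ∫⁻ v, ENNReal.ofReal (g t v * (jap v ^ 2 *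
        Real.exp (r t * (jap v ^ 2) ^ β))) ≤ ENNReal.ofReal (4 * M) := by
  obtain ⟨b₀, b₁, h0, hb⟩ := hbk.bounds
  have hc := lossConst_pos hN h0 he₀ he₁ hρ
  obtain ⟨R, hR, hRl⟩ := exists_radius (lam := 2 * sphereArea N * b₁ * 2 * (5 * M) +
    2 * (1 + 2) + 3 * lossConst N b₀ e ρ) hc
  have hR0 : 0 < R := by linarith
  -- The bound a ≤ k amounts to 2a + κ ≤ c₁/2 for κ = a/τ. Neither λ nor R involves a, so a may be
  -- chosen after them.
  set k := lossConst N b₀ e ρ / 2 / (2 + 1 / τ) with hk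
  have hk0 : 0 < k := by positivity
  refine ⟨min (min a₀ 1) (min (1 / (2 * R)) k), by positivity,
    (min_le_left _ _).trans (min_le_left _ _), ?_⟩
  set a := min (min a₀ 1) (min (1 / (2 * R)) k) with ha
  have ha0 : 0 < a := by rw [ha]; positivity
  have ha1 : a ≤ 1 := (min_le_left _ _).trans (min_le_right _ _)
  have haR : a * R ≤ 1 / 2 := by
    have h1 : a ≤ 1 / (2 * R) := (min_le_right _ _).trans (min_le_left _ _)
    calc a * R ≤ 1 / (2 * R) * R := by gcongr
      _ = 1 / 2 := by field_simp
  have hak : 2 * a + a / τ ≤ lossConst N b₀ e ρ / 2 := by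
    have h1 : a ≤ k := (min_le_right _ _).trans (min_le_right _ _)
    rw [hk, le_div_iff₀ (by positivity)] at h1
    calc 2 * a + a / τ = a * (2 + 1 / τ) := by ring
      _ ≤ _ := h1
  intro gin g hin hmass hs hM β hβ0 hβ r hr hr0 hra hrκ hinit t ht
  set ε : ℕ → ℝ := fun n => 1 / ((n : ℝ) + 1) with hε
  have hε0 : ∀ n, 0 < ε n := fun n => by rw [hε]; positivity
  have W := fun n => isWeight_exp (hε0 n) hβ0 hβ (hr0 t ht) ((hra t ht).trans ha1)
  refine lintegral_le_of_tendsto (hs.mem t ht).1 (hs.nonneg t ht)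
    (ψ := fun n => weightFn (expWeight β (ε n) (r t)))
    (fun n => (W n).continuous_weightFn)
    (fun n v => mul_nonneg (sq_nonneg _) (Real.exp_pos _).le)
    (fun n => (hs.mem t ht).weight (W n).continuous_weightFn _ (W n).abs_weightFn_le)
    (fun v => ?_) (fun n => ?_)
  · exact ((Real.continuous_exp.tendsto _).comp
      (((tendsto_trunc _).rpow_const (Or.inr hβ0)).const_mul (r t))).const_mul _
  · exact (hs.exp_moment_lt hbk h0 hb he₀ he₁ hin (by rw [hmass]; rfl) hc hM0 hM rfl hR hRl
      (hε0 n) hβ0 hβ ha1 haR hak (by positivity) hr.continuousOn hr0 hra hrκ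
      (by rw [hs.integral_initial]; exact hinit _ (hε0 n)) ht).le

lemma expMoment_le_lintegral {f : Vel N → ℝ} (hf : ∀ᵐ v, 0 ≤ f v) {a η : ℝ} (ha : 0 ≤ a)
    (hη : 0 ≤ η) : expMoment a η f ≤
      ∫⁻ v, ENNReal.ofReal (f v * (jap v ^ 2 * Real.exp (a * (jap v ^ 2) ^ (η / 2)))) := by
  refine lintegral_mono_ae ?_
  filter_upwards [hf] with v hv
  refine ENNReal.ofReal_le_ofReal (mul_le_mul_of_nonneg_left ?_ hv)
  have h1 : ‖v‖ ^ η ≤ (jap v ^ 2) ^ (η / 2) := by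
    rw [jap_sq, jap_rpow]
    exact Real.rpow_le_rpow (norm_nonneg v) (norm_le_jap v) hη
  have h2 : Real.exp (a * ‖v‖ ^ η) ≤ Real.exp (a * (jap v ^ 2) ^ (η / 2)) :=
    Real.exp_le_exp.2 (mul_le_mul_of_nonneg_left h1 ha)
  exact h2.trans (le_mul_of_one_le_left (Real.exp_pos _).le (one_le_jap_sq v))

lemma jap_rpow_le (v : Vel N) {η : ℝ} (hη : 0 < η) (hη1 : η ≤ 1) :
    jap v ^ η ≤ 2 + 2 * ‖v‖ ^ η := by
  have h2 : (2 : ℝ) ^ η ≤ 2 := by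
    calc (2 : ℝ) ^ η ≤ 2 ^ (1 : ℝ) := Real.rpow_le_rpow_of_exponent_le (by norm_num) hη1
      _ = 2 := Real.rpow_one 2
  have hv := norm_nonneg v
  have hvη : 0 ≤ ‖v‖ ^ η := Real.rpow_nonneg hv η
  have hJ : jap v ≤ ‖v‖ + 1 := by
    rw [jap, Real.sqrt_le_left (by positivity)]
    nlinarith
  rcases le_total ‖v‖ 1 with h | h
  · have : jap v ^ η ≤ 2 ^ η := Real.rpow_le_rpow (jap_pos v).le (by linarith) hη.le
    linarith
  · have h3 : jap v ^ η ≤ (2 * ‖v‖) ^ η := Real.rpow_le_rpow (jap_pos v).le (by linarith) hη.le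
    rw [Real.mul_rpow (by norm_num) hv] at h3
    have := mul_le_mul_of_nonneg_right h2 hvη
    linarith

/-- With z = ⟨v⟩^η, the factor ⟨v⟩² is absorbed by a second copy of e^{rz/8}. As z ≤ 2 + 2|v|^η, the
total exponent rz/4 is at most r/2 + (r/2)|v|^η. -/
lemma exists_exp_weight_le (N : ℕ) {r η : ℝ} (hr : 0 < r) (hη : 0 < η) (hη1 : η ≤ 1) :
    ∃ K : ℝ, ∀ v : Vel N, jap v ^ 2 * Real.exp (r / 8 * (jap v ^ 2) ^ (η / 2)) ≤
      K * Real.exp (r * ‖v‖ ^ η) := by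
  set n := ⌈2 / η⌉₊ with hn
  refine ⟨(n.factorial : ℝ) / (r / 8) ^ n * Real.exp (r / 2), fun v => ?_⟩
  have hz : (jap v ^ 2) ^ (η / 2) = jap v ^ η := by rw [jap_sq, jap_rpow]
  rw [hz]
  set z := jap v ^ η with hzdef
  have hz1 : 1 ≤ z := Real.one_le_rpow (one_le_jap v) hη.le
  have h1 : jap v ^ 2 ≤ z ^ n := by
    calc jap v ^ 2 = z ^ (2 / η) := by
          rw [hzdef, ← Real.rpow_mul (jap_pos v).le, mul_div_cancel₀ _ hη.ne']
          norm_num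
      _ ≤ z ^ ((n : ℕ) : ℝ) := Real.rpow_le_rpow_of_exponent_le hz1 (Nat.le_ceil _)
      _ = z ^ n := Real.rpow_natCast _ _
  have h2 : z ^ n ≤ (n.factorial : ℝ) / (r / 8) ^ n * Real.exp (r / 8 * z) := by
    have h3 := Real.pow_div_factorial_le_exp _ (show 0 ≤ r / 8 * z by positivity) n
    rw [mul_pow, div_le_iff₀ (by positivity)] at h3
    rw [div_mul_eq_mul_div, le_div_iff₀ (by positivity)]
    linarith
  have h4 : Real.exp (r / 8 * z) * Real.exp (r / 8 * z) ≤
      Real.exp (r / 2) * Real.exp (r * ‖v‖ ^ η) := by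
    rw [← Real.exp_add, ← Real.exp_add]
    refine Real.exp_le_exp.2 ?_
    have h5 := jap_rpow_le v hη hη1
    have h6 : 0 ≤ r * ‖v‖ ^ η := mul_nonneg hr.le (Real.rpow_nonneg (norm_nonneg v) η)
    have h7 := mul_le_mul_of_nonneg_left h5 hr.le
    linarith
  calc jap v ^ 2 * Real.exp (r / 8 * z)
      ≤ (n.factorial : ℝ) / (r / 8) ^ n * Real.exp (r / 8 * z) * Real.exp (r / 8 * z) := by
        gcongr; exact h1.trans h2
    _ = (n.factorial : ℝ) / (r / 8) ^ n * (Real.exp (r / 8 * z) * Real.exp (r / 8 * z)) := by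
        ring
    _ ≤ (n.factorial : ℝ) / (r / 8) ^ n * (Real.exp (r / 2) * Real.exp (r * ‖v‖ ^ η)) := by
        gcongr
    _ = _ := by ring

/-- Propagation of exponential moments. -/
theorem exists_expMoment_bound (hN : 2 ≤ N) {b : ℝ → ℝ} (hbk : IsAngularKernel b) {e : ℝ}
    (he₀ : 0 ≤ e) (he₁ : e < 1) {gin : Vel N → ℝ} {r η : ℝ} (hin : IsInitialDatum gin)
    (hr : 0 < r) (hη : 0 < η) (hη1 : η ≤ 1)
    (hint : Integrable (fun v => gin v * Real.exp (r * ‖v‖ ^ η))) :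
    ∃ C₁ r' : ℝ, 0 < C₁ ∧ 0 < r' ∧ ∀ g : ℝ → Vel N → ℝ, IsSolution b e gin g →
      ∀ t : ℝ, 0 ≤ t → expMoment r' η (g t) ≤ ENNReal.ofReal C₁ := by
  rcases le_or_gt (mass gin) 0 with hρ | hρ
  · refine ⟨1, 1, one_pos, one_pos, fun g hs t ht => ?_⟩
    rw [IsSolution.expMoment_eq_zero (hs.ae_eq_zero hbk he₀ he₁ hin hρ ht)]
    exact zero_le
  obtain ⟨M₀, hM₀, hM⟩ := exists_second_moment_bound hN hbk he₀ he₁ hρ (energy gin)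
  obtain ⟨K, hK⟩ := exists_exp_weight_le N hr hη hη1
  set w : Vel N → ℝ := fun v => jap v ^ 2 * Real.exp (r / 8 * (jap v ^ 2) ^ (η / 2)) with hw
  have hwc : Continuous w := (continuous_jap.pow 2).mul (Real.continuous_exp.comp
    (continuous_const.mul ((continuous_jap.pow 2).rpow_const fun v => Or.inr (by positivity))))
  have hw0 : ∀ v, 0 ≤ w v := fun v => mul_nonneg (sq_nonneg _) (Real.exp_pos _).le
  have hwi : Integrable (fun v => gin v * w v) :=
    integrable_of_weight_le hin.mem.1 hwc hint K fun v => by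
      rw [abs_of_nonneg (hw0 v), abs_of_pos (Real.exp_pos _)]; exact hK v
  -- M is fixed with the rate r/8 before a ≤ r/8 is chosen in terms of M; lowering the rate only
  -- decreases the initial moment.
  set M := max M₀ (∫ v, gin v * w v) with hMdef
  have hM0 : 0 < M := lt_max_of_lt_left hM₀
  obtain ⟨a, ha0, har, ha⟩ := exists_exp_rate hN hbk he₀ he₁ hρ hM0
    (show 0 < min (r / 8) 1 by positivity) one_pos
  have ha1 : a ≤ 1 := har.trans (min_le_right _ _)
  have har8 : a ≤ r / 8 := har.trans (min_le_left _ _)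
  refine ⟨4 * M, a, by positivity, ha0, fun g hs t ht => ?_⟩
  refine (expMoment_le_lintegral (hs.nonneg t ht) ha0.le hη.le).trans ?_
  refine ha gin g hin rfl hs (fun t ht => (hM gin g hin rfl rfl hs t ht).trans (le_max_left _ _))
    (η / 2) (by positivity) (by linarith) (fun _ => a) continuous_const (fun _ _ => ha0.le)
    (fun _ _ => le_rfl) (fun s t _ hst => ?_) (fun ε hε => ?_) t ht
  · rw [sub_self]
    exact mul_nonneg (by positivity) (by linarith)
  · have W := isWeight_exp hε (show 0 ≤ η / 2 by positivity) (by linarith) ha0.le ha1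
    refine le_max_of_le_right (integral_mono_ae
      (hin.mem.weight W.continuous_weightFn _ W.abs_weightFn_le) hwi ?_)
    filter_upwards [hin.nonneg] with v hv
    have hJ : 0 < jap v ^ 2 := pow_pos (jap_pos v) 2
    refine mul_le_mul_of_nonneg_left (mul_le_mul_of_nonneg_left (Real.exp_le_exp.2 ?_) hJ.le) hv
    exact mul_le_mul har8 (Real.rpow_le_rpow (trunc_pos hε hJ).le (trunc_le_self hε hJ)
      (by positivity)) (Real.rpow_nonneg (trunc_pos hε hJ).le _) (by positivity)

/-- Appearance of exponential moments. -/
theorem exists_expMoment_appearance (hN : 2 ≤ N) {b : ℝ → ℝ} (hbk : IsAngularKernel b) {e : ℝ}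
    (he₀ : 0 ≤ e) (he₁ : e < 1) {ρ : ℝ} (hρ : 0 < ρ) (E : ℝ) {η τ : ℝ} (hη : 0 < η)
    (hη1 : η ≤ 1) (hτ : 0 < τ) :
    ∃ a C : ℝ, 0 < a ∧ 0 < C ∧ ∀ (gin : Vel N → ℝ) (g : ℝ → Vel N → ℝ), IsInitialDatum gin →
      mass gin = ρ → energy gin = E → IsSolution b e gin g →
      ∀ t : ℝ, τ ≤ t → expMoment a η (g t) ≤ ENNReal.ofReal C := by
  obtain ⟨M, hM0, hM⟩ := exists_second_moment_bound hN hbk he₀ he₁ hρ E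
  obtain ⟨a, ha0, -, ha⟩ := exists_exp_rate hN hbk he₀ he₁ hρ hM0 one_pos hτ
  refine ⟨a, 4 * M, ha0, by positivity, fun gin g hin hmass hE hs t ht => ?_⟩
  have ht0 : 0 ≤ t := hτ.le.trans ht
  refine (expMoment_le_lintegral (hs.nonneg t ht0) ha0.le hη.le).trans ?_
  -- The rate a min(1, t/τ) is 0 initially, where the moment is just the second moment, has slope at
  -- most a/τ, and equals a from time τ on.
  have h := ha gin g hin hmass hs (hM gin g hin hmass hE hs) (η / 2) (by positivity)
    (by linarith) (fun t => a * min 1 (t / τ)) (by fun_prop)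
    (fun t ht => mul_nonneg ha0.le (le_min zero_le_one (by positivity)))
    (fun t _ => mul_le_of_le_one_right ha0.le (min_le_left _ _)) (fun s t _ hst => ?_)
    (fun ε hε => ?_) t ht0
  · have h1 : min 1 (t / τ) = 1 := min_eq_left ((one_le_div hτ).2 ht)
    simpa [h1] using h
  · have h1 : min 1 (t / τ) ≤ min 1 (s / τ) + (t - s) / τ := by
      have h2 : 0 ≤ (t - s) / τ := div_nonneg (by linarith) hτ.le
      rcases le_total 1 (s / τ) with h3 | h3
      · rw [min_eq_left h3]; linarith [min_le_left 1 (t / τ)]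
      · rw [min_eq_right h3, ← add_div, add_sub_cancel]; exact min_le_right _ _
    have h4 := mul_le_mul_of_nonneg_left h1 ha0.le
    have h5 : a / τ * (t - s) = a * ((t - s) / τ) := by ring
    rw [h5]
    linarith
  · have h1 : (fun v : Vel N => gin v * weightFn (expWeight (η / 2) ε (a * min 1 (0 / τ))) v) =
        fun v => gin v * jap v ^ 2 := by
      funext v; simp [weightFn, expWeight]
    simp only [h1]
    have h2 := hM gin g hin hmass hE hs 0 le_rfl
    rwa [hs.integral_initial (fun v => jap v ^ 2)] at h2

end Granular

theorem proposition3p1 (N : ℕ) (hN : 2 ≤ N) (b : ℝ → ℝ) (hb : Granular.IsAngularKernel b)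
    (e : ℝ) (he₀ : 0 ≤ e) (he₁ : e < 1) :
    -- (i) propagation of polynomial moments
    (∀ ρ E s : ℝ, 2 ≤ s → ∃ C : ℝ, 0 < C ∧
      ∀ (gin : Granular.Vel N → ℝ) (g : ℝ → Granular.Vel N → ℝ),
        Granular.IsInitialDatum gin → Granular.mass gin = ρ → Granular.energy gin = E →
        Granular.IsSolution b e gin g →
        ∀ t : ℝ, 0 ≤ t → Granular.weightedNorm s (g t) ≤
          max (Granular.weightedNorm s gin) (ENNReal.ofReal C)) ∧
    -- (ii) propagation of exponential moments
    (∀ (gin : Granular.Vel N → ℝ) (r η : ℝ), Granular.IsInitialDatum gin →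
      0 < r → 0 < η → η ≤ 1 →
      MeasureTheory.Integrable (fun v => gin v * Real.exp (r * ‖v‖ ^ η)) →
      ∃ C₁ r' : ℝ, 0 < C₁ ∧ 0 < r' ∧
        ∀ g : ℝ → Granular.Vel N → ℝ, Granular.IsSolution b e gin g →
          ∀ t : ℝ, 0 ≤ t → Granular.expMoment r' η (g t) ≤ ENNReal.ofReal C₁) ∧
    -- (iii) appearance of exponential moments
    (∀ ρ E η τ : ℝ, 0 < η → η < 1 / 2 → 0 < τ → ∃ a C : ℝ, 0 < a ∧ 0 < C ∧
      ∀ (gin : Granular.Vel N → ℝ) (g : ℝ → Granular.Vel N → ℝ),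
        Granular.IsInitialDatum gin → Granular.mass gin = ρ → Granular.energy gin = E →
        Granular.IsSolution b e gin g →
        ∀ t : ℝ, τ ≤ t → Granular.expMoment a η (g t) ≤ ENNReal.ofReal C) := by
  refine ⟨fun ρ E s hs2 => ?_, fun gin r η hin hr hη hη1 hint =>
    Granular.exists_expMoment_bound hN hb he₀ he₁ hin hr hη hη1 hint, fun ρ E η τ hη hη2 hτ => ?_⟩
  · rcases le_or_gt ρ 0 with hρ | hρ
    · refine ⟨1, one_pos, fun gin g hin hmass _ hs t ht => ?_⟩
      rw [Granular.IsSolution.weightedNorm_eq_zero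
        (hs.ae_eq_zero hb he₀ he₁ hin (hmass.le.trans hρ) ht)]
      exact zero_le
    · exact Granular.exists_weightedNorm_bound hN hb he₀ he₁ hρ E hs2
  · rcases le_or_gt ρ 0 with hρ | hρ
    · refine ⟨1, 1, one_pos, one_pos, fun gin g hin hmass _ hs t ht => ?_⟩
      rw [Granular.IsSolution.expMoment_eq_zero
        (hs.ae_eq_zero hb he₀ he₁ hin (hmass.le.trans hρ) (hτ.le.trans ht))]
      exact zero_le
    -- The argument reaches every η ≤ 1, hence in particular η < 1/2.
    · exact Granular.exists_expMoment_appearance hN hb he₀ he₁ hρ E hη (by linarith) hτ
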